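/- **Theorem (period of the degree-13 mirror family).** For $t\in\mathbb C$ let $N_t$ be the skew-symmetric matrix $$ N_{t} = \begin{pmatrix} 0 & tx_{0}^{2} & x_{5}x_{6} & x_{3}x_{4} & tx_{2}^{2} \\ -tx_{0}^{2} & 0 & t(x_{3}+x_{4})& x_{2} & x_{1} \\ -x_{5}x_{6} & -t(x_{3}+x_{4}) & 0 & tx_{1} & x_{0} \\ -x_{3}x_{4} & -x_{2} & -tx_{1} & 0 & t(x_{5}+x_{6}) \\ -tx_{2}^{2} & -x_{1} & -x_{0} & -t(x_{5}+x_{6}) & 0 \end{pmatrix}, $$ let $P_i$ be the Pfaffian (with the sign convention $\mathrm{Pf}(A)=a_{13}a_{24}-a_{12}a_{34}-a_{14}a_{23}$) of $N_t$ with the $i$-th row and column removed, and let $\check X_t=\{P_1=\dots=P_5=0\}\subset\mathbb P^6$ (Bœhm's family). Put $$\Omega_0=\frac1{(2\pi i)^6}\sum_{i=0}^6(-1)^ix_i\,dx_0\wedge\dots\wedge\widehat{dx_i}\wedge\dots\wedge dx_6,\qquad \alpha=\mathrm{Res}_{\check X_t}\frac{x_5x_6\,\Omega_0}{P_2P_4P_5},$$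 where the residue is normalised so that its integral over a cycle equals the integral of the six-form over the tube around the cycle; that is, $dP_2\wedge dP_4\wedge dP_5\wedge\alpha=(2\pi i)^3x_5x_6\,\Omega_0$ along $\check X_t$. Let $\varepsilon>0$. 1. There is $\delta>0$ such that the torus $|x_4/x_0|=|x_5/x_0|=|x_6/x_0|=\varepsilon$ in the plane $x_1=x_2=x_3=0$, which lies in $\check X_0$, extends for $|t|<\delta$ to a family of $C^1$ parametrised tori $\gamma=\gamma_t\subset\check X_t$, continuous in $t$, with the same values of $x_4/x_0,x_5/x_0,x_6/x_0$ on it. 2. For every such family $\gamma_t$, the period $\Phi_0(t)=\int_{\gamma_t}\alpha$ is given for all $t$ near $0$ by the convergent series $$\Phi_0(t)=\sum_{n=0}^\infty\binom{2n}{n}^2\sum_{k=0}^n\binom{2n+k}{n}\binom nk^2\,t^{7n}.$$ Hence near $t=0$ it is $\Phi_0=\Phi(\phi)$ with $\phi=t^7$ and $\Phi$ holomorphic near $\phi=0$. With $\Theta=\phi\frac{d}{d\phi}$, the fourth-order operator (No. 99 in the table of Calabi–Yau equations) $$\begin{aligned}\mathscr D=\;&13^{2}\Theta^{4}-\phi(59397\Theta^{4}+117546\Theta^{3}+86827\Theta^{2}+28054\Theta+3380)\\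 &+2^{4}\phi^{2}(6386\Theta^{4}-1774\Theta^{3}-17898\Theta^{2}-11596\Theta-2119)\\ &+2^{8}\phi^{3}(67\Theta^{4}+1248\Theta^{3}+1091\Theta^{2}+312\Theta+26)-2^{12}\phi^{4}(2\Theta+1)^{4}\end{aligned}$$ is the Picard–Fuchs operator of the period: $\mathscr D\Phi=0$ near $0$, and no nonzero differential operator of order less than $4$ with coefficients in $\mathbb C[\phi]$ annihilates $\Phi$ near $0$. 3. If $s^7=t^7$, then some projective linear automorphism of $\mathbb P^6$ maps $\check X_s$ onto $\check X_t$. -/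

import Mathlib

open Filter Topology
open scoped LinearAlgebra.Projectivization

/-! ### The family of degree-13 Pfaffians -/

/-- The Pfaffian of a skew-symmetric `4 × 4` matrix, with the sign convention
`Pf A = 1 / (2! 2²) ∑ σ, sign σ * A (σ 1) (σ 3) * A (σ 2) (σ 4)`. -/
def pf4 {R : Type*} [CommRing R] (A : Matrix (Fin 4) (Fin 4) R) : R :=
  A 0 2 * A 1 3 - A 0 1 * A 2 3 - A 0 3 * A 1 2

/-- The homogeneous coordinate `x_i` on `ℙ⁶`. -/
noncomputable def co (i : Fin 7) : MvPolynomial (Fin 7) ℂ := MvPolynomial.X i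

/-- The skew-symmetric matrix `N_t`. -/
noncomputable def skewN (t : ℂ) : Matrix (Fin 5) (Fin 5) (MvPolynomial (Fin 7) ℂ) :=
  let T : MvPolynomial (Fin 7) ℂ := MvPolynomial.C t
  !![0, T * co 0 ^ 2, co 5 * co 6, co 3 * co 4, T * co 2 ^ 2;
     -(T * co 0 ^ 2), 0, T * (co 3 + co 4), co 2, co 1;
     -(co 5 * co 6), -(T * (co 3 + co 4)), 0, T * co 1, co 0;
     -(co 3 * co 4), -(co 2), -(T * co 1), 0, T * (co 5 + co 6);
     -(T * co 2 ^ 2), -(co 1), -(co 0), -(T * (co 5 + co 6)), 0]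

/-- The Pfaffian of `N_t` with its `i`-th row and column removed. The indices start at `0`:
`pfaff t i` is usually written `P_{i+1}`. -/
noncomputable def pfaff (t : ℂ) (i : Fin 5) : MvPolynomial (Fin 7) ℂ :=
  pf4 ((skewN t).submatrix i.succAbove i.succAbove)

/-- The five Pfaffians, written out. -/
theorem eval_pfaff (t : ℂ) (x : Fin 7 → ℂ) :
    MvPolynomial.eval x (pfaff t 0)
      = x 0 * x 2 - t * x 1 ^ 2 - t ^ 2 * (x 3 + x 4) * (x 5 + x 6) ∧
    MvPolynomial.eval x (pfaff t 1)
      = x 0 * x 3 * x 4 - t * x 5 * x 6 * (x 5 + x 6) - t ^ 2 * x 1 * x 2 ^ 2 ∧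
    MvPolynomial.eval x (pfaff t 2)
      = x 1 * x 3 * x 4 - t * x 2 ^ 3 - t ^ 2 * x 0 ^ 2 * (x 5 + x 6) ∧
    MvPolynomial.eval x (pfaff t 3)
      = x 1 * x 5 * x 6 - t * x 0 ^ 3 - t ^ 2 * x 2 ^ 2 * (x 3 + x 4) ∧
    MvPolynomial.eval x (pfaff t 4)
      = x 2 * x 5 * x 6 - t * x 3 * x 4 * (x 3 + x 4) - t ^ 2 * x 0 ^ 2 * x 1 := by
  refine ⟨?_, ?_, ?_, ?_, ?_⟩ <;>
  · simp [pfaff, pf4, skewN, co, Fin.succAbove, Fin.lt_def]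
    ring

/-- The threefold `X̌_t ⊂ ℙ⁶` cut out by the five Pfaffians. -/
def mirrorX (t : ℂ) : Set (ℙ ℂ (Fin 7 → ℂ)) :=
  {p | ∀ i, MvPolynomial.eval p.rep (pfaff t i) = 0}

/-- Membership in `X̌_t` can be tested on any homogeneous coordinate vector. -/
theorem mk_mem_mirrorX (t : ℂ) (x : Fin 7 → ℂ) (hx : x ≠ 0) :
    Projectivization.mk ℂ x hx ∈ mirrorX t ↔ ∀ i, MvPolynomial.eval x (pfaff t i) = 0 := by
  obtain ⟨a, ha⟩ := Projectivization.exists_smul_eq_mk_rep ℂ x hx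
  have key : ∀ i, MvPolynomial.eval (Projectivization.mk ℂ x hx).rep (pfaff t i) = 0 ↔
      MvPolynomial.eval x (pfaff t i) = 0 := by
    intro i
    have h0 : (a : ℂ) ≠ 0 := a.ne_zero
    have h2 : ∀ u v : ℂ, v = (a : ℂ) ^ 2 * u → (v = 0 ↔ u = 0) := by
      rintro u v rfl; simp [h0]
    have h3 : ∀ u v : ℂ, v = (a : ℂ) ^ 3 * u → (v = 0 ↔ u = 0) := by
      rintro u v rfl; simp [h0]
    rw [← ha, Units.smul_def]
    obtain ⟨p0, p1, p2, p3, p4⟩ := eval_pfaff t x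
    obtain ⟨q0, q1, q2, q3, q4⟩ := eval_pfaff t ((a : ℂ) • x)
    fin_cases i
    · refine h2 _ _ ?_
      simp only [Fin.zero_eta, q0, p0, Pi.smul_apply, smul_eq_mul]; ring
    · refine h3 _ _ ?_
      simp only [Fin.mk_one, q1, p1, Pi.smul_apply, smul_eq_mul]; ring
    · refine h3 _ _ ?_
      simp only [Fin.reduceFinMk, q2, p2, Pi.smul_apply, smul_eq_mul]; ring
    · refine h3 _ _ ?_
      simp only [Fin.reduceFinMk, q3, p3, Pi.smul_apply, smul_eq_mul]; ring
    · refine h3 _ _ ?_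
      simp only [Fin.reduceFinMk, q4, p4, Pi.smul_apply, smul_eq_mul]; ring
  exact forall_congr' key

/-! ### The holomorphic three-form -/

/-- The form `Ω₀ = (2πi)⁻⁶ ∑ i, (-1)^i x_i dx_0 ∧ ⋯ (dx_i omitted) ⋯ ∧ dx_6` at the point `x`,
evaluated on six vectors: the expansion of the determinant along its first row `x`. -/
noncomputable def omega0 (x : Fin 7 → ℂ) (u : Fin 6 → Fin 7 → ℂ) : ℂ :=
  ((2 * Real.pi * Complex.I) ^ 6)⁻¹ * Matrix.det (Matrix.of (Matrix.vecCons x u))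

/-- The differential of a polynomial at `x`, evaluated on the vector `n`. -/
noncomputable def polyDiff (P : MvPolynomial (Fin 7) ℂ) (x n : Fin 7 → ℂ) : ℂ :=
  ∑ j, MvPolynomial.eval x (MvPolynomial.pderiv j P) * n j

/-- The three equations `P_2`, `P_4`, `P_5`. -/
noncomputable def eqs (t : ℂ) : Fin 3 → MvPolynomial (Fin 7) ℂ :=
  ![pfaff t 1, pfaff t 3, pfaff t 4]

/-- The `3 × 3` matrix `(dP_i(n_j))` for `i ∈ {2, 4, 5}`. -/
noncomputable def eqsDiff (t : ℂ) (x : Fin 7 → ℂ) (n : Fin 3 → Fin 7 → ℂ) :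
    Matrix (Fin 3) (Fin 3) ℂ :=
  Matrix.of fun i j => polyDiff (eqs t i) x (n j)

/-- The residue `Res_X (P_{2,4,5} Ω₀ / (P_2 P_4 P_5))` at `x`, on tangent vectors `v`, computed with
a transversal frame `n`: it is the form `η` on `X` with
`dP_2 ∧ dP_4 ∧ dP_5 ∧ η = (2πi)³ P_{2,4,5} Ω₀`, so that the integral of `η` over a cycle is the
integral of the rational six-form over the surrounding tube. Here `P_{2,4,5}`, the Pfaffian of `N_t`
with the rows and columns `2, 4, 5` removed, is the entry in row `1` and column `3`. -/
noncomputable def residueForm (t : ℂ) (x : Fin 7 → ℂ) (n v : Fin 3 → Fin 7 → ℂ) : ℂ :=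
  (2 * Real.pi * Complex.I) ^ 3 * MvPolynomial.eval x (skewN t 0 2)
    * omega0 x (Fin.append n v) / (eqsDiff t x n).det

theorem polyDiff_self (t : ℂ) (x : Fin 7 → ℂ)
    (hx : ∀ i, MvPolynomial.eval x (eqs t i) = 0) (i : Fin 3) : polyDiff (eqs t i) x x = 0 := by
  have hi := hx i
  obtain ⟨-, p1, -, p3, p4⟩ := eval_pfaff t x
  fin_cases i
  · simp [eqs] at hi
    rw [p1] at hi
    simp [eqs, polyDiff, pfaff, pf4, skewN, co, Fin.succAbove, Fin.lt_def, Fin.sum_univ_seven,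
      MvPolynomial.pderiv_X, Pi.single_apply]
    linear_combination 3 * hi
  · simp [eqs] at hi
    rw [p3] at hi
    simp [eqs, polyDiff, pfaff, pf4, skewN, co, Fin.succAbove, Fin.lt_def, Fin.sum_univ_seven,
      MvPolynomial.pderiv_X, Pi.single_apply]
    linear_combination 3 * hi
  · simp [eqs] at hi
    rw [p4] at hi
    simp [eqs, polyDiff, pfaff, pf4, skewN, co, Fin.succAbove, Fin.lt_def, Fin.sum_univ_seven,
      MvPolynomial.pderiv_X, Pi.single_apply]
    linear_combination 3 * hi

theorem det_frame_aux (F : Matrix (Fin 7) (Fin 3) ℂ) (x : Fin 7 → ℂ) (n m v : Fin 3 → Fin 7 → ℂ)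
    (hx : Matrix.vecMul x F = 0) (hv : ∀ k, Matrix.vecMul (v k) F = 0)
    (hR : (Matrix.of (Matrix.vecCons x (Fin.append m v))).det ≠ 0) :
    (Matrix.of (Matrix.vecCons x (Fin.append n v))).det * (Matrix.of m * F).det
      = (Matrix.of (Matrix.vecCons x (Fin.append m v))).det * (Matrix.of n * F).det := by
  set Rn : Matrix (Fin 7) (Fin 7) ℂ := Matrix.of (Matrix.vecCons x (Fin.append n v)) with hRn
  set Rm : Matrix (Fin 7) (Fin 7) ℂ := Matrix.of (Matrix.vecCons x (Fin.append m v)) with hRm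
  have hu : IsUnit Rm.det := isUnit_iff_ne_zero.mpr hR
  set T := Rn * Rm⁻¹ with hT
  have hTR : T * Rm = Rn := by rw [hT, Matrix.mul_assoc, Matrix.nonsing_inv_mul _ hu, Matrix.mul_one]
  let e : Fin 3 → Fin 7 := ![1, 2, 3]
  have hrow : ∀ i, (∀ k, i ≠ e k) → T i = (1 : Matrix (Fin 7) (Fin 7) ℂ) i := by
    intro i hi
    have hrr : Rn i = Rm i := by
      fin_cases i
      · rfl
      · exact absurd rfl (hi 0)
      · exact absurd rfl (hi 1)
      · exact absurd rfl (hi 2)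
      · rfl
      · rfl
      · rfl
    have : T i = Matrix.vecMul (Rn i) Rm⁻¹ := rfl
    rw [this, hrr]
    have h1 : Matrix.vecMul (Rm i) Rm⁻¹ = (Rm * Rm⁻¹) i := rfl
    rw [h1, Matrix.mul_nonsing_inv _ hu]
  have hRmF : ∀ i, (∀ k, i ≠ e k) → ∀ j, (Rm * F) i j = 0 := by
    intro i hi j
    have h1 : (Rm * F) i = Matrix.vecMul (Rm i) F := rfl
    rw [h1]
    fin_cases i
    · exact congrFun hx j
    · exact absurd rfl (hi 0)
    · exact absurd rfl (hi 1)
    · exact absurd rfl (hi 2)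
    · exact congrFun (hv 0) j
    · exact congrFun (hv 1) j
    · exact congrFun (hv 2) j
  have hdetT : T.det = (T.submatrix e e).det := by
    rw [Matrix.twoBlockTriangular_det T (fun i => ∃ k, i = e k)
      (by
        intro i hi j hj
        rw [hrow i (fun k hk => hi ⟨k, hk⟩), Matrix.one_apply_ne]
        rintro rfl; exact hi hj)]
    have h2 : (T.toSquareBlockProp fun i => ¬ ∃ k, i = e k) = 1 := by
      ext i j
      have hh := congrFun (hrow i.1 (fun k hk => i.2 ⟨k, hk⟩)) j.1
      rw [Matrix.toSquareBlockProp_def, Matrix.of_apply, hh, Matrix.one_apply, Matrix.one_apply]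
      simp [Subtype.ext_iff]
    rw [h2, Matrix.det_one, mul_one]
    have he : Function.Injective e := by decide
    let E : Fin 3 ≃ {i // ∃ k, i = e k} := Equiv.ofBijective (fun k => ⟨e k, k, rfl⟩)
      ⟨fun a b hab => he (Subtype.ext_iff.mp hab), by rintro ⟨i, k, rfl⟩; exact ⟨k, rfl⟩⟩
    rw [← Matrix.det_submatrix_equiv_self E]
    rfl
  have hnF : Matrix.of n * F = T.submatrix e e * (Matrix.of m * F) := by
    ext a j
    have h1 : (Matrix.of n * F) a j = (Rn * F) (e a) j := by
      fin_cases a <;> rfl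
    have hm : ∀ b, (Matrix.of m * F) b j = (Rm * F) (e b) j := by
      intro b; fin_cases b <;> rfl
    rw [h1, ← hTR, Matrix.mul_assoc, Matrix.mul_apply, Matrix.mul_apply]
    simp only [hm]
    have hz : ∀ i : Fin 7, (∀ k, i ≠ e k) → T (e a) i * (Rm * F) i j = 0 := by
      intro i hi; rw [hRmF i hi, mul_zero]
    rw [Fin.sum_univ_seven, Fin.sum_univ_three, hz 0 (by decide), hz 4 (by decide),
      hz 5 (by decide), hz 6 (by decide)]
    simp [e]
  rw [hnF, Matrix.det_mul, ← hdetT, ← hTR, Matrix.det_mul]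
  ring

/-- On tangent vectors the residue does not depend on the transversal frame. -/
theorem residueForm_congr (t : ℂ) (x : Fin 7 → ℂ) (n m v : Fin 3 → Fin 7 → ℂ)
    (hx : ∀ i, MvPolynomial.eval x (eqs t i) = 0)
    (hv : ∀ i k, polyDiff (eqs t i) x (v k) = 0)
    (hn : (eqsDiff t x n).det ≠ 0) (hm : (eqsDiff t x m).det ≠ 0) :
    residueForm t x n v = residueForm t x m v := by
  let F : Matrix (Fin 7) (Fin 3) ℂ :=
    Matrix.of fun j i => MvPolynomial.eval x (MvPolynomial.pderiv j (eqs t i))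
  have hF : ∀ w i, Matrix.vecMul w F i = polyDiff (eqs t i) x w := by
    intro w i
    simp [Matrix.vecMul, dotProduct, F, polyDiff, mul_comm]
  have hD : ∀ w : Fin 3 → Fin 7 → ℂ, (eqsDiff t x w).det = (Matrix.of w * F).det := by
    intro w
    rw [← Matrix.det_transpose]
    congr 1
    ext a i
    exact (hF (w a) i).symm
  have hx0 : Matrix.vecMul x F = 0 := by
    ext i; rw [hF]; exact polyDiff_self t x hx i
  have hv0 : ∀ k, Matrix.vecMul (v k) F = 0 := by
    intro k; ext i; rw [hF]; exact hv i k
  have key : (Matrix.of (Matrix.vecCons x (Fin.append n v))).det * (eqsDiff t x m).det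
      = (Matrix.of (Matrix.vecCons x (Fin.append m v))).det * (eqsDiff t x n).det := by
    rw [hD, hD]
    by_cases h1 : (Matrix.of (Matrix.vecCons x (Fin.append m v))).det = 0
    · by_cases h2 : (Matrix.of (Matrix.vecCons x (Fin.append n v))).det = 0
      · rw [h1, h2, zero_mul, zero_mul]
      · exact (det_frame_aux F x m n v hx0 hv0 h2).symm
    · exact det_frame_aux F x n m v hx0 hv0 h1
  unfold residueForm omega0
  rw [div_eq_div_iff hn hm]
  linear_combination ((2 * Real.pi * Complex.I) ^ 3 * MvPolynomial.eval x (skewN t 0 2)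
    * ((2 * Real.pi * Complex.I) ^ 6)⁻¹) * key

/-- The holomorphic three-form `α = Res_X (P_{2,4,5} Ω₀ / (P_2 P_4 P_5))` where
`∂(P_2, P_4, P_5) / ∂(x_1, x_2, x_3) ≠ 0`, computed with the frame `∂_1, ∂_2, ∂_3`. -/
noncomputable def alpha (t : ℂ) (x : Fin 7 → ℂ) (v : Fin 3 → Fin 7 → ℂ) : ℂ :=
  residueForm t x ![Pi.single 1 1, Pi.single 2 1, Pi.single 3 1] v

/-! ### The torus cycle and the period -/

/-- `γ t`, for `|t| < δ`, is a torus in `X̌_t`, parametrised by three angles and given in homogeneous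
coordinates with `x_0 = 1`, on which `|x_4| = |x_5| = |x_6| = ε`; it depends continuously on `t`
and for `t = 0` it is the torus `|x_4| = |x_5| = |x_6| = ε` in the plane `x_1 = x_2 = x_3 = 0`. -/
structure IsTorusCycle (ε δ : ℝ) (γ : ℂ → (Fin 3 → ℝ) → Fin 7 → ℂ) : Prop where
  continuousOn : ContinuousOn (fun q : ℂ × (Fin 3 → ℝ) => γ q.1 q.2)
    (Metric.ball 0 δ ×ˢ Set.univ)
  contDiff : ∀ t ∈ Metric.ball (0 : ℂ) δ, ContDiff ℝ 1 (γ t)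
  periodic : ∀ t ∈ Metric.ball (0 : ℂ) δ, ∀ θ k,
    γ t (θ + Pi.single k (2 * Real.pi)) = γ t θ
  coord_zero : ∀ t ∈ Metric.ball (0 : ℂ) δ, ∀ θ, γ t θ 0 = 1
  coord_four : ∀ t ∈ Metric.ball (0 : ℂ) δ, ∀ θ, γ t θ 4 = ε * Complex.exp (θ 0 * Complex.I)
  coord_five : ∀ t ∈ Metric.ball (0 : ℂ) δ, ∀ θ, γ t θ 5 = ε * Complex.exp (θ 1 * Complex.I)
  coord_six : ∀ t ∈ Metric.ball (0 : ℂ) δ, ∀ θ, γ t θ 6 = ε * Complex.exp (θ 2 * Complex.I)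
  initial : ∀ θ, γ 0 θ 1 = 0 ∧ γ 0 θ 2 = 0 ∧ γ 0 θ 3 = 0
  mem : ∀ t ∈ Metric.ball (0 : ℂ) δ, ∀ θ,
    ∃ h : γ t θ ≠ 0, Projectivization.mk ℂ (γ t θ) h ∈ mirrorX t

/-- The integral of `α` over the torus parametrised by `c : [0, 2π]³ → X̌_t`. -/
noncomputable def period (t : ℂ) (c : (Fin 3 → ℝ) → Fin 7 → ℂ) : ℂ :=
  ∫ θ in Set.Icc (0 : Fin 3 → ℝ) (fun _ => 2 * Real.pi),
    alpha t (c θ) (fun k => fderiv ℝ c θ (Pi.single k 1))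

/-- The coefficients of the period. -/
def periodCoeff (n : ℕ) : ℕ :=
  (2 * n).choose n ^ 2 * ∑ k ∈ Finset.range (n + 1), (2 * n + k).choose n * n.choose k ^ 2

/-! ### Differential operators in `Θ = φ d/dφ` -/

/-- The Euler operator `Θ = φ d/dφ`. -/
noncomputable def euler (f : ℂ → ℂ) : ℂ → ℂ := fun z => z * deriv f z

/-- A differential operator `∑ i, p_i(φ) Θ^i` with polynomial coefficients is written as the
polynomial `∑ i, p_i Y^i` over `ℂ[φ]`; this is its action on functions. Its order is the degree
in `Y`. -/
noncomputable def applyOp (L : Polynomial (Polynomial ℂ)) (f : ℂ → ℂ) : ℂ → ℂ :=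
  fun z => L.sum fun i p => p.eval z * euler^[i] f z

/-- `L` is a nonzero operator of least order among those that annihilate the germ of `f` at `0`. -/
def IsPicardFuchs (L : Polynomial (Polynomial ℂ)) (f : ℂ → ℂ) : Prop :=
  L ≠ 0 ∧ applyOp L f =ᶠ[𝓝 0] 0 ∧
    ∀ M : Polynomial (Polynomial ℂ), M ≠ 0 → applyOp M f =ᶠ[𝓝 0] 0 → L.natDegree ≤ M.natDegree

/-- The operator `𝒟`. All coefficients in `φ` stand to the left of the powers of `Θ`. -/
noncomputable def opD : Polynomial (Polynomial ℂ) :=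
  let Θ : Polynomial (Polynomial ℂ) := Polynomial.X
  let φ : Polynomial (Polynomial ℂ) := Polynomial.C Polynomial.X
  13 ^ 2 * Θ ^ 4
    - φ * (59397 * Θ ^ 4 + 117546 * Θ ^ 3 + 86827 * Θ ^ 2 + 28054 * Θ + 3380)
    + 2 ^ 4 * φ ^ 2 * (6386 * Θ ^ 4 - 1774 * Θ ^ 3 - 17898 * Θ ^ 2 - 11596 * Θ - 2119)
    + 2 ^ 8 * φ ^ 3 * (67 * Θ ^ 4 + 1248 * Θ ^ 3 + 1091 * Θ ^ 2 + 312 * Θ + 26)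
    - 2 ^ 12 * φ ^ 4 * (2 * Θ + 1) ^ 4

/-! Cycle. Put x_0 = 1 and (a, b, c) = (x_4, x_5, x_6). Where bc ≠ 0, the equations P_2 = P_4 = P_5
= 0 already define X̌_t, since syzygies give P_1 and P_3 (`mem_mirrorX_of_eqs`). For small t, P_4
and P_2 are solved for x_1 and x_3, and P_5 becomes a fixed-point equation for x_2 under a
holomorphic contraction of the unit disc. The implicit function theorem makes its fixed point C^1 in
t and the angles. Uniqueness forces every admissible family to be this one for small t.

Period. In the angles, α has density (2π)^(-3) a(bc)²/J, where J is the Jacobian of P_2, P_4, P_5 in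
x_1, x_2, x_3. Cauchy's formula twice and Lagrange's formula at the fixed point identify a(bc)²/J
with the average over |x_1| = |x_2| = |x_3| = 1 of 1/((1 - A)(1 - B)(1 - C)), where the three
factors are P_2/(x_3 x_4), P_4/(x_1 x_5 x_6) and P_5/(x_2 x_5 x_6) (`avg_avg_avg_torusKernel`). The
period is therefore the constant term of a Laurent expansion in x_1, …, x_6. The vanishing of the
six exponents leaves a family of terms indexed by κ ∈ ℕ³ with t-degree 7|κ|, and Vandermonde's
identity sums their multinomial coefficients to `periodCoeff` (`sum_tripleMultinomial`).

Equation. Creative telescoping gives a second-order recurrence for the inner sums, hence for the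
coefficients. A combination of three shifts of it is the recurrence of 𝒟 (`periodCoeff_rec_four`).

Minimality. An annihilator of least order below 4 is, by division in the ring of differential
operators, a right factor of a polynomial multiple of 𝒟 (`exists_pseudo_division`). It inherits
regularity, and its indicial polynomials divide those of 𝒟 (`exists_symb_dvd`): the exponents are
all 0 at 0, all 1/2 at infinity, and natural numbers elsewhere with 0 at most once. For order r the
Fuchs relation says that r(r-1)/2 minus the sum of the exponents, added over the nonzero finite
roots of the leading coefficient, equals r/2. Integrality excludes r = 1 and r = 3, and a sign
excludes r = 2 (`order_of_exponents`).

Symmetry. The diagonal action of the seventh root of unity t/s carries X̌_s to X̌_t. -/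

/-! ### The recurrence of the coefficients -/

/-- The hypergeometric term on which the creative telescoping is based. -/
def baseTerm (n k : ℕ) : ℚ :=
  (2 * n + k).factorial / ((n + k + 2).factorial * k.factorial ^ 2 * (n + 2 - k).factorial ^ 2)

/-- The quotient of consecutive terms is rational in n and k. This is the only property of
`baseTerm` that the telescoping uses. -/
theorem baseTerm_succ (n k : ℕ) (hk : k + 1 ≤ n + 2) :
    baseTerm n (k + 1) * ((n + k + 3) * (k + 1) ^ 2)
      = (2 * n + k + 1) * (n + 2 - k) ^ 2 * baseTerm n k := by
  obtain ⟨m, hm⟩ := Nat.exists_eq_add_of_le hk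
  have h1 : n + 2 - (k + 1) = m := by omega
  have h2 : n + 2 - k = m + 1 := by omega
  have h3 : (n : ℚ) + 2 - k = m + 1 := by
    have : ((n + 2 : ℕ) : ℚ) = ((k + 1 + m : ℕ) : ℚ) := by rw [hm]
    push_cast at this; linarith
  have e1 : 2 * n + (k + 1) = (2 * n + k) + 1 := by ring
  have e2 : n + (k + 1) + 2 = (n + k + 2) + 1 := by ring
  rw [h3, baseTerm, baseTerm, h1, h2, e1, e2]
  simp only [Nat.factorial_succ]
  push_cast
  have := Nat.factorial_ne_zero
  field_simp
  ring

theorem choose_mul_choose_sq (n k : ℕ) (hk : k ≤ n) :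
    ((2 * n + k).choose n * n.choose k ^ 2 : ℚ)
      = (2 * n + k).factorial * n.factorial
        / ((n + k).factorial * k.factorial ^ 2 * (n - k).factorial ^ 2) := by
  obtain ⟨m, rfl⟩ := Nat.exists_eq_add_of_le hk
  have e1 : 2 * (k + m) + k = (k + m) + ((k + m) + k) := by ring
  rw [e1, Nat.cast_add_choose, Nat.cast_add_choose, Nat.add_sub_cancel_left]
  have h1 : ((k + m).factorial : ℚ) ≠ 0 := by exact_mod_cast Nat.factorial_ne_zero _
  have h2 : ((k + m + k).factorial : ℚ) ≠ 0 := by exact_mod_cast Nat.factorial_ne_zero _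
  have h3 : (k.factorial : ℚ) ≠ 0 := by exact_mod_cast Nat.factorial_ne_zero _
  have h4 : (m.factorial : ℚ) ≠ 0 := by exact_mod_cast Nat.factorial_ne_zero _
  field_simp

theorem cast_sub_of_add {n k m : ℕ} (h : n + 2 = k + m) : (n : ℚ) = k + m - 2 := by
  have : ((n + 2 : ℕ) : ℚ) = ((k + m : ℕ) : ℚ) := by rw [h]
  push_cast at this; linarith

/-- The denominator of `baseTerm` is large enough for the summands at n, n + 1 and n + 2 to be
polynomial multiples of it. For k = n + 1 and k = n + 2 the binomial coefficient is zero and so is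
one of the squared factors, so truncated subtraction does no harm. -/
theorem summand_zero (n k : ℕ) (hk : k ≤ n + 2) :
    ((2 * n + k).choose n * n.choose k ^ 2 : ℚ)
      = n.factorial * ((n + k + 1) * (n + k + 2) * (n + 1 - k) ^ 2 * (n + 2 - k) ^ 2)
        * baseTerm n k := by
  obtain ⟨m, hm⟩ := Nat.exists_eq_add_of_le hk
  have hn := cast_sub_of_add hm
  rcases m with _ | _ | m
  · have : n.choose k = 0 := Nat.choose_eq_zero_of_lt (by omega)
    rw [this, hn]; simp
  · have : n.choose k = 0 := Nat.choose_eq_zero_of_lt (by omega)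
    rw [this, hn]; push_cast; ring
  · have hkn : k ≤ n := by omega
    rw [choose_mul_choose_sq n k hkn, baseTerm]
    have h1 : n - k = m := by omega
    have h2 : n + 2 - k = m + 1 + 1 := by omega
    have h3 : (n : ℚ) + 1 - k = m + 1 := by rw [hn]; push_cast; ring
    have h4 : (n : ℚ) + 2 - k = m + 2 := by rw [hn]; push_cast; ring
    rw [h1, h2, h3, h4]
    simp only [Nat.factorial_succ]
    push_cast
    have := Nat.factorial_ne_zero
    field_simp
    ring

theorem summand_one (n k : ℕ) (hk : k ≤ n + 2) :
    ((2 * (n + 1) + k).choose (n + 1) * (n + 1).choose k ^ 2 : ℚ)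
      = (n + 1).factorial * ((2 * n + k + 1) * (2 * n + k + 2) * (n + k + 2) * (n + 2 - k) ^ 2)
        * baseTerm n k := by
  obtain ⟨m, hm⟩ := Nat.exists_eq_add_of_le hk
  have hn := cast_sub_of_add hm
  rcases m with _ | m
  · have : (n + 1).choose k = 0 := Nat.choose_eq_zero_of_lt (by omega)
    rw [this, hn]; simp
  · have hkn : k ≤ n + 1 := by omega
    rw [choose_mul_choose_sq (n + 1) k hkn, baseTerm]
    have h1 : n + 1 - k = m := by omega
    have h2 : n + 2 - k = m + 1 := by omega
    have h4 : (n : ℚ) + 2 - k = m + 1 := by rw [hn]; push_cast; ring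
    have e1 : 2 * (n + 1) + k = 2 * n + k + 1 + 1 := by ring
    have e2 : n + 1 + k = n + k + 1 := by ring
    rw [h1, h2, h4, e1, e2]
    simp only [Nat.factorial_succ]
    push_cast
    have := Nat.factorial_ne_zero
    field_simp
    ring

theorem summand_two (n k : ℕ) (hk : k ≤ n + 2) :
    ((2 * (n + 2) + k).choose (n + 2) * (n + 2).choose k ^ 2 : ℚ)
      = (n + 2).factorial
        * ((2 * n + k + 1) * (2 * n + k + 2) * (2 * n + k + 3) * (2 * n + k + 4))
        * baseTerm n k := by
  rw [choose_mul_choose_sq (n + 2) k hk, baseTerm]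
  have e1 : 2 * (n + 2) + k = 2 * n + k + 1 + 1 + 1 + 1 := by ring
  have e2 : n + 2 + k = n + k + 2 := by ring
  rw [e1, e2]
  simp only [Nat.factorial_succ]
  push_cast
  have := Nat.factorial_ne_zero
  field_simp
  ring

/-- The polynomial part of the telescoping certificate. -/
def certPoly (n k : ℚ) : ℚ :=
  (-51328 - 518362 * n - 2250581 * n ^ 2 - 5523324 * n ^ 3 - 8455324 * n ^ 4 - 8382812 * n ^ 5
    - 5388294 * n ^ 6 - 2167534 * n ^ 7 - 495635 * n ^ 8 - 49130 * n ^ 9)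
  + (-112856 - 913789 * n - 3150506 * n ^ 2 - 6024592 * n ^ 3 - 6971563 * n ^ 4 - 4988019 * n ^ 5
    - 2150220 * n ^ 6 - 509320 * n ^ 7 - 50575 * n ^ 8) * k
  + (-37536 - 210664 * n - 445939 * n ^ 2 - 404745 * n ^ 3 - 65264 * n ^ 4 + 148735 * n ^ 5
    + 102465 * n ^ 6 + 20400 * n ^ 7) * k ^ 2
  + (24884 + 155835 * n + 398394 * n ^ 2 + 531235 * n ^ 3 + 388937 * n ^ 4 + 148010 * n ^ 5
    + 22865 * n ^ 6) * k ^ 3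
  + (892 + 5560 * n + 12976 * n ^ 2 + 14068 * n ^ 3 + 7120 * n ^ 4 + 1360 * n ^ 5) * k ^ 4

/-- The outer coefficients of the recurrence are, up to linear factors, values of this quadratic
polynomial. -/
def recE (n : ℚ) : ℚ := 85 * n ^ 2 + 105 * n + 33

/-- The middle coefficient of the recurrence. -/
def recMid (n : ℚ) : ℚ :=
  -57796 - 338610 * n - 796417 * n ^ 2 - 961595 * n ^ 3 - 631222 * n ^ 4 - 214635 * n ^ 5
    - 29665 * n ^ 6

/-- The summand of the telescoping sum divided by the base term. -/
def telePoly (n k : ℚ) : ℚ :=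
  -4 * (n + 1) ^ 2 * (2 * n + 1) ^ 2 * recE (n + 1)
      * ((n + k + 1) * (n + k + 2) * (n + 1 - k) ^ 2 * (n + 2 - k) ^ 2)
    + recMid n * ((n + 1) * ((2 * n + k + 1) * (2 * n + k + 2) * (n + k + 2) * (n + 2 - k) ^ 2))
    + 4 * (n + 2) ^ 2 * (2 * n + 3) ^ 2 * recE n * ((n + 2) * (n + 1)
      * ((2 * n + k + 1) * (2 * n + k + 2) * (2 * n + k + 3) * (2 * n + k + 4)))

/-- Zeilberger's identity. With G(k) = k²(n+k+2) · `certPoly` · `baseTerm`, it says that the summand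
is G(k+1) - G(k), once `baseTerm_succ` has expressed the term at k + 1 through the term at k. -/
theorem telePoly_eq (n k : ℚ) :
    telePoly n k = (2 * n + k + 1) * (n + 2 - k) ^ 2 * certPoly n (k + 1)
      - k ^ 2 * (n + k + 2) * certPoly n k := by
  unfold telePoly certPoly recMid recE
  ring

theorem tele_partial_sum (n K : ℕ) (hK : K ≤ n + 2) :
    ∑ k ∈ Finset.range K, telePoly n k * baseTerm n k
      = (K : ℚ) ^ 2 * (n + K + 2) * certPoly n K * baseTerm n K := by
  induction K with
  | zero => simp
  | succ K ih =>
    rw [Finset.sum_range_succ, ih (by omega), telePoly_eq]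
    have h := baseTerm_succ n K hK
    push_cast
    linear_combination (-certPoly n (K + 1)) * h

/-- At k = n + 2 the factor (n+2-k)² removes the first term of `telePoly_eq`, so the last summand is
minus the telescoped boundary value. -/
theorem tele_sum (n : ℕ) : ∑ k ∈ Finset.range (n + 3), telePoly n k * baseTerm n k = 0 := by
  rw [Finset.sum_range_succ, tele_partial_sum n (n + 2) le_rfl, telePoly_eq]
  push_cast
  ring

/-- The inner sums of `periodCoeff`. -/
def innerSum (n : ℕ) : ℕ := ∑ k ∈ Finset.range (n + 1), (2 * n + k).choose n * n.choose k ^ 2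

theorem innerSum_eq (n N : ℕ) (h : n + 1 ≤ N) :
    innerSum n = ∑ k ∈ Finset.range N, (2 * n + k).choose n * n.choose k ^ 2 := by
  refine Finset.sum_subset (Finset.range_subset_range.mpr h) fun k _ hk => ?_
  rw [Nat.choose_eq_zero_of_lt (n := n) (k := k) (by simpa using hk)]
  simp

theorem innerSum_rec (n : ℕ) :
    -4 * ((n : ℚ) + 1) ^ 2 * (2 * n + 1) ^ 2 * recE (n + 1) * innerSum n
      + recMid n * innerSum (n + 1)
      + 4 * (n + 2) ^ 2 * (2 * n + 3) ^ 2 * recE n * innerSum (n + 2) = 0 := by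
  have h0 := tele_sum n
  rw [innerSum_eq n (n + 3) (by omega), innerSum_eq (n + 1) (n + 3) (by omega),
    innerSum_eq (n + 2) (n + 3) (by omega)]
  have hn : (n.factorial : ℚ) ≠ 0 := by exact_mod_cast Nat.factorial_ne_zero _
  push_cast
  rw [Finset.mul_sum, Finset.mul_sum, Finset.mul_sum, ← Finset.sum_add_distrib,
    ← Finset.sum_add_distrib]
  -- After multiplication by n!, the factors 1, n+1 and (n+1)(n+2) in `telePoly` become the
  -- factorials n!, (n+1)! and (n+2)! of the three summands.
  rw [← mul_zero (n.factorial : ℚ), ← h0, Finset.mul_sum]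
  refine Finset.sum_congr rfl fun k hk => ?_
  have hk' : k ≤ n + 2 := by have := Finset.mem_range.mp hk; omega
  rw [summand_zero n k hk', summand_one n k hk', summand_two n k hk', telePoly]
  simp only [Nat.factorial_succ]
  push_cast
  ring

theorem centralBinom_rec (n : ℕ) :
    ((2 * (n + 1)).choose (n + 1) : ℚ) * (n + 1) = 2 * (2 * n + 1) * (2 * n).choose n := by
  have := Nat.succ_mul_centralBinom_succ n
  unfold Nat.centralBinom at this
  have h2 : (((n + 1) * (2 * (n + 1)).choose (n + 1) : ℕ) : ℚ)
      = ((2 * (2 * n + 1) * (2 * n).choose n : ℕ) : ℚ) := by rw [this]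
  push_cast at h2
  linarith

theorem periodCoeff_eq (n : ℕ) : (periodCoeff n : ℚ) = ((2 * n).choose n : ℚ) ^ 2 * innerSum n := by
  simp [periodCoeff, innerSum]

theorem periodCoeff_rec_two (n : ℕ) :
    -16 * (2 * (n : ℚ) + 1) ^ 4 * recE (n + 1) * periodCoeff n + recMid n * periodCoeff (n + 1)
      + (n + 2) ^ 4 * recE n * periodCoeff (n + 2) = 0 := by
  have h := innerSum_rec n
  have c1 := centralBinom_rec n
  have c2 := centralBinom_rec (n + 1)
  rw [periodCoeff_eq, periodCoeff_eq, periodCoeff_eq]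
  rw [show n + 1 + 1 = n + 2 from rfl] at c2
  push_cast at c2
  generalize ((2 * n).choose n : ℚ) = x at *
  generalize ((2 * (n + 1)).choose (n + 1) : ℚ) = y at *
  generalize ((2 * (n + 2)).choose (n + 2) : ℚ) = z at *
  -- Both relations are differences of squares whose linear factor vanishes by the recurrence of the
  -- central binomial coefficients.
  have hx : 4 * (2 * (n : ℚ) + 1) ^ 2 * x ^ 2 = y ^ 2 * (n + 1) ^ 2 := by
    linear_combination (-(y * (n + 1) + 2 * (2 * n + 1) * x)) * c1
  have hz : z ^ 2 * ((n : ℚ) + 2) ^ 2 = 4 * (2 * n + 3) ^ 2 * y ^ 2 := by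
    linear_combination (z * (n + 2) + 2 * (2 * n + 3) * y) * c2
  linear_combination y ^ 2 * h - 4 * (2 * (n : ℚ) + 1) ^ 2 * recE (n + 1) * innerSum n * hx
    + (n + 2) ^ 2 * recE n * innerSum (n + 2) * hz

/-- The order-two recurrence has coefficients of degree six. This combination of three of its shifts
is divisible by `recE (n + 1) * recE (n + 2)`, which is positive, and the quotient has the
degree-four coefficients of 𝒟. The outer multipliers are read off from the first and last
coefficients of 𝒟. -/
theorem periodCoeff_rec_four (n : ℕ) :
    169 * ((n : ℚ) + 4) ^ 4 * periodCoeff (n + 4)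
      - (59397 * ((n : ℚ) + 3) ^ 4 + 117546 * (n + 3) ^ 3 + 86827 * (n + 3) ^ 2 + 28054 * (n + 3)
          + 3380) * periodCoeff (n + 3)
      + 16 * (6386 * ((n : ℚ) + 2) ^ 4 - 1774 * (n + 2) ^ 3 - 17898 * (n + 2) ^ 2 - 11596 * (n + 2)
          - 2119) * periodCoeff (n + 2)
      + 256 * (67 * ((n : ℚ) + 1) ^ 4 + 1248 * (n + 1) ^ 3 + 1091 * (n + 1) ^ 2 + 312 * (n + 1)
          + 26) * periodCoeff (n + 1)
      - 4096 * (2 * (n : ℚ) + 1) ^ 4 * periodCoeff n = 0 := by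
  have h0 := periodCoeff_rec_two n
  have h1 := periodCoeff_rec_two (n + 1)
  have h2 := periodCoeff_rec_two (n + 2)
  rw [show n + 1 + 1 = n + 2 from rfl, show n + 1 + 2 = n + 3 from rfl] at h1
  rw [show n + 2 + 1 = n + 3 from rfl, show n + 2 + 2 = n + 4 from rfl] at h2
  push_cast at h1 h2
  have hn : (0 : ℚ) ≤ n := Nat.cast_nonneg n
  have e1 : recE (n + 1) ≠ 0 := by unfold recE; positivity
  have e2 : recE (n + 2) ≠ 0 := by unfold recE; positivity
  refine (mul_eq_zero.mp ?_).resolve_left (mul_ne_zero e1 e2)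
  unfold recE recMid at *
  linear_combination 256 * (85 * ((n : ℚ) + 2) ^ 2 + 105 * (n + 2) + 33) * h0
    + (-132288 - 149760 * n - 35360 * n ^ 2) * h1
    + 169 * (85 * ((n : ℚ) + 1) ^ 2 + 105 * (n + 1) + 33) * h2

/-! ### The symmetry of the family -/

/-- The weights of the diagonal action that permutes the members of the family. -/
def symWeight : Fin 7 → ℕ := ![0, 3, 0, 6, 6, 6, 6]

/-- The diagonal linear automorphism with the given nonzero entries. -/
noncomputable def diagEquiv (d : Fin 7 → ℂ) (hd : ∀ i, d i ≠ 0) :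
    (Fin 7 → ℂ) ≃ₗ[ℂ] (Fin 7 → ℂ) :=
  LinearEquiv.piCongrRight fun i => LinearEquiv.smulOfUnit (Units.mk0 (d i) (hd i))

theorem diagEquiv_apply (d : Fin 7 → ℂ) (hd : ∀ i, d i ≠ 0) (x : Fin 7 → ℂ) (i : Fin 7) :
    diagEquiv d hd x i = d i * x i := by
  simp only [diagEquiv, LinearEquiv.piCongrRight_apply]
  rfl

/-- With these weights all monomials of one Pfaffian scale by the same power of z up to powers of
z^7, once t is replaced by z^6 t. -/
theorem eval_pfaff_diag (t z : ℂ) (hz : z ^ 7 = 1) (x : Fin 7 → ℂ) (i : Fin 5) :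
    MvPolynomial.eval (fun j => z ^ symWeight j * x j) (pfaff t i)
      = z ^ (![0, 5, 1, 1, 5] i : ℕ) * MvPolynomial.eval x (pfaff (z ^ 6 * t) i) := by
  obtain ⟨p0, p1, p2, p3, p4⟩ := eval_pfaff (z ^ 6 * t) x
  obtain ⟨q0, q1, q2, q3, q4⟩ := eval_pfaff t (fun j => z ^ symWeight j * x j)
  have hs : symWeight 0 = 0 ∧ symWeight 1 = 3 ∧ symWeight 2 = 0 ∧ symWeight 3 = 6 ∧
    symWeight 4 = 6 ∧ symWeight 5 = 6 ∧ symWeight 6 = 6 := ⟨rfl, rfl, rfl, rfl, rfl, rfl, rfl⟩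
  obtain ⟨h0, h1, h2, h3, h4, h5, h6⟩ := hs
  fin_cases i
  · simp only [Fin.zero_eta, q0, p0, h0, h1, h2, h3, h4, h5, h6, Matrix.cons_val_zero]
    ring
  · simp only [Fin.mk_one, q1, p1, h0, h1, h2, h3, h4, h5, h6]
    rw [show (![0, 5, 1, 1, 5] : Fin 5 → ℕ) 1 = 5 from rfl]
    linear_combination (z ^ 5 * x 0 * x 3 * x 4 - z ^ 11 * t * x 5 * x 6 * (x 5 + x 6)
      + z ^ 3 * (z ^ 7 + 1) * t ^ 2 * x 1 * x 2 ^ 2) * hz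
  · simp only [Fin.reduceFinMk, q2, p2, h0, h1, h2, h3, h4, h5, h6]
    rw [show (![0, 5, 1, 1, 5] : Fin 5 → ℕ) 2 = 1 from rfl]
    linear_combination (z * (z ^ 7 + 1) * x 1 * x 3 * x 4 + t * x 2 ^ 3
      + z ^ 6 * t ^ 2 * x 0 ^ 2 * (x 5 + x 6)) * hz
  · simp only [Fin.reduceFinMk, q3, p3, h0, h1, h2, h3, h4, h5, h6]
    rw [show (![0, 5, 1, 1, 5] : Fin 5 → ℕ) 3 = 1 from rfl]
    linear_combination (z * (z ^ 7 + 1) * x 1 * x 5 * x 6 + t * x 0 ^ 3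
      + z ^ 6 * t ^ 2 * x 2 ^ 2 * (x 3 + x 4)) * hz
  · simp only [Fin.reduceFinMk, q4, p4, h0, h1, h2, h3, h4, h5, h6]
    rw [show (![0, 5, 1, 1, 5] : Fin 5 → ℕ) 4 = 5 from rfl]
    linear_combination (z ^ 5 * x 2 * x 5 * x 6 - z ^ 11 * t * x 3 * x 4 * (x 3 + x 4)
      + z ^ 3 * (z ^ 7 + 1) * t ^ 2 * x 0 ^ 2 * x 1) * hz

theorem image_mirrorX (s t : ℂ) (g : (Fin 7 → ℂ) ≃ₗ[ℂ] (Fin 7 → ℂ))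
    (h : ∀ x, (∀ i, MvPolynomial.eval (g x) (pfaff t i) = 0) ↔
      ∀ i, MvPolynomial.eval x (pfaff s i) = 0) :
    Projectivization.map g.toLinearMap g.injective '' mirrorX s = mirrorX t := by
  ext p
  induction p using Projectivization.ind with
  | h y hy =>
  rw [mk_mem_mirrorX]
  constructor
  · rintro ⟨q, hq, hqp⟩
    induction q using Projectivization.ind with
    | h x hx =>
    rw [mk_mem_mirrorX, ← h] at hq
    have hgx : g x ≠ 0 := by simpa using hx
    have hm : Projectivization.mk ℂ y hy = Projectivization.mk ℂ (g x) hgx := by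
      rw [← hqp]; rfl
    rw [← mk_mem_mirrorX t y hy, hm, mk_mem_mirrorX]
    exact hq
  · intro hy'
    have hx : g.symm y ≠ 0 := by simpa using hy
    refine ⟨Projectivization.mk ℂ (g.symm y) hx, ?_, ?_⟩
    · rw [mk_mem_mirrorX, ← h, g.apply_symm_apply]
      exact hy'
    · rw [Projectivization.map_mk]
      congr 1
      exact g.apply_symm_apply y

/-- For z = t/s one has z^7 = 1 and z^6 t = s. If s = 0, then t = 0 as well and the identity serves.
-/
theorem exists_equiv_image_mirrorX (s t : ℂ) (hst : s ^ 7 = t ^ 7) :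
    ∃ g : (Fin 7 → ℂ) ≃ₗ[ℂ] (Fin 7 → ℂ),
      Projectivization.map g.toLinearMap g.injective '' mirrorX s = mirrorX t := by
  by_cases hs : s = 0
  · have ht : t = 0 := by
      rw [hs] at hst
      exact pow_eq_zero_iff (n := 7) (by norm_num) |>.mp (by rw [← hst]; norm_num)
    subst hs ht
    exact ⟨LinearEquiv.refl ℂ _, image_mirrorX 0 0 _ fun x => Iff.rfl⟩
  · have hz : (t / s) ^ 7 = 1 := by rw [div_pow, ← hst, div_self (pow_ne_zero 7 hs)]
    have hz0 : t / s ≠ 0 := by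
      intro h0; rw [h0] at hz; norm_num at hz
    have hst6 : (t / s) ^ 6 * t = s := by
      have : (t / s) ^ 6 * t = (t / s) ^ 7 * s := by field_simp
      rw [this, hz, one_mul]
    refine ⟨diagEquiv (fun j => (t / s) ^ symWeight j) fun j => pow_ne_zero _ hz0,
      image_mirrorX s t _ fun x => forall_congr' fun i => ?_⟩
    have hx : (diagEquiv (fun j => (t / s) ^ symWeight j) fun j => pow_ne_zero _ hz0) x
        = fun j => (t / s) ^ symWeight j * x j := funext fun j => diagEquiv_apply _ _ x j
    rw [hx, eval_pfaff_diag t _ hz, hst6]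
    simp [hz0]

/-! ### Differential operators with polynomial coefficients

An operator `∑ i, a_i δ^i` with polynomial coefficients on the left is written as the polynomial
`∑ i, a_i Y^i` over `ℂ[X]`. -/

section Operators

open Polynomial

/-- `δ` acts on the coefficients as the derivation `d / dX`. -/
def IsWeyl {E : Type*} [Ring E] (j : ℂ[X] →+* E) (δ : E) : Prop :=
  ∀ a : ℂ[X], δ * j a = j (derivative a) + j a * δ

/-- Left multiplication of an operator by `d / dX`. -/
noncomputable def leftD (A : ℂ[X][X]) : ℂ[X][X] :=
  (A.sum fun i a => monomial i (derivative a)) + X * A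

theorem leftD_add (A B : ℂ[X][X]) : leftD (A + B) = leftD A + leftD B := by
  unfold leftD
  rw [sum_add_index _ _ _ (by simp) (by simp)]
  ring

theorem leftD_monomial (i : ℕ) (a : ℂ[X]) :
    leftD (monomial i a) = monomial i (derivative a) + monomial (i + 1) a := by
  unfold leftD
  rw [sum_monomial_index _ _ (by simp), X_mul_monomial]

theorem coeff_leftD_succ (A : ℂ[X][X]) (n : ℕ) :
    (leftD A).coeff (n + 1) = derivative (A.coeff (n + 1)) + A.coeff n := by
  induction A using Polynomial.induction_on' with
  | add A B hA hB => rw [leftD_add, coeff_add, hA, hB, coeff_add, coeff_add, derivative_add]; ring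
  | monomial i a =>
    rw [leftD_monomial]
    simp only [coeff_add, coeff_monomial, Nat.add_right_cancel_iff]
    split_ifs <;> simp

/-- Differentiating the coefficients does not raise the order, so the top term comes from `X * A`
alone. The unchanged leading coefficient is what division needs. -/
theorem degree_leftD (A : ℂ[X][X]) (hA : A ≠ 0) :
    leftD A ≠ 0 ∧ (leftD A).natDegree = A.natDegree + 1 ∧
      (leftD A).leadingCoeff = A.leadingCoeff := by
  have h1 : (leftD A).coeff (A.natDegree + 1) = A.leadingCoeff := by
    rw [coeff_leftD_succ, coeff_eq_zero_of_natDegree_lt (Nat.lt_succ_self _)]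
    simp
  have h2 : (leftD A).natDegree ≤ A.natDegree + 1 := by
    rw [natDegree_le_iff_coeff_eq_zero]
    intro N hN
    obtain ⟨N, rfl⟩ : ∃ m, N = m + 1 := ⟨N - 1, by omega⟩
    rw [coeff_leftD_succ, coeff_eq_zero_of_natDegree_lt (by omega),
      coeff_eq_zero_of_natDegree_lt (by omega)]
    simp
  have h3 : (leftD A).coeff (A.natDegree + 1) ≠ 0 := by rw [h1]; simpa using hA
  have h4 : (leftD A).natDegree = A.natDegree + 1 := le_antisymm h2 (le_natDegree_of_ne_zero h3)
  refine ⟨fun h => h3 (by rw [h, coeff_zero]), h4, ?_⟩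
  rw [leadingCoeff, h4, h1]

theorem degree_iterate_leftD (A : ℂ[X][X]) (hA : A ≠ 0) (k : ℕ) :
    leftD^[k] A ≠ 0 ∧ (leftD^[k] A).natDegree = A.natDegree + k ∧
      (leftD^[k] A).leadingCoeff = A.leadingCoeff := by
  induction k with
  | zero => exact ⟨hA, rfl, rfl⟩
  | succ k ih =>
    obtain ⟨h1, h2, h3⟩ := ih
    rw [Function.iterate_succ_apply']
    obtain ⟨g1, g2, g3⟩ := degree_leftD _ h1
    exact ⟨g1, by rw [g2, h2]; ring, by rw [g3, h3]⟩

variable {E : Type*} [Ring E] (j : ℂ[X] →+* E) (δ : E)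

theorem eval₂_C_mul_left (a : ℂ[X]) (A : ℂ[X][X]) :
    (C a * A).eval₂ j δ = j a * A.eval₂ j δ := by
  induction A using Polynomial.induction_on' with
  | add A B hA hB => rw [mul_add, eval₂_add, eval₂_add, hA, hB, mul_add]
  | monomial i b => rw [C_mul_monomial, eval₂_monomial, eval₂_monomial, map_mul, mul_assoc]

theorem eval₂_leftD (h : IsWeyl j δ) (A : ℂ[X][X]) : (leftD A).eval₂ j δ = δ * A.eval₂ j δ := by
  induction A using Polynomial.induction_on' with
  | add A B hA hB => rw [leftD_add, eval₂_add, eval₂_add, hA, hB, mul_add]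
  | monomial i b =>
    rw [leftD_monomial, eval₂_add, eval₂_monomial, eval₂_monomial, eval₂_monomial, ← mul_assoc,
      h b, add_mul, pow_succ', mul_assoc]

theorem eval₂_iterate_leftD (h : IsWeyl j δ) (A : ℂ[X][X]) (k : ℕ) :
    (leftD^[k] A).eval₂ j δ = δ ^ k * A.eval₂ j δ := by
  induction k with
  | zero => simp
  | succ k ih => rw [Function.iterate_succ_apply', eval₂_leftD j δ h, ih, pow_succ', mul_assoc]

/-- Division with remainder of `A` by `M` after multiplication with a polynomial. -/
theorem exists_pseudo_division (M : ℂ[X][X]) (hM : M ≠ 0) (A : ℂ[X][X]) :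
    ∃ h : ℂ[X], h ≠ 0 ∧ ∃ Q R : ℂ[X][X], Q.natDegree ≤ A.natDegree - M.natDegree ∧
      R.degree < M.degree ∧ ∀ {E : Type} [Ring E] (j : ℂ[X] →+* E) (δ : E), IsWeyl j δ →
        j h * A.eval₂ j δ = Q.eval₂ j δ * M.eval₂ j δ + R.eval₂ j δ := by
  -- The data `h`, `Q`, `R` are found before the ring `E` is given, so one identity can be read both
  -- on power series and on polynomials expanded at any point.
  induction A using degree_lt_wf.induction with
  | h A ih =>
  by_cases hdeg : A.degree < M.degree
  · exact ⟨1, one_ne_zero, 0, A, by simp, hdeg, fun j δ _ => by simp⟩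
  · have hA : A ≠ 0 := by
      rintro rfl
      exact hdeg (by rw [degree_zero]; exact bot_lt_iff_ne_bot.mpr (by simpa using hM))
    have hle : M.natDegree ≤ A.natDegree := natDegree_le_natDegree (not_lt.mp hdeg)
    set k := A.natDegree - M.natDegree with hk
    obtain ⟨b1, b2, b3⟩ := degree_iterate_leftD M hM k
    set B := leftD^[k] M with hB
    have hm : M.leadingCoeff ≠ 0 := by simpa using hM
    have ha : A.leadingCoeff ≠ 0 := by simpa using hA
    -- Cross-multiplication by the leading coefficients cancels the top terms. Polynomials stand on
    -- the left, so these products are formed coefficientwise, and only the powers of d/dX need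
    -- `leftD`.
    have hlt : (C M.leadingCoeff * A - C A.leadingCoeff * B).degree < A.degree := by
      have d1 : (C M.leadingCoeff * A).degree = A.degree := by rw [degree_C_mul hm]
      have d2 : (C A.leadingCoeff * B).degree = A.degree := by
        rw [degree_C_mul ha, degree_eq_natDegree b1, degree_eq_natDegree hA, b2]
        congr 1; omega
      rw [← d1]
      refine degree_sub_lt_left (by rw [d1, d2]) (mul_ne_zero (by simpa using hm) hA) ?_
      rw [leadingCoeff_mul, leadingCoeff_mul, leadingCoeff_C, leadingCoeff_C, b3, mul_comm]
    obtain ⟨h, h0, Q, R, hQ, hR, hid⟩ := ih _ hlt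
    refine ⟨h * M.leadingCoeff, mul_ne_zero h0 hm, Q + C (h * A.leadingCoeff) * X ^ k, R, ?_, hR,
      fun j δ hj => ?_⟩
    · refine (natDegree_add_le _ _).trans (max_le (hQ.trans ?_) (natDegree_C_mul_X_pow_le _ _))
      exact Nat.sub_le_sub_right (natDegree_le_natDegree hlt.le) _
    · have e := hid j δ hj
      rw [sub_eq_add_neg, eval₂_add, eval₂_neg, eval₂_C_mul_left, eval₂_C_mul_left, hB,
        eval₂_iterate_leftD j δ hj] at e
      rw [eval₂_add, eval₂_C_mul_left, eval₂_X_pow, map_mul, map_mul, add_mul]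
      have : j h * (j M.leadingCoeff * A.eval₂ j δ)
          = (Q.eval₂ j δ * M.eval₂ j δ + R.eval₂ j δ)
            + j h * (j A.leadingCoeff * (δ ^ k * M.eval₂ j δ)) := by
        rw [← e]; noncomm_ring
      rw [mul_assoc, this]
      noncomm_ring

/-- Left multiplication of an operator in `d / dX` by the Euler operator. -/
noncomputable def leftEuler (A : ℂ[X][X]) : ℂ[X][X] := C X * leftD A

/-- The operator in `d / dX` given by an operator in `Θ = X d / dX`. -/
noncomputable def ofEuler (M : ℂ[X][X]) : ℂ[X][X] := M.sum fun i a => C a * leftEuler^[i] 1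

theorem eval₂_iterate_leftEuler (h : IsWeyl j δ) (i : ℕ) :
    (leftEuler^[i] 1).eval₂ j δ = (j X * δ) ^ i := by
  induction i with
  | zero => simp
  | succ i ih =>
    rw [Function.iterate_succ_apply', leftEuler, eval₂_C_mul_left, eval₂_leftD j δ h, ih, pow_succ',
      mul_assoc]

theorem ofEuler_add (A B : ℂ[X][X]) : ofEuler (A + B) = ofEuler A + ofEuler B := by
  unfold ofEuler
  rw [sum_add_index _ _ _ (by simp) (by intros; simp; ring)]

theorem ofEuler_monomial (i : ℕ) (a : ℂ[X]) :
    ofEuler (monomial i a) = C a * leftEuler^[i] 1 := by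
  unfold ofEuler
  rw [sum_monomial_index _ _ (by simp)]

theorem eval₂_ofEuler (h : IsWeyl j δ) (M : ℂ[X][X]) :
    (ofEuler M).eval₂ j δ = M.eval₂ j (j X * δ) := by
  induction M using Polynomial.induction_on' with
  | add A B hA hB => rw [ofEuler_add, eval₂_add, eval₂_add, hA, hB]
  | monomial i b =>
    rw [ofEuler_monomial, eval₂_C_mul_left, eval₂_iterate_leftEuler j δ h, eval₂_monomial]

theorem natDegree_iterate_leftEuler (i : ℕ) :
    (leftEuler^[i] 1).natDegree = i ∧ (leftEuler^[i] 1).leadingCoeff = X ^ i ∧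
      leftEuler^[i] 1 ≠ 0 := by
  induction i with
  | zero => simp
  | succ i ih =>
    obtain ⟨h1, h2, h3⟩ := ih
    obtain ⟨g1, g2, g3⟩ := degree_leftD _ h3
    rw [Function.iterate_succ_apply', leftEuler, natDegree_C_mul X_ne_zero, g2, h1,
      leadingCoeff_mul, g3, h2, leadingCoeff_C, pow_succ']
    exact ⟨rfl, rfl, mul_ne_zero (by simp [X_ne_zero]) g1⟩

/-- Θ^i has order i and leading coefficient X^i, so the top coefficient of `M` is only multiplied by
a power of X. -/
theorem ofEuler_ne_zero (M : ℂ[X][X]) (hM : M ≠ 0) :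
    ofEuler M ≠ 0 ∧ (ofEuler M).natDegree ≤ M.natDegree := by
  have h : (ofEuler M).coeff M.natDegree = M.leadingCoeff * X ^ M.natDegree := by
    unfold ofEuler
    rw [sum_def, finsetSum_coeff, Finset.sum_eq_single M.natDegree]
    · obtain ⟨h1, h2, -⟩ := natDegree_iterate_leftEuler M.natDegree
      have h3 : (leftEuler^[M.natDegree] 1).coeff M.natDegree = X ^ M.natDegree := by
        rw [← h2, leadingCoeff, h1]
      rw [coeff_C_mul, h3]
      rfl
    · intro i hi hne
      have hle := le_natDegree_of_mem_supp i hi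
      rw [coeff_C_mul, coeff_eq_zero_of_natDegree_lt (p := leftEuler^[i] 1), mul_zero]
      rw [(natDegree_iterate_leftEuler i).1]
      omega
    · intro hn
      exact absurd (natDegree_mem_support_of_nonzero hM) hn
  refine ⟨fun h0 => ?_, ?_⟩
  · rw [h0, coeff_zero] at h
    exact mul_ne_zero (by simpa using hM) (pow_ne_zero _ X_ne_zero) h.symm
  · unfold ofEuler
    refine natDegree_sum_le_of_forall_le _ _ fun i hi => ?_
    refine (natDegree_C_mul_le _ _).trans ?_
    rw [(natDegree_iterate_leftEuler i).1]
    exact le_natDegree_of_mem_supp i hi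

end Operators

/-! ### Taylor series of analytic germs -/

section Germs

open PowerSeries

/-- The Taylor series at `0`. -/
noncomputable def taylorSeries (f : ℂ → ℂ) : ℂ⟦X⟧ :=
  PowerSeries.mk fun n => iteratedDeriv n f 0 / n.factorial

theorem taylorSeries_mul {f g : ℂ → ℂ} (hf : AnalyticAt ℂ f 0) (hg : AnalyticAt ℂ g 0) :
    taylorSeries (fun z => f z * g z) = taylorSeries f * taylorSeries g := by
  have : (fun z => f z * g z) = f * g := rfl
  ext n
  simp only [taylorSeries, coeff_mk, this, iteratedDeriv_mul hf.contDiffAt hg.contDiffAt,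
    PowerSeries.coeff_mul, Finset.Nat.sum_antidiagonal_eq_sum_range_succ_mk, Nat.succ_eq_add_one,
    Finset.sum_div]
  refine Finset.sum_congr rfl fun i hi ↦ ?_
  rw [Nat.cast_choose _ (by have := Finset.mem_range.mp hi; omega)]
  field_simp [Nat.factorial_ne_zero]

theorem taylorSeries_add {f g : ℂ → ℂ} (hf : AnalyticAt ℂ f 0) (hg : AnalyticAt ℂ g 0) :
    taylorSeries (fun z => f z + g z) = taylorSeries f + taylorSeries g := by
  ext n
  simp only [taylorSeries, coeff_mk, map_add]
  rw [iteratedDeriv_fun_add hf.contDiffAt hg.contDiffAt, add_div]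

theorem taylorSeries_const (c : ℂ) : taylorSeries (fun _ => c) = PowerSeries.C c := by
  ext n
  rw [taylorSeries, coeff_mk, iteratedDeriv_const, PowerSeries.coeff_C]
  split_ifs with h <;> simp [h]

theorem taylorSeries_deriv (f : ℂ → ℂ) : taylorSeries (deriv f) = derivative ℂ (taylorSeries f) := by
  ext n
  rw [coeff_derivative, taylorSeries, taylorSeries, coeff_mk, coeff_mk, iteratedDeriv_succ',
    Nat.factorial_succ]
  push_cast
  have : ((n : ℂ) + 1) ≠ 0 := Nat.cast_add_one_ne_zero n
  field_simp [Nat.factorial_ne_zero]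

theorem taylorSeries_id : taylorSeries (fun z => z) = X := by
  have h : derivative ℂ (taylorSeries fun z => z) = derivative ℂ X := by
    rw [← taylorSeries_deriv, derivative_X, deriv_id'', taylorSeries_const, map_one]
  refine derivative.ext h ?_
  simp [taylorSeries]

theorem taylorSeries_eq_zero_iff {f : ℂ → ℂ} (hf : AnalyticAt ℂ f 0) :
    taylorSeries f = 0 ↔ f =ᶠ[𝓝 0] 0 := by
  refine Iff.trans ?_ hf.hasFPowerSeriesAt.locally_zero_iff.symm
  rw [FormalMultilinearSeries.ofScalars_series_eq_zero, PowerSeries.ext_iff, funext_iff]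
  simp [taylorSeries]

theorem analyticAt_eval (p : Polynomial ℂ) : AnalyticAt ℂ (fun z => p.eval z) 0 :=
  AnalyticOnNhd.eval_polynomial p 0 (Set.mem_univ 0)

theorem taylorSeries_eval (p : Polynomial ℂ) : taylorSeries (fun z => p.eval z) = p := by
  induction p using Polynomial.induction_on with
  | add p q hp hq =>
    simp only [Polynomial.eval_add]
    rw [taylorSeries_add (analyticAt_eval p) (analyticAt_eval q), hp, hq, Polynomial.coe_add]
  | C a => simp [taylorSeries_const]
  | monomial n a ih =>
    have : (fun z => Polynomial.eval z (Polynomial.C a * Polynomial.X ^ (n + 1)))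
        = fun z => Polynomial.eval z (Polynomial.C a * Polynomial.X ^ n) * z := by
      ext z; simp [pow_succ, mul_assoc]
    rw [this, taylorSeries_mul (g := fun z => z) (analyticAt_eval _) analyticAt_id, ih, taylorSeries_id, pow_succ,
      ← mul_assoc, Polynomial.coe_mul _ Polynomial.X, Polynomial.coe_X]

theorem taylorSeries_of_hasSum {f : ℂ → ℂ} {c : ℕ → ℂ}
    (h : ∀ᶠ z in 𝓝 (0 : ℂ), HasSum (fun n => c n * z ^ n) (f z)) :
    AnalyticAt ℂ f 0 ∧ taylorSeries f = PowerSeries.mk c := by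
  have h1 : HasFPowerSeriesAt f (FormalMultilinearSeries.ofScalars ℂ c) 0 := by
    rw [hasFPowerSeriesAt_iff]
    filter_upwards [h] with z hz
    simpa [FormalMultilinearSeries.coeff_ofScalars, mul_comm] using hz
  refine ⟨h1.analyticAt, ?_⟩
  have h2 := h1.eq_formalMultilinearSeries h1.analyticAt.hasFPowerSeriesAt
  rw [FormalMultilinearSeries.ofScalars_series_eq_iff] at h2
  ext n
  simp [taylorSeries, congrFun h2 n]

/-- Multiplication of power series by polynomials. -/
noncomputable def mulSeries : Polynomial ℂ →+* Module.End ℂ ℂ⟦X⟧ :=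
  (Algebra.lmul ℂ ℂ⟦X⟧).toRingHom.comp Polynomial.coeToPowerSeries.ringHom

/-- The derivation of power series. -/
noncomputable def derivSeries : Module.End ℂ ℂ⟦X⟧ := (derivative ℂ).toLinearMap

theorem mulSeries_apply (a : Polynomial ℂ) (f : ℂ⟦X⟧) : mulSeries a f = a * f := rfl

theorem derivSeries_apply (f : ℂ⟦X⟧) : derivSeries f = derivative ℂ f := rfl

theorem isWeyl_series : IsWeyl mulSeries derivSeries := by
  intro a
  ext1 f
  simp only [Module.End.mul_apply, LinearMap.add_apply, mulSeries_apply, derivSeries_apply,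
    Derivation.leibniz, derivative_coe, smul_eq_mul]
  ring

theorem analyticAt_euler {f : ℂ → ℂ} (hf : AnalyticAt ℂ f 0) : AnalyticAt ℂ (euler f) 0 :=
  analyticAt_id.mul hf.deriv

theorem taylorSeries_euler {f : ℂ → ℂ} (hf : AnalyticAt ℂ f 0) :
    taylorSeries (euler f) = (mulSeries Polynomial.X * derivSeries) (taylorSeries f) := by
  unfold euler
  rw [taylorSeries_mul (f := fun z => z) analyticAt_id hf.deriv, taylorSeries_id, taylorSeries_deriv,
    Module.End.mul_apply, mulSeries_apply, derivSeries_apply, Polynomial.coe_X]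

theorem analyticAt_iterate_euler {f : ℂ → ℂ} (hf : AnalyticAt ℂ f 0) (i : ℕ) :
    AnalyticAt ℂ (euler^[i] f) 0 := by
  induction i with
  | zero => exact hf
  | succ i ih => rw [Function.iterate_succ_apply']; exact analyticAt_euler ih

theorem taylorSeries_iterate_euler {f : ℂ → ℂ} (hf : AnalyticAt ℂ f 0) (i : ℕ) :
    taylorSeries (euler^[i] f) = ((mulSeries Polynomial.X * derivSeries) ^ i) (taylorSeries f) := by
  induction i with
  | zero => rfl
  | succ i ih =>
    rw [Function.iterate_succ_apply', taylorSeries_euler (analyticAt_iterate_euler hf i), ih,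
      pow_succ' (_ * _), Module.End.mul_apply (_ * _)]

theorem taylorSeries_applyOp {f : ℂ → ℂ} (hf : AnalyticAt ℂ f 0)
    (M : Polynomial (Polynomial ℂ)) :
    AnalyticAt ℂ (applyOp M f) 0 ∧ taylorSeries (applyOp M f)
      = (M.eval₂ mulSeries (mulSeries Polynomial.X * derivSeries)) (taylorSeries f) := by
  induction M using Polynomial.induction_on' with
  | add A B hA hB =>
    have : applyOp (A + B) f = fun z => applyOp A f z + applyOp B f z := by
      ext z
      unfold applyOp
      rw [Polynomial.sum_add_index _ _ _ (by simp) (by intros; simp; ring)]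
    rw [this, taylorSeries_add hA.1 hB.1, hA.2, hB.2, Polynomial.eval₂_add]
    exact ⟨hA.1.add hB.1, rfl⟩
  | monomial i a =>
    have : applyOp (Polynomial.monomial i a) f = fun z => a.eval z * euler^[i] f z := by
      ext z
      unfold applyOp
      rw [Polynomial.sum_monomial_index _ _ (by simp)]
    rw [this, taylorSeries_mul (analyticAt_eval a) (analyticAt_iterate_euler hf i),
      taylorSeries_eval, taylorSeries_iterate_euler hf, Polynomial.eval₂_monomial]
    exact ⟨(analyticAt_eval a).mul (analyticAt_iterate_euler hf i), rfl⟩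

/-- An analytic germ vanishes exactly when its Taylor series does. Annihilation thus becomes algebra
with power series, and nothing analytic is needed for minimality. -/
theorem applyOp_eventuallyEq_zero_iff {f : ℂ → ℂ} (hf : AnalyticAt ℂ f 0)
    (M : Polynomial (Polynomial ℂ)) :
    applyOp M f =ᶠ[𝓝 0] 0 ↔ ((ofEuler M).eval₂ mulSeries derivSeries) (taylorSeries f) = 0 := by
  obtain ⟨h1, h2⟩ := taylorSeries_applyOp hf M
  rw [← taylorSeries_eq_zero_iff h1, h2, eval₂_ofEuler _ _ isWeyl_series]

end Germs

/-! ### Indicial polynomials -/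

section Indicial

open Polynomial

/-- Multiplication by polynomials after the translation that moves `p` to `0`. -/
noncomputable def mulTaylor (p : ℂ) : ℂ[X] →+* Module.End ℂ ℂ[X] :=
  (Algebra.lmul ℂ ℂ[X]).toRingHom.comp (taylorAlgHom p).toRingHom

theorem mulTaylor_apply (p : ℂ) (a f : ℂ[X]) : mulTaylor p a f = taylor p a * f := rfl

theorem derivative_taylor (p : ℂ) (a : ℂ[X]) :
    derivative (taylor p a) = taylor p (derivative a) := by
  simp [taylor_apply, derivative_comp]

theorem isWeyl_taylor (p : ℂ) : IsWeyl (mulTaylor p) derivative := by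
  intro a
  refine LinearMap.ext fun f => ?_
  simp only [Module.End.mul_apply, LinearMap.add_apply, mulTaylor_apply, derivative_mul,
    derivative_taylor]

/-- The coefficients of a polynomial, indexed by the integers. -/
noncomputable def zcoeff (a : ℂ[X]) (k : ℤ) : ℂ := if 0 ≤ k then a.coeff k.toNat else 0

theorem zcoeff_natCast (a : ℂ[X]) (k : ℕ) : zcoeff a k = a.coeff k := by simp [zcoeff]

/-- The component of degree `j` of the operator `A`, in powers of `X - p`: the operator maps
`(X - p) ^ s` to `∑ j, symb p A j (s) (X - p) ^ (s + j)`. -/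
noncomputable def symb (p : ℂ) (A : ℂ[X][X]) (j : ℤ) : ℂ[X] :=
  A.sum fun i a => C (zcoeff (taylor p a) (i + j)) * descPochhammer ℂ i

theorem zcoeff_zero (k : ℤ) : zcoeff 0 k = 0 := by simp [zcoeff]

theorem zcoeff_add (a b : ℂ[X]) (k : ℤ) : zcoeff (a + b) k = zcoeff a k + zcoeff b k := by
  unfold zcoeff; split_ifs <;> simp

theorem symb_add (p : ℂ) (A B : ℂ[X][X]) (j : ℤ) : symb p (A + B) j = symb p A j + symb p B j := by
  unfold symb
  rw [sum_add_index _ _ _ (by simp [zcoeff_zero]) (by intros; simp [zcoeff_add]; ring)]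

theorem symb_monomial (p : ℂ) (i : ℕ) (a : ℂ[X]) (j : ℤ) :
    symb p (monomial i a) j = C (zcoeff (taylor p a) (i + j)) * descPochhammer ℂ i := by
  unfold symb
  rw [sum_monomial_index _ _ (by simp [zcoeff_zero])]

/-- (d/dX)^i sends X^s to s(s-1)⋯(s-i+1) X^(s-i). The falling factorial vanishes for s < i, where
the truncated exponent would be wrong. -/
theorem coeff_act_X_pow (p : ℂ) (A : ℂ[X][X]) (s n : ℕ) :
    ((A.eval₂ (mulTaylor p) derivative) (X ^ s)).coeff n = (symb p A (n - s)).eval (s : ℂ) := by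
  induction A using Polynomial.induction_on' with
  | add A B hA hB =>
    rw [eval₂_add, LinearMap.add_apply, coeff_add, hA, hB, symb_add, eval_add]
  | monomial i a =>
    rw [eval₂_monomial, symb_monomial, Module.End.mul_apply, mulTaylor_apply, Module.End.pow_apply,
      iterate_derivative_X_pow_eq_smul, eval_mul, eval_C, descPochhammer_eval_eq_descFactorial,
      mul_smul_comm, coeff_smul, coeff_mul_X_pow', smul_eq_mul, mul_comm]
    by_cases his : i ≤ s
    · unfold zcoeff
      have hiff : s - i ≤ n ↔ (0 : ℤ) ≤ i + (n - s) := by omega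
      have ht : ((i : ℤ) + (n - s)).toNat = n - (s - i) := by omega
      simp only [hiff, ht]
    · rw [Nat.descFactorial_of_lt (by omega)]; simp

theorem coeff_act (p : ℂ) (A : ℂ[X][X]) (g : ℂ[X]) (n : ℕ) :
    ((A.eval₂ (mulTaylor p) derivative) g).coeff n
      = ∑ m ∈ g.support, g.coeff m * (symb p A (n - m)).eval (m : ℂ) := by
  conv_lhs => rw [g.as_sum_support_C_mul_X_pow]
  rw [map_sum, finsetSum_coeff]
  refine Finset.sum_congr rfl fun m _ => ?_
  rw [← smul_eq_C_mul, map_smul, coeff_smul, coeff_act_X_pow, smul_eq_mul]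

/-- `v` is the extremal degree of `A`: the least one for `σ = 1` and the largest one for
`σ = -1`. -/
def IsExt (σ : ℤ) (p : ℂ) (A : ℂ[X][X]) (v : ℤ) : Prop :=
  symb p A v ≠ 0 ∧ ∀ j, σ * j < σ * v → symb p A j = 0

theorem IsExt.unique {σ : ℤ} (hσ : σ ≠ 0) {p : ℂ} {A : ℂ[X][X]} {v w : ℤ} (hv : IsExt σ p A v)
    (hw : IsExt σ p A w) : v = w := by
  rcases lt_trichotomy (σ * v) (σ * w) with h | h | h
  · exact absurd (hw.2 v h) hv.1
  · exact mul_left_cancel₀ hσ h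
  · exact absurd (hv.2 w h) hw.1

/-- Symbols are compared at large natural s only, because a shift by a negative degree must stay
inside the polynomials. -/
theorem eq_of_eval_large {f g : ℂ[X]} (N : ℤ)
    (h : ∀ s : ℕ, N ≤ s → f.eval (s : ℂ) = g.eval (s : ℂ)) : f = g := by
  refine eq_of_infinite_eval_eq f g ?_
  have hinf : (Set.Ici N.toNat).Infinite := Set.Ici_infinite _
  refine (hinf.image (f := fun s : ℕ => (s : ℂ)) Nat.cast_injective.injOn).mono ?_
  rintro _ ⟨s, hs, rfl⟩
  exact h s (by have : N.toNat ≤ s := hs; omega)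

/-- Apply `Q` after `M` to X^s. In the extremal total degree only the extremal parts of both can
meet, and that of `M` moves s to s + v before `Q` acts. The product of the two symbols is nonzero
because ℂ[X] is a domain. -/
theorem isExt_mul {σ : ℤ} (hσ : σ ≠ 0) {p : ℂ} {B Q M : ℂ[X][X]}
    (hB : B.eval₂ (mulTaylor p) derivative
      = Q.eval₂ (mulTaylor p) derivative * M.eval₂ (mulTaylor p) derivative)
    {v w : ℤ} (hM : IsExt σ p M v) (hQ : IsExt σ p Q w) :
    IsExt σ p B (v + w) ∧
      symb p B (v + w) = symb p M v * (symb p Q w).comp (X + C (v : ℂ)) := by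
  have key : ∀ s n : ℕ, (symb p B (n - s)).eval (s : ℂ)
      = ∑ m ∈ ((M.eval₂ (mulTaylor p) derivative) (X ^ s)).support,
        (symb p M (m - s)).eval (s : ℂ) * (symb p Q (n - m)).eval (m : ℂ) := by
    intro s n
    rw [← coeff_act_X_pow, hB, Module.End.mul_apply, coeff_act]
    simp only [coeff_act_X_pow]
  have hlow : ∀ j, σ * j < σ * (v + w) → symb p B j = 0 := by
    intro j hj
    refine eq_of_eval_large (-j) fun s hs => ?_
    obtain ⟨n, hn⟩ := Int.eq_ofNat_of_zero_le (by omega : 0 ≤ (s : ℤ) + j)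
    have hjn : j = n - s := by omega
    rw [hjn, key, eval_zero]
    refine Finset.sum_eq_zero fun m _ => ?_
    by_cases h1 : σ * (m - s) < σ * v
    · rw [hM.2 _ h1, eval_zero, zero_mul]
    · rw [hQ.2 (n - m), eval_zero, mul_zero]
      rw [hjn] at hj
      linarith
  have hid : symb p B (v + w) = symb p M v * (symb p Q w).comp (X + C (v : ℂ)) := by
    -- This bound makes both s + v and s + v + w nonnegative.
    refine eq_of_eval_large (|v| + |v + w|) fun s hs => ?_
    have a1 := neg_abs_le v
    have a2 := neg_abs_le (v + w)
    have a3 := abs_nonneg v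
    have a4 := abs_nonneg (v + w)
    obtain ⟨n, hn⟩ := Int.eq_ofNat_of_zero_le (by omega : 0 ≤ (s : ℤ) + (v + w))
    obtain ⟨m₀, hm₀⟩ := Int.eq_ofNat_of_zero_le (by omega : 0 ≤ (s : ℤ) + v)
    have hjn : v + w = n - s := by omega
    rw [hjn, key, Finset.sum_eq_single m₀]
    · have e1 : (m₀ : ℤ) - s = v := by omega
      have e2 : (n : ℤ) - m₀ = w := by omega
      have e3 : (m₀ : ℂ) = s + v := by
        have : ((m₀ : ℤ) : ℂ) = ((s + v : ℤ) : ℂ) := by rw [hm₀]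
        push_cast at this; exact this
      rw [e1, e2, e3, eval_mul, eval_comp]
      simp
    · intro m _ hne
      by_cases h1 : σ * (m - s) < σ * v
      · rw [hM.2 _ h1, eval_zero, zero_mul]
      · rw [hQ.2 (n - m), eval_zero, mul_zero]
        refine lt_of_le_of_ne ?_ ?_
        · have : σ * (v + w) = σ * (n - s) := by rw [hjn]
          linarith
        · intro h
          have := mul_left_cancel₀ hσ h
          omega
    · intro h0
      have e1 : (m₀ : ℤ) - s = v := by omega
      rw [← coeff_act_X_pow, notMem_support_iff.mp h0, zero_mul]
  refine ⟨⟨?_, hlow⟩, hid⟩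
  rw [hid]
  refine mul_ne_zero hM.1 fun h => hQ.1 ?_
  have := congrArg (fun f => f.comp (X - C (v : ℂ))) h
  simpa [comp_assoc] using this

theorem symb_eq_sum_range (p : ℂ) (A : ℂ[X][X]) (j : ℤ) (r : ℕ) (hr : A.natDegree ≤ r) :
    symb p A j = ∑ i ∈ Finset.range (r + 1),
      C (zcoeff (taylor p (A.coeff i)) (i + j)) * descPochhammer ℂ i := by
  unfold symb
  rw [sum_over_range' _ (by simp [zcoeff_zero]) (r + 1) (by omega)]

theorem natDegree_symb_le (p : ℂ) (A : ℂ[X][X]) (j : ℤ) : (symb p A j).natDegree ≤ A.natDegree := by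
  rw [symb_eq_sum_range p A j _ le_rfl]
  refine natDegree_sum_le_of_forall_le _ _ fun i hi => ?_
  refine (natDegree_C_mul_le _ _).trans ?_
  rw [descPochhammer_natDegree]
  have := Finset.mem_range.mp hi
  omega

theorem coeff_descPochhammer_self (r : ℕ) : (descPochhammer ℂ r).coeff r = 1 := by
  have h := monic_descPochhammer ℂ r
  rw [Monic, leadingCoeff, descPochhammer_natDegree] at h
  exact h

theorem coeff_descPochhammer_pred (r : ℕ) :
    (descPochhammer ℂ (r + 1)).coeff r = -((r + 1) * r / 2) := by
  induction r with
  | zero => simp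
  | succ r ih =>
    rw [descPochhammer_succ_right, mul_sub, coeff_sub, coeff_mul_X, ih, ← C_eq_natCast,
      coeff_mul_C, coeff_descPochhammer_self]
    push_cast
    ring

theorem coeff_descPochhammer_of_lt {i r : ℕ} (h : i < r) : (descPochhammer ℂ i).coeff r = 0 :=
  coeff_eq_zero_of_natDegree_lt (by rwa [descPochhammer_natDegree])

theorem coeff_symb_top (p : ℂ) (A : ℂ[X][X]) (j : ℤ) (r : ℕ) (hr : A.natDegree ≤ r) :
    (symb p A j).coeff r = zcoeff (taylor p (A.coeff r)) (r + j) := by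
  rw [symb_eq_sum_range p A j r hr, finsetSum_coeff, Finset.sum_range_succ, Finset.sum_eq_zero,
    zero_add, coeff_C_mul, coeff_descPochhammer_self, mul_one]
  intro i hi
  rw [coeff_C_mul, coeff_descPochhammer_of_lt (Finset.mem_range.mp hi), mul_zero]

theorem coeff_symb_pred (p : ℂ) (A : ℂ[X][X]) (j : ℤ) (r : ℕ) (hr : A.natDegree ≤ r + 1) :
    (symb p A j).coeff r = zcoeff (taylor p (A.coeff r)) (r + j)
      - (r + 1) * r / 2 * zcoeff (taylor p (A.coeff (r + 1))) (r + 1 + j) := by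
  rw [symb_eq_sum_range p A j (r + 1) hr, finsetSum_coeff, Finset.sum_range_succ,
    Finset.sum_range_succ, Finset.sum_eq_zero, coeff_C_mul, coeff_C_mul, coeff_descPochhammer_self,
    coeff_descPochhammer_pred]
  · push_cast; ring
  · intro i hi
    rw [coeff_C_mul, coeff_descPochhammer_of_lt (Finset.mem_range.mp hi), mul_zero]

theorem finite_symb_ne_zero (p : ℂ) (A : ℂ[X][X]) : {j | symb p A j ≠ 0}.Finite := by
  refine (A.support.finite_toSet.biUnion (t := fun i =>
    (fun k : ℕ => (k : ℤ) - i) '' ((taylor p (A.coeff i)).support : Set ℕ))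
    fun i _ => (Finset.finite_toSet _).image _).subset ?_
  intro j hj
  simp only [Set.mem_ofPred_eq, symb, sum_def] at hj
  obtain ⟨i, hi, hne⟩ := Finset.exists_ne_zero_of_sum_ne_zero hj
  have h1 : zcoeff (taylor p (A.coeff i)) (i + j) ≠ 0 := by
    intro h; rw [h] at hne; simp at hne
  refine Set.mem_biUnion hi ⟨(i + j).toNat, ?_, ?_⟩
  · unfold zcoeff at h1
    split_ifs at h1 with h2
    · exact mem_support_iff.mpr h1
    · exact absurd rfl h1
  · unfold zcoeff at h1
    split_ifs at h1 with h2
    · simp only; omega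
    · exact absurd rfl h1

theorem taylor_ne_zero (p : ℂ) {a : ℂ[X]} (ha : a ≠ 0) : taylor p a ≠ 0 := by
  intro h
  exact ha (taylor_injective p (by rw [h, map_zero]))

theorem exists_isExt (σ : ℤ) (p : ℂ) (A : ℂ[X][X]) (hA : A ≠ 0) : ∃ v, IsExt σ p A v := by
  have hne : {j | symb p A j ≠ 0}.Nonempty := by
    have h1 : taylor p A.leadingCoeff ≠ 0 := taylor_ne_zero p (by simpa using hA)
    obtain ⟨k, hk⟩ := Polynomial.support_nonempty.mpr h1
    -- In this degree a nonzero coefficient of the leading coefficient becomes the top coefficient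
    -- of the symbol, which the terms of lower order cannot cancel.
    refine ⟨(k : ℤ) - A.natDegree, fun h0 => ?_⟩
    have h2 := coeff_symb_top p A ((k : ℤ) - A.natDegree) A.natDegree le_rfl
    rw [h0, coeff_zero, add_sub_cancel, zcoeff_natCast] at h2
    exact mem_support_iff.mp hk h2.symm
  obtain ⟨v, hv, hmin⟩ := Set.exists_min_image _ (fun j => σ * j) (finite_symb_ne_zero p A) hne
  refine ⟨v, hv, fun j hj => ?_⟩
  by_contra h
  exact absurd (hmin j h) (not_le.mpr hj)

theorem symb_C (p : ℂ) (h : ℂ[X]) (j : ℤ) : symb p (C h) j = C (zcoeff (taylor p h) j) := by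
  rw [← monomial_zero_left, symb_monomial]
  simp

/-- The indicial polynomial of a right factor divides that of the operator, and a right factor of
a regular operator is regular. -/
theorem exists_symb_dvd {σ : ℤ} (hσ : σ ≠ 0) (p : ℂ) {L Q M : ℂ[X][X]} {h : ℂ[X]} (hh : h ≠ 0)
    (hM0 : M ≠ 0) (hdeg : M.natDegree ≤ L.natDegree)
    (hQd : Q.natDegree ≤ L.natDegree - M.natDegree)
    (hid : mulTaylor p h * L.eval₂ (mulTaylor p) derivative
      = Q.eval₂ (mulTaylor p) derivative * M.eval₂ (mulTaylor p) derivative)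
    {l : ℤ} (hl : IsExt σ p L l) (hreg : (symb p L l).natDegree = L.natDegree) :
    ∃ v, IsExt σ p M v ∧ (symb p M v).natDegree = M.natDegree ∧ symb p M v ∣ symb p L l := by
  obtain ⟨k, hk⟩ := exists_isExt σ p (C h) (by simpa using hh)
  obtain ⟨v, hv⟩ := exists_isExt σ p M hM0
  have hB : (C h * L).eval₂ (mulTaylor p) derivative
      = (C h).eval₂ (mulTaylor p) derivative * L.eval₂ (mulTaylor p) derivative := by
    rw [eval₂_C_mul_left, eval₂_C]
  obtain ⟨b1, b2⟩ := isExt_mul hσ hB hl hk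
  have hQ0 : Q ≠ 0 := by
    rintro rfl
    rw [eval₂_zero, zero_mul, ← eval₂_C_mul_left] at hid
    have : ∀ j, symb p (C h * L) j = 0 := by
      intro j
      refine eq_of_eval_large (-j) fun s hs => ?_
      obtain ⟨n, hn⟩ := Int.eq_ofNat_of_zero_le (by omega : 0 ≤ (s : ℤ) + j)
      have hjn : j = n - s := by omega
      rw [hjn, ← coeff_act_X_pow, hid]
      simp
    exact b1.1 (this _)
  obtain ⟨w, hw⟩ := exists_isExt σ p Q hQ0
  obtain ⟨c1, c2⟩ := isExt_mul (B := C h * L) hσ (by rw [eval₂_C_mul_left, hid]) hv hw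
  have hvw := b1.unique hσ c1
  rw [← hvw, b2, symb_C, C_comp] at c2
  have hc : zcoeff (taylor p h) k ≠ 0 := by
    have := hk.1
    rw [symb_C] at this
    exact fun h0 => this (by rw [h0, C_0])
  refine ⟨v, hv, ?_, ?_⟩
  · have hQc : (symb p Q w).comp (X + C (v : ℂ)) ≠ 0 := by
      intro h0
      rw [h0, mul_zero] at c2
      exact mul_ne_zero hl.1 (by simpa using hc) c2
    -- The degrees of the symbols of `Q` and `M` are at most their orders, yet they add up to the
    -- order of `L`. The bound for `M` must therefore be attained, which is its regularity.
    have d := congrArg natDegree c2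
    rw [natDegree_mul_C hc, hreg, natDegree_mul hv.1 hQc, natDegree_comp, natDegree_X_add_C,
      mul_one] at d
    have d1 := natDegree_symb_le p Q w
    have d2 := natDegree_symb_le p M v
    omega
  -- Multiplication by `h` has a constant as extremal symbol, so it does not affect divisibility.
  · have hu : IsUnit (C (zcoeff (taylor p h) k)) := isUnit_C.mpr (isUnit_iff_ne_zero.mpr hc)
    exact (hu.dvd_mul_right).mp ⟨_, c2⟩

end Indicial

/-! ### The Fuchs relation -/

section Fuchs

open Polynomial

/-- `A` is regular at `p` (for `σ = 1`) or at infinity (for `σ = -1` and `p = 0`), and `f` is its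
indicial polynomial there. -/
def IsIndicial (σ : ℤ) (p : ℂ) (A : ℂ[X][X]) (f : ℂ[X]) : Prop :=
  ∃ v, IsExt σ p A v ∧ symb p A v = f ∧ f.natDegree = A.natDegree

theorem coeff_eq_neg_sum_roots {f : ℂ[X]} {q : ℕ} (hf : f.natDegree = q + 1) :
    f.coeff q = -(f.coeff (q + 1) * f.roots.sum) := by
  have h := (IsAlgClosed.splits f).nextCoeff_eq_neg_sum_roots_mul_leadingCoeff
  rw [nextCoeff_of_natDegree_pos (by omega), leadingCoeff, hf, Nat.add_sub_cancel] at h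
  rw [h]; ring

/-- The two leading coefficients of a regular operator near a point. -/
theorem IsIndicial.coeffs {σ : ℤ} {p : ℂ} {A : ℂ[X][X]} {f : ℂ[X]} (h : IsIndicial σ p A f) {q : ℕ}
    (hq : A.natDegree = q + 1) :
    ∃ m : ℕ, (taylor p (A.coeff (q + 1))).coeff m ≠ 0 ∧
      (∀ k : ℕ, σ * k < σ * m → (taylor p (A.coeff (q + 1))).coeff k = 0) ∧
      (∀ k : ℕ, σ * (k + 1) < σ * m → (taylor p (A.coeff q)).coeff k = 0) ∧
      zcoeff (taylor p (A.coeff q)) (m - 1)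
        = (taylor p (A.coeff (q + 1))).coeff m * ((q + 1) * q / 2 - f.roots.sum) := by
  obtain ⟨v, hv, hf, hd⟩ := h
  have hd' : f.natDegree = q + 1 := hd.trans hq
  have hf0 : f ≠ 0 := by rw [← hf]; exact hv.1
  have htop (j : ℤ) := coeff_symb_top p A j (q + 1) hq.le
  have hpred (j : ℤ) := coeff_symb_pred p A j q hq.le
  have hlead : f.coeff (q + 1) ≠ 0 := by
    rw [← hd', coeff_natDegree]; simpa using hf0
  have hz : zcoeff (taylor p (A.coeff (q + 1))) ((q + 1 : ℕ) + v) ≠ 0 := by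
    rw [← htop, hf]; exact hlead
  have h0 : 0 ≤ ((q + 1 : ℕ) : ℤ) + v := by
    by_contra hneg
    exact hz (by rw [zcoeff, if_neg hneg])
  -- Here m is the order of vanishing at p of the leading coefficient if σ = 1, and its degree if σ
  -- = -1.
  obtain ⟨m, hm⟩ := Int.eq_ofNat_of_zero_le h0
  have hvan : ∀ k : ℤ, σ * k < σ * m → zcoeff (taylor p (A.coeff (q + 1))) k = 0 := by
    intro k hk
    have := htop (k - (q + 1 : ℕ))
    rw [hv.2 _ (by rw [← hm, mul_add] at hk; rw [mul_sub]; linarith), coeff_zero,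
      add_sub_cancel] at this
    exact this.symm
  refine ⟨m, ?_, fun k hk => ?_, fun k hk => ?_, ?_⟩
  · rwa [hm, zcoeff_natCast] at hz
  · rw [← zcoeff_natCast, hvan _ hk]
  · have := hpred (k - q)
    rw [hv.2 _ (by
        have : σ * (m : ℤ) = σ * ((q + 1 : ℕ) + v) := by rw [hm]
        rw [this] at hk; push_cast at hk; linarith),
      coeff_zero, add_sub_cancel, zcoeff_natCast,
      show (q : ℤ) + 1 + (k - q) = ((k : ℤ) + 1) by ring, hvan _ hk] at this
    simpa using this.symm
  -- Vieta: the two top coefficients of the indicial polynomial give the sum of its roots. The term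
  -- (q+1)q/2 is the subleading coefficient of the falling factorial of degree q + 1, up to sign.
  · have h1 := hpred v
    have h2 := htop v
    rw [hf, coeff_eq_neg_sum_roots hd'] at h1
    rw [hf] at h2
    push_cast at h2 hm
    rw [show (q : ℤ) + v = m - 1 by linarith, show (q : ℤ) + 1 + v = m from hm] at h1
    rw [show (q : ℤ) + 1 + v = m from hm] at h2
    rw [zcoeff_natCast] at h1 h2
    rw [h2] at h1
    linear_combination -h1

theorem X_sub_C_pow_dvd_iff_coeff (p : ℂ) (n : ℕ) (f : ℂ[X]) :
    (X - C p) ^ n ∣ f ↔ ∀ k < n, (taylor p f).coeff k = 0 := by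
  rw [X_sub_C_pow_dvd_iff, ← taylor_apply, X_pow_dvd_iff]

/-- Let `ρ p` be `(q + 1) q / 2` minus the sum of the exponents at `p`, for an operator of order
`q + 1` that is regular everywhere. The sum of all `ρ p` is the value at infinity. -/
theorem fuchs_relation {M : ℂ[X][X]} {q : ℕ} (hq : M.natDegree = q + 1) (F : ℂ → ℂ[X])
    (hF : ∀ p, IsIndicial 1 p M (F p)) {G : ℂ[X]} (hG : IsIndicial (-1) 0 M G) :
    ∑ p ∈ (M.coeff (q + 1)).roots.toFinset, (((q : ℂ) + 1) * q / 2 - (F p).roots.sum)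
      = (q + 1) * q / 2 - G.roots.sum := by
  set a := M.coeff (q + 1) with ha
  set b := M.coeff q with hb
  set ρ : ℂ → ℂ := fun p => ((q : ℂ) + 1) * q / 2 - (F p).roots.sum with hρ
  have ha0 : a ≠ 0 := by
    intro h0
    have : M.leadingCoeff = 0 := by rw [leadingCoeff, hq]; exact h0
    rw [leadingCoeff_eq_zero.mp this] at hq
    simp at hq
  obtain ⟨m, m1, m2, m3, m4⟩ := hG.coeffs hq
  rw [← ha, ← hb] at *
  simp only [taylor_zero] at m1 m2 m3 m4
  have hdega : a.natDegree = m := by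
    refine natDegree_eq_of_le_of_coeff_ne_zero ?_ m1
    rw [natDegree_le_iff_coeff_eq_zero]
    intro k hk
    exact m2 k (by omega)
  have hdegb : ∀ k, m ≤ k → b.coeff k = 0 := fun k hk => m3 k (by omega)
  have hlc : a.leadingCoeff = a.coeff m := by rw [leadingCoeff, hdega]
  set S := a.roots.toFinset with hS
  have hroot : ∀ p ∈ S, (X - C p) * (a /ₘ (X - C p)) = a := by
    intro p hp
    rw [mul_divByMonic_eq_iff_isRoot]
    exact (mem_roots ha0).mp (Multiset.mem_toFinset.mp hp)
  have hdegc : ∀ p ∈ S, (a /ₘ (X - C p)).natDegree + 1 = m ∧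
      (a /ₘ (X - C p)).leadingCoeff = a.leadingCoeff := by
    intro p hp
    have h1 := hroot p hp
    have hc0 : a /ₘ (X - C p) ≠ 0 := by
      intro h0; rw [h0, mul_zero] at h1; exact ha0 h1.symm
    have h2 := congrArg natDegree h1
    have h3 := congrArg leadingCoeff h1
    rw [natDegree_mul (X_sub_C_ne_zero p) hc0, natDegree_X_sub_C, hdega] at h2
    rw [leadingCoeff_mul, leadingCoeff_X_sub_C, one_mul] at h3
    exact ⟨by omega, h3⟩
  -- Regularity means that b/a has at most simple poles, with residue ρ p at p. The vanishing of d
  -- is the partial fraction expansion of b/a: a divides d at every root, while the degree of d is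
  -- smaller than that of a.
  set d := b - ∑ p ∈ S, C (ρ p) * (a /ₘ (X - C p)) with hd
  have hdvd : ∀ p ∈ S, (X - C p) ^ (a.rootMultiplicity p) ∣ d := by
    intro p hp
    obtain ⟨n, n1, n2, n3, n4⟩ := (hF p).coeffs hq
    rw [← ha, ← hb] at *
    have n2' : ∀ k < n, (taylor p a).coeff k = 0 := fun k hk => n2 k (by omega)
    have hmult : a.rootMultiplicity p = n := by
      refine le_antisymm ?_ ?_
      · rw [rootMultiplicity_le_iff ha0, X_sub_C_pow_dvd_iff_coeff]
        exact fun h => n1 (h n (Nat.lt_succ_self n))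
      · rw [le_rootMultiplicity_iff ha0, X_sub_C_pow_dvd_iff_coeff]
        exact n2'
    have hn1 : 1 ≤ n := by
      rw [← hmult]
      exact (rootMultiplicity_pos ha0).mpr ((mem_roots ha0).mp (Multiset.mem_toFinset.mp hp))
    rw [hmult, hd, ← Finset.add_sum_erase _ _ hp, ← sub_sub]
    refine dvd_sub ?_ (Finset.dvd_sum fun p' hp' => Dvd.dvd.mul_left ?_ _)
    · have hc : ∀ k, (taylor p (a /ₘ (X - C p))).coeff k = (taylor p a).coeff (k + 1) := by
        intro k
        conv_rhs => rw [← hroot p hp]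
        rw [taylor_mul, map_sub, taylor_X, taylor_C, add_sub_cancel_right, coeff_X_mul]
      rw [X_sub_C_pow_dvd_iff_coeff]
      intro k hk
      rw [map_sub, taylor_mul, taylor_C, coeff_sub, coeff_C_mul, hc]
      rcases Nat.lt_or_ge (k + 1) n with h | h
      · rw [n2' _ h, n3 k (by omega)]; ring
      · have hkn : k + 1 = n := by omega
        rw [hkn]
        rw [show (n : ℤ) - 1 = (k : ℕ) by omega, zcoeff_natCast] at n4
        rw [n4]; ring
    · obtain ⟨hne, hp'S⟩ := Finset.mem_erase.mp hp'
      have h1 : (X - C p) ^ n ∣ (X - C p') * (a /ₘ (X - C p')) := by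
        rw [hroot p' hp'S, X_sub_C_pow_dvd_iff_coeff]; exact n2'
      refine IsCoprime.dvd_of_dvd_mul_left (IsCoprime.pow_left ?_) h1
      exact isCoprime_X_sub_C_of_isUnit_sub (isUnit_iff_ne_zero.mpr (sub_ne_zero.mpr (Ne.symm hne)))
  have hd0 : d = 0 := by
    by_contra hne
    have h1 : a ∣ d := by
      rw [IsAlgClosed.dvd_iff_roots_le_roots ha0 hne, Multiset.le_iff_count]
      intro p
      rw [count_roots, count_roots]
      by_cases hp : p ∈ S
      · exact (le_rootMultiplicity_iff hne).mpr (hdvd p hp)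
      · have : a.rootMultiplicity p = 0 := by
          rw [← count_roots, Multiset.count_eq_zero]
          exact fun h => hp (Multiset.mem_toFinset.mpr h)
        omega
    have h2 := natDegree_le_of_dvd h1 hne
    rw [hdega] at h2
    have h3 : ∀ k, m ≤ k → d.coeff k = 0 := by
      intro k hk
      rw [hd, coeff_sub, hdegb k hk, finsetSum_coeff, Finset.sum_eq_zero, sub_zero]
      intro p hp
      rw [coeff_C_mul, coeff_eq_zero_of_natDegree_lt (by have := (hdegc p hp).1; omega), mul_zero]
    exact hne (leadingCoeff_eq_zero.mp (h3 _ h2))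
  have hb' : b = ∑ p ∈ S, C (ρ p) * (a /ₘ (X - C p)) := sub_eq_zero.mp hd0
  -- The coefficient of degree m - 1 compares the behaviour at infinity: every quotient a/(X - p)
  -- has degree m - 1 and the leading coefficient of a.
  refine mul_left_cancel₀ m1 ?_
  rw [← m4]
  rcases Nat.eq_zero_or_pos m with h0 | hpos
  · have hS0 : S = ∅ := by
      rw [Finset.eq_empty_iff_forall_notMem]
      intro p hp
      have := (hdegc p hp).1
      omega
    rw [hS0, Finset.sum_empty, mul_zero, zcoeff, if_neg (by omega)]
  · rw [show (m : ℤ) - 1 = ((m - 1 : ℕ) : ℤ) by omega, zcoeff_natCast, hb', finsetSum_coeff,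
      Finset.mul_sum]
    refine Finset.sum_congr rfl fun p hp => ?_
    obtain ⟨h1, h2⟩ := hdegc p hp
    rw [coeff_C_mul, show m - 1 = (a /ₘ (X - C p)).natDegree by omega, coeff_natDegree, h2, hlc]
    ring

/-- The roots of `f` are natural numbers and `0` is at most a simple root. -/
def HasNatExponents (f : ℂ[X]) : Prop := (∀ x, f.IsRoot x → ∃ n : ℕ, x = n) ∧ ¬ X ^ 2 ∣ f

theorem HasNatExponents.of_dvd {f g : ℂ[X]} (hf : HasNatExponents f) (h : g ∣ f) :
    HasNatExponents g :=
  ⟨fun x hx => hf.1 x (hx.dvd h), fun h2 => hf.2 (h2.trans h)⟩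

theorem exists_natCast_eq_sum (s : Multiset ℂ) (h : ∀ x ∈ s, ∃ n : ℕ, x = n) :
    ∃ n : ℕ, s.sum = n := by
  induction s using Multiset.induction_on with
  | empty => exact ⟨0, by simp⟩
  | cons x s ih =>
    obtain ⟨n, hn⟩ := h x (Multiset.mem_cons_self x s)
    obtain ⟨k, hk⟩ := ih fun y hy => h y (Multiset.mem_cons_of_mem hy)
    exact ⟨n + k, by rw [Multiset.sum_cons, hn, hk]; push_cast; ring⟩

/-- Two natural roots with sum 0 would both be 0, and X² would divide f. -/
theorem HasNatExponents.sum_roots {f : ℂ[X]} (hf : HasNatExponents f) :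
    ∃ n : ℕ, f.roots.sum = n ∧ (f.natDegree = 2 → 1 ≤ n) := by
  obtain ⟨n, hn⟩ := exists_natCast_eq_sum f.roots fun x hx => hf.1 x (isRoot_of_mem_roots hx)
  refine ⟨n, hn, fun h2 => ?_⟩
  by_contra hlt
  have hn0 : n = 0 := by omega
  have hcard := (IsAlgClosed.splits f).natDegree_eq_card_roots
  rw [h2] at hcard
  obtain ⟨x, y, hxy⟩ := Multiset.card_eq_two.mp hcard.symm
  obtain ⟨k, hk⟩ := hf.1 x (isRoot_of_mem_roots (by rw [hxy]; simp))
  obtain ⟨l, hl⟩ := hf.1 y (isRoot_of_mem_roots (by rw [hxy]; simp))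
  rw [hxy, hk, hl, hn0] at hn
  have hn' : (k : ℂ) + l = ((0 : ℕ) : ℂ) := by simpa using hn
  have hkl : k + l = 0 := by exact_mod_cast hn'
  have hk0 : k = 0 := by omega
  have hl0 : l = 0 := by omega
  refine hf.2 ?_
  have hd := prod_multiset_X_sub_C_dvd f
  rw [hxy, hk, hl, hk0, hl0] at hd
  simpa [pow_two] using hd

theorem sum_roots_of_dvd_pow {f : ℂ[X]} (c x : ℂ) (hc : c ≠ 0) (n : ℕ)
    (h : f ∣ C c * (X - C x) ^ n) : f.roots.sum = f.natDegree * x := by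
  have h0 : C c * (X - C x) ^ n ≠ 0 := mul_ne_zero (by simpa using hc) (pow_ne_zero _ (X_sub_C_ne_zero x))
  have h1 : f.roots = Multiset.replicate f.natDegree x := by
    rw [(IsAlgClosed.splits f).natDegree_eq_card_roots, Multiset.eq_replicate_card]
    intro y hy
    have hr := (isRoot_of_mem_roots hy).dvd h
    simp only [IsRoot, eval_mul, eval_C, eval_pow, eval_sub, eval_X] at hr
    have := (mul_eq_zero.mp hr).resolve_left hc
    exact sub_eq_zero.mp (eq_zero_of_pow_eq_zero this)
  rw [h1, Multiset.sum_replicate, nsmul_eq_mul]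

/-- An operator that is regular everywhere, with all exponents `0` at `0`, with all exponents
`1 / 2` at infinity, and elsewhere with natural exponents, of which at most one is `0`, does not
have order `1`, `2` or `3`. -/
theorem order_of_exponents {M : ℂ[X][X]} {q : ℕ} (hq : M.natDegree = q + 1) (hq3 : q < 3)
    (hX : (M.coeff (q + 1)).IsRoot 0) (F : ℂ → ℂ[X]) (hF : ∀ p, IsIndicial 1 p M (F p))
    (h0 : (F 0).roots.sum = 0) (hp : ∀ p ≠ 0, HasNatExponents (F p)) {G : ℂ[X]}
    (hG : IsIndicial (-1) 0 M G) (hinf : G.roots.sum = -(q + 1) / 2) : False := by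
  have hf := fuchs_relation hq F hF hG
  have ha0 : M.coeff (q + 1) ≠ 0 := by
    intro h0
    have : M.leadingCoeff = 0 := by rw [leadingCoeff, hq]; exact h0
    rw [leadingCoeff_eq_zero.mp this] at hq
    simp at hq
  have hmem : (0 : ℂ) ∈ (M.coeff (q + 1)).roots.toFinset := by
    rw [Multiset.mem_toFinset, mem_roots ha0]; exact hX
  rw [← Finset.add_sum_erase _ _ hmem, h0, hinf] at hf
  have hnat : ∀ p, ∃ n : ℕ, p ≠ 0 → (F p).roots.sum = n ∧ (q = 1 → 1 ≤ n) := by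
    intro p
    by_cases hp0 : p = 0
    · exact ⟨0, fun h => absurd hp0 h⟩
    · obtain ⟨n, h1, h2⟩ := (hp p hp0).sum_roots
      refine ⟨n, fun _ => ⟨h1, fun hq1 => h2 ?_⟩⟩
      obtain ⟨v, -, -, hd⟩ := hF p
      rw [hd, hq, hq1]
  choose n hn using hnat
  set T := (M.coeff (q + 1)).roots.toFinset.erase 0 with hT
  have hsum : ∑ p ∈ T, (((q : ℂ) + 1) * q / 2 - (F p).roots.sum)
      = ∑ p ∈ T, (((q : ℂ) + 1) * q / 2 - (n p : ℂ)) :=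
    Finset.sum_congr rfl fun p hp => by rw [(hn p (Finset.mem_erase.mp hp).1).1]
  rw [hsum] at hf
  -- With r = q + 1 the relation reads: the sum over `T` of r(r-1)/2 - n p equals r/2. For r = 1 and
  -- r = 3 the right side is not an integer. For r = 2 it is 1, while every term 1 - n p is at most
  -- 0.
  interval_cases q
  · have h1 : (2 * ∑ p ∈ T, (n p : ℂ)) = -1 := by
      simp only [Finset.sum_sub_distrib] at hf
      norm_num at hf
      linear_combination -2 * hf
    have h2 : ((2 * ∑ p ∈ T, n p : ℕ) : ℤ) = -1 := by
      have : (((2 * ∑ p ∈ T, n p : ℕ) : ℤ) : ℂ) = ((-1 : ℤ) : ℂ) := by push_cast; exact h1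
      exact_mod_cast this
    omega
  · have h1 : ∑ p ∈ T, ((1 : ℤ) - n p) = 1 := by
      have : ((∑ p ∈ T, ((1 : ℤ) - n p) : ℤ) : ℂ) = ((1 : ℤ) : ℂ) := by
        push_cast
        push_cast at hf
        norm_num at hf ⊢
        linear_combination hf
      exact_mod_cast this
    have h2 : ∑ p ∈ T, ((1 : ℤ) - n p) ≤ 0 := by
      refine Finset.sum_nonpos fun p hp => ?_
      have := (hn p (Finset.mem_erase.mp hp).1).2 rfl
      omega
    omega
  · have h1 : 2 * ∑ p ∈ T, ((3 : ℤ) - n p) = 3 := by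
      have : ((2 * ∑ p ∈ T, ((3 : ℤ) - n p) : ℤ) : ℂ) = ((3 : ℤ) : ℂ) := by
        push_cast
        push_cast at hf
        norm_num at hf ⊢
        linear_combination 2 * hf
      exact_mod_cast this
    omega

end Fuchs

/-! ### The exponents of the operator -/

section Exponents

open Polynomial

/-- A polynomial of degree at most four with the given coefficients. -/
noncomputable def quartic (a b c d e : ℂ) : ℂ[X] :=
  C a + C b * X + C c * X ^ 2 + C d * X ^ 3 + C e * X ^ 4

theorem coeff_quartic (a b c d e : ℂ) :
    (quartic a b c d e).coeff 0 = a ∧ (quartic a b c d e).coeff 4 = e ∧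
      ∀ k, 4 < k → (quartic a b c d e).coeff k = 0 := by
  refine ⟨?_, ?_, fun k hk => coeff_eq_zero_of_natDegree_lt (lt_of_le_of_lt ?_ hk)⟩
  · simp [quartic]
  · simp [quartic]
  · unfold quartic; compute_degree

theorem eval_quartic (a b c d e x : ℂ) :
    (quartic a b c d e).eval x = a + b * x + c * x ^ 2 + d * x ^ 3 + e * x ^ 4 := by
  simp [quartic]

theorem opD_eq : opD = monomial 0 (quartic 0 (-3380) (-33904) 6656 (-4096))
    + monomial 1 (quartic 0 (-28054) (-185536) 79872 (-32768))
    + monomial 2 (quartic 0 (-86827) (-286368) 279296 (-98304))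
    + monomial 3 (quartic 0 (-117546) (-28384) 319488 (-131072))
    + monomial 4 (quartic 169 (-59397) 102176 17152 (-65536)) := by
  simp only [opD, quartic, ← C_mul_X_pow_eq_monomial, map_add, map_mul, map_neg, map_pow,
    map_ofNat, map_zero]
  ring

theorem leftEuler_add (A B : ℂ[X][X]) : leftEuler (A + B) = leftEuler A + leftEuler B := by
  unfold leftEuler; rw [leftD_add, mul_add]

theorem leftEuler_monomial (i k : ℕ) (c : ℂ[X]) (hc : derivative c = 0) :
    leftEuler (monomial i (c * X ^ k)) = monomial i (c * (k : ℂ[X]) * X ^ k) + monomial (i + 1) (c * X ^ (k + 1)) := by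
  unfold leftEuler
  rw [leftD_monomial, mul_add, C_mul_monomial, C_mul_monomial, derivative_mul, hc,
    derivative_X_pow]
  congr 2
  · rcases k with _ | k
    · simp
    · simp; ring
  · ring

/-- The coefficients are the Stirling numbers of the second kind. -/
theorem leftEuler_iterate :
    leftEuler^[1] 1 = monomial 1 X ∧
    leftEuler^[2] 1 = monomial 1 X + monomial 2 (X ^ 2) ∧
    leftEuler^[3] 1 = monomial 1 X + monomial 2 (3 * X ^ 2) + monomial 3 (X ^ 3) ∧
    leftEuler^[4] 1 = monomial 1 X + monomial 2 (7 * X ^ 2) + monomial 3 (6 * X ^ 3)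
      + monomial 4 (X ^ 4) := by
  have e0 : leftEuler (1 : ℂ[X][X]) = monomial 1 X := by
    have := leftEuler_monomial 0 0 1 (by simp)
    simpa using this
  have e1 : leftEuler (monomial 1 X) = monomial 1 X + monomial 2 (X ^ 2) := by
    have := leftEuler_monomial 1 1 1 (by simp)
    simpa using this
  have e2 : ∀ c : ℂ[X], derivative c = 0 → leftEuler (monomial 2 (c * X ^ 2))
      = monomial 2 (c * 2 * X ^ 2) + monomial 3 (c * X ^ 3) := by
    intro c hc
    simpa using leftEuler_monomial 2 2 c hc
  have e3 : ∀ c : ℂ[X], derivative c = 0 → leftEuler (monomial 3 (c * X ^ 3))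
      = monomial 3 (c * 3 * X ^ 3) + monomial 4 (c * X ^ 4) := by
    intro c hc
    simpa using leftEuler_monomial 3 3 c hc
  have e2' := e2 1 (by simp)
  have e3' := e3 1 (by simp)
  rw [one_mul, one_mul, one_mul] at e2' e3'
  have f1 : leftEuler^[1] 1 = monomial 1 X := e0
  have f2 : leftEuler^[2] 1 = monomial 1 X + monomial 2 (X ^ 2) := by
    rw [Function.iterate_succ_apply', f1, e1]
  have f3 : leftEuler^[3] 1 = monomial 1 X + monomial 2 (3 * X ^ 2) + monomial 3 (X ^ 3) := by
    rw [Function.iterate_succ_apply', f2, leftEuler_add, e1, e2', ← add_assoc,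
      add_assoc (monomial 1 X), ← map_add]
    congr 3; ring
  refine ⟨f1, f2, f3, ?_⟩
  rw [Function.iterate_succ_apply', f3, leftEuler_add, leftEuler_add, e1, e2 3 (by simp), e3']
  rw [show (7 : ℂ[X]) * X ^ 2 = X ^ 2 + 3 * 2 * X ^ 2 by ring,
    show (6 : ℂ[X]) * X ^ 3 = 3 * X ^ 3 + 3 * X ^ 3 by ring, map_add, map_add]
  abel

/-- The coefficients of `opD` as an operator in `d / dX`. -/
theorem ofEuler_opD : ofEuler opD = monomial 0 (X ^ 0 * quartic 0 (-3380) (-33904) 6656 (-4096))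
    + monomial 1 (X ^ 1 * quartic 169 (-291824) (-398112) 695808 (-327680))
    + monomial 2 (X ^ 2 * quartic 1183 (-855244) 343712 1357824 (-950272))
    + monomial 3 (X ^ 3 * quartic 1014 (-473928) 584672 422400 (-524288))
    + monomial 4 (X ^ 4 * quartic 169 (-59397) 102176 17152 (-65536)) := by
  obtain ⟨h1, h2, h3, h4⟩ := leftEuler_iterate
  rw [opD_eq, ofEuler_add, ofEuler_add, ofEuler_add, ofEuler_add, ofEuler_monomial,
    ofEuler_monomial, ofEuler_monomial, ofEuler_monomial, ofEuler_monomial, h1, h2, h3, h4]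
  simp only [quartic, ← C_mul_X_pow_eq_monomial, map_add, map_mul, map_pow, map_neg,
    map_ofNat, map_zero, Function.iterate_zero, id]
  ring

theorem quartic_ne_zero (a b c d e : ℂ) (ha : a ≠ 0) : quartic a b c d e ≠ 0 := by
  intro h
  have := (coeff_quartic a b c d e).1
  rw [h, coeff_zero] at this
  exact ha this.symm

theorem natDegree_sum_monomial (a b c d e : ℂ[X]) (he : e ≠ 0) :
    (monomial 0 a + monomial 1 b + monomial 2 c + monomial 3 d + monomial 4 e).natDegree = 4 := by
  simp only [← C_mul_X_pow_eq_monomial]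
  compute_degree!

theorem natDegree_opD : opD.natDegree = 4 := by
  rw [opD_eq]
  exact natDegree_sum_monomial _ _ _ _ _ (quartic_ne_zero _ _ _ _ _ (by norm_num))

theorem natDegree_ofEuler_opD : (ofEuler opD).natDegree = 4 := by
  rw [ofEuler_opD]
  exact natDegree_sum_monomial _ _ _ _ _
    (mul_ne_zero (pow_ne_zero _ X_ne_zero) (quartic_ne_zero _ _ _ _ _ (by norm_num)))

theorem descPochhammer_values : descPochhammer ℂ 1 = X ∧ descPochhammer ℂ 2 = X * (X - 1) ∧
    descPochhammer ℂ 3 = X * (X - 1) * (X - 2) ∧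
    descPochhammer ℂ 4 = X * (X - 1) * (X - 2) * (X - 3) := by
  refine ⟨descPochhammer_one ℂ, ?_, ?_, ?_⟩ <;>
  simp [descPochhammer_succ_right]

/-- At p = 0 the factor X^i in the coefficient of (d/dX)^i offsets the shift by i in `symb`. The
symbol of degree j then reads off the j-th coefficient of each quartic. -/
theorem zcoeff_X_pow_mul (i : ℕ) (a : ℂ[X]) (j : ℤ) :
    zcoeff (taylor 0 (X ^ i * a)) (i + j) = zcoeff a j := by
  rw [taylor_zero]
  rcases le_or_gt 0 j with h | h
  · obtain ⟨n, rfl⟩ := Int.eq_ofNat_of_zero_le h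
    rw [← Nat.cast_add, zcoeff_natCast, zcoeff_natCast, add_comm, coeff_X_pow_mul]
  · rw [zcoeff, zcoeff, if_neg (not_le.mpr h)]
    split_ifs with h2
    · rw [coeff_X_pow_mul', if_neg (by omega)]
    · rfl

theorem symb_opD (p : ℂ) (j : ℤ) : symb p (ofEuler opD) j = C (zcoeff (taylor p (X ^ 0 * quartic 0 (-3380) (-33904) 6656 (-4096))) ((0 : ℕ) + j)) * descPochhammer ℂ 0
    + C (zcoeff (taylor p (X ^ 1 * quartic 169 (-291824) (-398112) 695808 (-327680))) ((1 : ℕ) + j)) * descPochhammer ℂ 1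
    + C (zcoeff (taylor p (X ^ 2 * quartic 1183 (-855244) 343712 1357824 (-950272))) ((2 : ℕ) + j)) * descPochhammer ℂ 2
    + C (zcoeff (taylor p (X ^ 3 * quartic 1014 (-473928) 584672 422400 (-524288))) ((3 : ℕ) + j)) * descPochhammer ℂ 3
    + C (zcoeff (taylor p (X ^ 4 * quartic 169 (-59397) 102176 17152 (-65536))) ((4 : ℕ) + j)) * descPochhammer ℂ 4 := by
  rw [ofEuler_opD, symb_add, symb_add, symb_add, symb_add, symb_monomial, symb_monomial,
    symb_monomial, symb_monomial, symb_monomial]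

theorem symb_opD_zero (j : ℤ) : symb 0 (ofEuler opD) j = C (zcoeff (quartic 0 (-3380) (-33904) 6656 (-4096)) j) * descPochhammer ℂ 0
    + C (zcoeff (quartic 169 (-291824) (-398112) 695808 (-327680)) j) * descPochhammer ℂ 1
    + C (zcoeff (quartic 1183 (-855244) 343712 1357824 (-950272)) j) * descPochhammer ℂ 2
    + C (zcoeff (quartic 1014 (-473928) 584672 422400 (-524288)) j) * descPochhammer ℂ 3
    + C (zcoeff (quartic 169 (-59397) 102176 17152 (-65536)) j) * descPochhammer ℂ 4 := by
  rw [symb_opD]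
  simp only [zcoeff_X_pow_mul]

theorem zcoeff_quartic (a b c d e : ℂ) :
    zcoeff (quartic a b c d e) 0 = a ∧ zcoeff (quartic a b c d e) 4 = e ∧
      (∀ j, 4 < j → zcoeff (quartic a b c d e) j = 0) ∧
      ∀ j, j < 0 → zcoeff (quartic a b c d e) j = 0 := by
  obtain ⟨h0, h4, h5⟩ := coeff_quartic a b c d e
  refine ⟨?_, ?_, fun j hj => ?_, fun j hj => ?_⟩
  · rw [show (0 : ℤ) = ((0 : ℕ) : ℤ) from rfl, zcoeff_natCast, h0]
  · rw [show (4 : ℤ) = ((4 : ℕ) : ℤ) from rfl, zcoeff_natCast, h4]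
  · rw [zcoeff, if_pos (by omega), h5 _ (by omega)]
  · rw [zcoeff, if_neg (by omega)]

/-- Modulo φ the operator 𝒟 is 13² Θ^4. -/
theorem isIndicial_opD_zero : IsIndicial 1 0 (ofEuler opD) (C 169 * (X - C 0) ^ 4) := by
  obtain ⟨d1, d2, d3, d4⟩ := descPochhammer_values
  have hs : symb 0 (ofEuler opD) 0 = C 169 * (X - C 0) ^ 4 := by
    rw [symb_opD_zero]
    simp only [(zcoeff_quartic _ _ _ _ _).1, d1, d2, d3, d4, descPochhammer_zero]
    simp only [map_ofNat, map_zero]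
    ring
  refine ⟨0, ⟨?_, fun j hj => ?_⟩, hs, ?_⟩
  · rw [hs]
    exact mul_ne_zero (by simp) (pow_ne_zero _ (X_sub_C_ne_zero _))
  · rw [symb_opD_zero]
    have hj' : j < 0 := by omega
    simp only [(zcoeff_quartic _ _ _ _ _).2.2.2 j hj', C_0, zero_mul, add_zero]
  · rw [natDegree_ofEuler_opD, natDegree_C_mul (by norm_num), natDegree_pow, natDegree_X_sub_C]

/-- The φ^4 part of 𝒟 is -2^12 (2Θ + 1)^4. Symbols are polynomials in the exponent s of φ^s, so the
root -1/2 is the exponent 1/2 in the coordinate 1/φ. -/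
theorem isIndicial_opD_infinity :
    IsIndicial (-1) 0 (ofEuler opD) (C (-65536) * (X - C (-1 / 2)) ^ 4) := by
  obtain ⟨d1, d2, d3, d4⟩ := descPochhammer_values
  have hs : symb 0 (ofEuler opD) 4 = C (-65536) * (X - C (-1 / 2)) ^ 4 := by
    rw [symb_opD_zero]
    simp only [(zcoeff_quartic _ _ _ _ _).2.1, d1, d2, d3, d4, descPochhammer_zero]
    have hC : (2 : ℂ[X]) * C (-1 / 2) = -1 := by
      rw [← map_ofNat C 2, ← map_mul]; norm_num
    have e4 : C (-65536 : ℂ) * (X - C (-1 / 2)) ^ 4 = -4096 * (2 * X + 1) ^ 4 := by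
      have : (2 : ℂ[X]) * X + 1 = 2 * (X - C (-1 / 2)) := by linear_combination hC
      rw [this]
      simp only [map_neg, map_ofNat]
      ring
    rw [e4]
    simp only [map_ofNat, map_neg]
    ring
  refine ⟨4, ⟨?_, fun j hj => ?_⟩, hs, ?_⟩
  · rw [hs]
    exact mul_ne_zero (by simp) (pow_ne_zero _ (X_sub_C_ne_zero _))
  · rw [symb_opD_zero]
    have hj' : 4 < j := by omega
    simp only [(zcoeff_quartic _ _ _ _ _).2.2.1 j hj', C_0, zero_mul, add_zero]
  · rw [natDegree_ofEuler_opD, natDegree_C_mul (by norm_num), natDegree_pow, natDegree_X_sub_C]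

theorem hasNatExponents_of_roots (c : ℂ) (hc : c ≠ 0) (k l m : ℕ) (hk : k ≠ 0) (hl : l ≠ 0)
    (hm : m ≠ 0) : HasNatExponents (C c * (X * (X - C (k : ℂ)) * (X - C (l : ℂ)) * (X - C (m : ℂ)))) := by
  constructor
  · intro x hx
    simp only [IsRoot, eval_mul, eval_C, eval_sub, eval_X, mul_eq_zero, hc, false_or,
      sub_eq_zero] at hx
    rcases hx with ((rfl | rfl) | rfl) | rfl
    · exact ⟨0, by simp⟩
    · exact ⟨k, rfl⟩
    · exact ⟨l, rfl⟩
    · exact ⟨m, rfl⟩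
  · intro h
    rw [show C c * (X * (X - C (k : ℂ)) * (X - C (l : ℂ)) * (X - C (m : ℂ)))
      = X * (C c * ((X - C (k : ℂ)) * (X - C (l : ℂ)) * (X - C (m : ℂ)))) by ring, pow_two,
      mul_dvd_mul_iff_left X_ne_zero, X_dvd_iff] at h
    simp [coeff_zero_eq_eval_zero, hc, hk, hl, hm] at h

theorem natDegree_of_roots (c : ℂ) (hc : c ≠ 0) (k l m : ℕ) :
    (C c * (X * (X - C (k : ℂ)) * (X - C (l : ℂ)) * (X - C (m : ℂ)))).natDegree = 4 := by
  rw [natDegree_C_mul hc, natDegree_mul (mul_ne_zero (mul_ne_zero X_ne_zero (X_sub_C_ne_zero _))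
    (X_sub_C_ne_zero _)) (X_sub_C_ne_zero _), natDegree_mul (mul_ne_zero X_ne_zero
    (X_sub_C_ne_zero _)) (X_sub_C_ne_zero _), natDegree_mul X_ne_zero (X_sub_C_ne_zero _)]
  simp only [natDegree_X, natDegree_X_sub_C]

/-- An indicial polynomial of order four with natural exponents. -/
theorem isIndicial_of_symb {p : ℂ} {v : ℤ} (c : ℂ) (hc : c ≠ 0) (k l m : ℕ) (hk : k ≠ 0)
    (hl : l ≠ 0) (hm : m ≠ 0) (hlow : ∀ j < v, symb p (ofEuler opD) j = 0)
    (hs : symb p (ofEuler opD) v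
      = C c * (X * (X - C (k : ℂ)) * (X - C (l : ℂ)) * (X - C (m : ℂ)))) :
    ∃ f, IsIndicial 1 p (ofEuler opD) f ∧ HasNatExponents f := by
  refine ⟨_, ⟨v, ⟨?_, fun j hj => hlow j (by omega)⟩, hs, ?_⟩,
    hasNatExponents_of_roots c hc k l m hk hl hm⟩
  · rw [hs]
    intro h0
    have := natDegree_of_roots c hc k l m
    rw [h0] at this
    simp at this
  · rw [natDegree_ofEuler_opD, natDegree_of_roots c hc]

end Exponents

/-! ### The exponents at the nonzero finite points. -/

section FinitePoints

open Polynomial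

theorem taylor_coeff_two (p : ℂ) (f : ℂ[X]) :
    (taylor p f).coeff 2 = (derivative (derivative f)).eval p / 2 := by
  have h : (derivative (taylor p f)).coeff 1 = (derivative (derivative f)).eval p := by
    rw [derivative_taylor, taylor_coeff_one]
  rw [coeff_derivative] at h
  rw [← h]
  push_cast
  ring

theorem zcoeff_neg (a : ℂ[X]) {k : ℤ} (hk : k < 0) : zcoeff a k = 0 := by
  rw [zcoeff, if_neg (by omega)]

theorem zcoeff_taylor (p : ℂ) (a : ℂ[X]) : zcoeff (taylor p a) 0 = a.eval p ∧
    zcoeff (taylor p a) 1 = (derivative a).eval p ∧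
    zcoeff (taylor p a) 2 = (derivative (derivative a)).eval p / 2 := by
  refine ⟨?_, ?_, ?_⟩
  · rw [show (0 : ℤ) = ((0 : ℕ) : ℤ) from rfl, zcoeff_natCast, taylor_coeff_zero]
  · rw [show (1 : ℤ) = ((1 : ℕ) : ℤ) from rfl, zcoeff_natCast, taylor_coeff_one]
  · rw [show (2 : ℤ) = ((2 : ℕ) : ℤ) from rfl, zcoeff_natCast, taylor_coeff_two]

theorem eval_X_pow_mul_quartic (a b c d e p : ℂ) (k : ℕ) :
    (X ^ k * quartic a b c d e).eval p
      = p ^ k * (a + b * p + c * p ^ 2 + d * p ^ 3 + e * p ^ 4) := by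
  simp [eval_quartic]

theorem derivative_X_pow_mul_quartic (a b c d e : ℂ) (k : ℕ) :
    derivative (X ^ (k + 1) * quartic a b c d e)
      = X ^ k * quartic ((k + 1) * a) ((k + 2) * b) ((k + 3) * c) ((k + 4) * d) ((k + 5) * e) := by
  simp only [quartic, derivative_mul, derivative_X_pow, derivative_C, derivative_X,
    map_add, map_mul, map_natCast, map_ofNat, map_one, Nat.cast_add, Nat.cast_one, Nat.cast_ofNat]
  simp only [Nat.add_sub_cancel, show 2 - 1 = 1 from rfl, show 3 - 1 = 2 from rfl,
    show 4 - 1 = 3 from rfl]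
  ring

/-- Degrees up to -2 suffice, because away from 0 the leading coefficient vanishes at most to second
order. -/
theorem symb_opD_low (p : ℂ) :
    (∀ j, j < -4 → symb p (ofEuler opD) j = 0) ∧
    symb p (ofEuler opD) (-4) = C ((X ^ 4 * quartic 169 (-59397) 102176 17152 (-65536)).eval p) * descPochhammer ℂ 4 ∧
    symb p (ofEuler opD) (-3) = C ((X ^ 3 * quartic 1014 (-473928) 584672 422400 (-524288)).eval p) * descPochhammer ℂ 3
      + C ((derivative (X ^ 4 * quartic 169 (-59397) 102176 17152 (-65536))).eval p) * descPochhammer ℂ 4 ∧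
    symb p (ofEuler opD) (-2) = C ((X ^ 2 * quartic 1183 (-855244) 343712 1357824 (-950272)).eval p) * descPochhammer ℂ 2
      + C ((derivative (X ^ 3 * quartic 1014 (-473928) 584672 422400 (-524288))).eval p) * descPochhammer ℂ 3
      + C ((derivative (derivative (X ^ 4 * quartic 169 (-59397) 102176 17152 (-65536)))).eval p / 2)
        * descPochhammer ℂ 4 := by
  refine ⟨fun j hj => ?_, ?_, ?_, ?_⟩ <;> rw [symb_opD]
  · rw [zcoeff_neg _ (by push_cast; omega), zcoeff_neg _ (by push_cast; omega),
      zcoeff_neg _ (by push_cast; omega), zcoeff_neg _ (by push_cast; omega),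
      zcoeff_neg _ (by push_cast; omega)]
    simp only [C_0, zero_mul, add_zero]
  · rw [zcoeff_neg _ (by norm_num), zcoeff_neg _ (by norm_num), zcoeff_neg _ (by norm_num),
      zcoeff_neg _ (by norm_num), show ((4 : ℕ) : ℤ) + -4 = 0 by norm_num, (zcoeff_taylor p _).1]
    simp only [C_0, zero_mul, zero_add]
  · rw [zcoeff_neg _ (by norm_num), zcoeff_neg _ (by norm_num), zcoeff_neg _ (by norm_num),
      show ((3 : ℕ) : ℤ) + -3 = 0 by norm_num, show ((4 : ℕ) : ℤ) + -3 = 1 by norm_num,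
      (zcoeff_taylor p _).1, (zcoeff_taylor p _).2.1]
    simp only [C_0, zero_mul, zero_add]
  · rw [zcoeff_neg _ (by norm_num), zcoeff_neg _ (by norm_num),
      show ((2 : ℕ) : ℤ) + -2 = 0 by norm_num, show ((3 : ℕ) : ℤ) + -2 = 1 by norm_num,
      show ((4 : ℕ) : ℤ) + -2 = 2 by norm_num, (zcoeff_taylor p _).1, (zcoeff_taylor p _).2.1,
      (zcoeff_taylor p _).2.2]
    simp only [C_0, zero_mul, zero_add]

/-- The exponents 0, 1, 1, 2 occur at the two roots of 1 - 349φ - 256φ². -/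
theorem indicial_simple_point (c x y : ℂ) (hx : x = 2 * c) (hy : y = c) :
    C x * (X * (X - 1) * (X - 2)) + C y * (X * (X - 1) * (X - 2) * (X - 3))
      = C c * (X * (X - C ((1 : ℕ) : ℂ)) * (X - C ((1 : ℕ) : ℂ)) * (X - C ((2 : ℕ) : ℂ))) := by
  subst hx hy
  simp only [Nat.cast_one, Nat.cast_ofNat, map_one, map_ofNat, map_mul]
  ring

/-- The exponents 0, 1, 3, 4 occur at the double root φ = 13/16 of the leading coefficient. -/
theorem indicial_double_point (c x y z : ℂ) (hx : x = 2 * c) (hy : y = -2 * c) (hz : z = c) :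
    C x * (X * (X - 1)) + C y * (X * (X - 1) * (X - 2)) + C z * (X * (X - 1) * (X - 2) * (X - 3))
      = C c * (X * (X - C ((1 : ℕ) : ℂ)) * (X - C ((3 : ℕ) : ℂ)) * (X - C ((4 : ℕ) : ℂ))) := by
  subst hx hy hz
  simp only [Nat.cast_one, Nat.cast_ofNat, map_one, map_ofNat, map_mul, map_neg]
  ring

/-- The leading coefficient is φ^4 (13 - 16φ)² (1 - 349φ - 256φ²). A nonzero point is its double
root, one of its two simple roots, or an ordinary point with exponents 0, 1, 2, 3. -/
theorem isIndicial_opD_finite (p : ℂ) (hp : p ≠ 0) :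
    ∃ f, IsIndicial 1 p (ofEuler opD) f ∧ HasNatExponents f := by
  obtain ⟨h5, h4, h3, h2⟩ := symb_opD_low p
  obtain ⟨d1, d2, d3, d4⟩ := descPochhammer_values
  rw [eval_X_pow_mul_quartic, d4] at h4
  rw [eval_X_pow_mul_quartic, derivative_X_pow_mul_quartic, eval_X_pow_mul_quartic, d3, d4] at h3
  rw [eval_X_pow_mul_quartic, derivative_X_pow_mul_quartic,
    derivative_X_pow_mul_quartic _ _ _ _ _ 3, derivative_X_pow_mul_quartic _ _ _ _ _ 2,
    eval_X_pow_mul_quartic, eval_X_pow_mul_quartic, d2, d3, d4] at h2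
  have hfac : (169 : ℂ) + -59397 * p + 102176 * p ^ 2 + 17152 * p ^ 3 + -65536 * p ^ 4
      = (13 - 16 * p) ^ 2 * (1 - 349 * p - 256 * p ^ 2) := by ring
  rw [hfac] at h4
  by_cases hA : (13 : ℂ) - 16 * p = 0
  · have hpv : p = 13 / 16 := by linear_combination (-1 / 16) * hA
    subst hpv
    refine isIndicial_of_symb (v := -2) ((13 / 16) ^ 4 * 256 * (1 - 349 * (13 / 16) - 256 * (13 / 16) ^ 2))
      (by norm_num) 1 3 4 one_ne_zero three_ne_zero four_ne_zero (fun j hj => ?_) ?_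
    · rcases (by omega : j < -4 ∨ j = -4 ∨ j = -3) with h | rfl | rfl
      · exact h5 j h
      · rw [h4]; norm_num
      · rw [h3]; norm_num
    · rw [h2]
      exact indicial_double_point _ _ _ _ (by norm_num) (by norm_num) (by norm_num)
  · by_cases hB : (1 : ℂ) - 349 * p - 256 * p ^ 2 = 0
    -- The roots of the quadratic are simple: its discriminant is 349² + 4 · 256 = 122825.
    · have hder : (-349 - 512 * p : ℂ) ≠ 0 := by
        intro h0
        have : (122825 : ℂ) = 0 := by
          linear_combination 1024 * hB - (512 * p + 349) * h0
        norm_num at this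
      refine isIndicial_of_symb (v := -3) (p ^ 4 * (13 - 16 * p) ^ 2 * (-349 - 512 * p))
        (mul_ne_zero (mul_ne_zero (pow_ne_zero _ hp) (pow_ne_zero _ hA)) hder) 1 1 2 one_ne_zero
        one_ne_zero two_ne_zero (fun j hj => ?_) ?_
      · rcases (by omega : j < -4 ∨ j = -4) with h | rfl
        · exact h5 j h
        · rw [h4, hB]; simp
      · rw [h3]
        refine indicial_simple_point _ _ _ ?_ ?_
        · linear_combination (p ^ 3 * (1014 * p ^ 0 + (-2080) * p ^ 1 + 1024 * p ^ 2)) * hB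
        · push_cast
          linear_combination (p ^ 3 * (676 * p ^ 0 + (-2080) * p ^ 1 + 1536 * p ^ 2)) * hB
    · refine isIndicial_of_symb (v := -4) (p ^ 4 * ((13 - 16 * p) ^ 2 * (1 - 349 * p - 256 * p ^ 2)))
        (mul_ne_zero (pow_ne_zero _ hp) (mul_ne_zero (pow_ne_zero _ hA) hB)) 1 2 3 one_ne_zero
        two_ne_zero three_ne_zero h5 ?_
      rw [h4]
      simp only [Nat.cast_one, Nat.cast_ofNat, map_one, map_ofNat]

end FinitePoints

/-! ### The Picard–Fuchs operator of the series -/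

section PicardFuchs

open Polynomial

/-- The generating series of the period coefficients. -/
noncomputable def periodSeries : PowerSeries ℂ := PowerSeries.mk fun n => (periodCoeff n : ℂ)

theorem euler_pow_periodSeries (i : ℕ) :
    ((mulSeries X * derivSeries) ^ i) periodSeries
      = PowerSeries.mk fun n => (n : ℂ) ^ i * periodCoeff n := by
  induction i with
  | zero => ext n; simp [periodSeries]
  | succ i ih =>
    rw [pow_succ' (_ * _), Module.End.mul_apply (_ * _), ih, Module.End.mul_apply, mulSeries_apply,
      derivSeries_apply]
    ext n
    rw [Polynomial.coe_X]
    rcases n with _ | n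
    · simp
    · rw [PowerSeries.coeff_succ_X_mul, PowerSeries.coeff_derivative, PowerSeries.coeff_mk,
        PowerSeries.coeff_mk]
      push_cast
      ring

theorem coeff_quartic_mul (a b c d e : ℂ) (g : PowerSeries ℂ) :
    (∀ n, PowerSeries.coeff (n + 4) ((quartic a b c d e : PowerSeries ℂ) * g)
      = a * g.coeff (n + 4) + b * g.coeff (n + 3) + c * g.coeff (n + 2) + d * g.coeff (n + 1)
        + e * g.coeff n) ∧
    PowerSeries.coeff 0 ((quartic a b c d e : PowerSeries ℂ) * g) = a * g.coeff 0 ∧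
    PowerSeries.coeff 1 ((quartic a b c d e : PowerSeries ℂ) * g) = a * g.coeff 1 + b * g.coeff 0 ∧
    PowerSeries.coeff 2 ((quartic a b c d e : PowerSeries ℂ) * g)
      = a * g.coeff 2 + b * g.coeff 1 + c * g.coeff 0 ∧
    PowerSeries.coeff 3 ((quartic a b c d e : PowerSeries ℂ) * g)
      = a * g.coeff 3 + b * g.coeff 2 + c * g.coeff 1 + d * g.coeff 0 := by
  have h : (quartic a b c d e : PowerSeries ℂ) * g
      = PowerSeries.C a * g + PowerSeries.C b * (PowerSeries.X ^ 1 * g)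
        + PowerSeries.C c * (PowerSeries.X ^ 2 * g) + PowerSeries.C d * (PowerSeries.X ^ 3 * g)
        + PowerSeries.C e * (PowerSeries.X ^ 4 * g) := by
    simp only [quartic, Polynomial.coe_add, Polynomial.coe_mul, Polynomial.coe_C,
      Polynomial.coe_pow, Polynomial.coe_X]
    ring
  rw [h]
  refine ⟨fun n => ?_, ?_, ?_, ?_, ?_⟩ <;>
  simp [PowerSeries.coeff_X_pow_mul']

/-- From degree 4 on, the coefficients vanish by `periodCoeff_rec_four`. The first four involve
fewer terms and are checked by value. -/
theorem opD_periodSeries :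
    (opD.eval₂ mulSeries (mulSeries X * derivSeries)) periodSeries = 0 := by
  rw [opD_eq]
  simp only [eval₂_add, eval₂_monomial, LinearMap.add_apply, Module.End.mul_apply (mulSeries (quartic _ _ _ _ _)),
    euler_pow_periodSeries, mulSeries_apply (quartic _ _ _ _ _)]
  ext n
  simp only [map_add, map_zero]
  rcases Nat.lt_or_ge n 4 with hn | hn
  · have c0 : periodCoeff 0 = 1 := by decide
    have c1 : periodCoeff 1 = 20 := by decide
    have c2 : periodCoeff 2 = 2196 := by decide
    have c3 : periodCoeff 3 = 369200 := by decide
    interval_cases n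
    · simp only [(coeff_quartic_mul _ _ _ _ _ _).2.1, PowerSeries.coeff_mk, c0]
      norm_num
    · simp only [(coeff_quartic_mul _ _ _ _ _ _).2.2.1, PowerSeries.coeff_mk, c0, c1]
      norm_num
    · simp only [(coeff_quartic_mul _ _ _ _ _ _).2.2.2.1, PowerSeries.coeff_mk, c0, c1, c2]
      norm_num
    · simp only [(coeff_quartic_mul _ _ _ _ _ _).2.2.2.2, PowerSeries.coeff_mk, c0, c1, c2, c3]
      norm_num
  · obtain ⟨m, rfl⟩ := Nat.exists_eq_add_of_le' hn
    simp only [(coeff_quartic_mul _ _ _ _ _ _).1, PowerSeries.coeff_mk]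
    have h := congrArg (Rat.cast : ℚ → ℂ) (periodCoeff_rec_four m)
    push_cast at h
    push_cast
    linear_combination h

/-- An annihilator of least order right-divides 𝒟 up to a polynomial factor, so its exponents are
among those of 𝒟, and `order_of_exponents` rules this out. -/
theorem not_eval₂_periodSeries (M : ℂ[X][X]) (hM : M ≠ 0) (hd : M.natDegree < 4) :
    (M.eval₂ mulSeries derivSeries) periodSeries ≠ 0 := by
  classical
  intro hM0
  set P : ℕ → Prop := fun r => ∃ A : ℂ[X][X], A ≠ 0 ∧ A.natDegree = r ∧
    (A.eval₂ mulSeries derivSeries) periodSeries = 0 with hP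
  have hex : ∃ r, P r := ⟨_, M, hM, rfl, hM0⟩
  obtain ⟨A, hA, hAr, hA0⟩ := Nat.find_spec hex
  have hmin : ∀ B : ℂ[X][X], (B.eval₂ mulSeries derivSeries) periodSeries = 0 →
      B.degree < A.degree → B = 0 := by
    intro B hB hlt
    by_contra hne
    exact Nat.find_min hex (hAr ▸ natDegree_lt_natDegree hne hlt) ⟨B, hne, rfl, hB⟩
  have hAd : A.natDegree < 4 := by
    rw [hAr]
    exact (Nat.find_min' hex ⟨M, hM, rfl, hM0⟩).trans_lt hd
  -- The factor X makes 0 a root of the leading coefficient, as `order_of_exponents` requires. It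
  -- preserves the order and the annihilation.
  have hN0 : C X * A ≠ 0 := mul_ne_zero (by simp) hA
  have hNd : (C X * A).natDegree = A.natDegree := natDegree_C_mul X_ne_zero
  have hNdeg : (C X * A).degree = A.degree := degree_C_mul X_ne_zero
  set N := C X * A with hN
  have hNk : (N.eval₂ mulSeries derivSeries) periodSeries = 0 := by
    rw [hN, eval₂_C_mul_left, Module.End.mul_apply, hA0, map_zero]
  have hser : periodSeries ≠ 0 := by
    intro h
    have := congrArg (PowerSeries.coeff 0) h
    simp [periodSeries, periodCoeff] at this
  -- Order 0 is impossible, since power series over ℂ have no zero divisors.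
  obtain ⟨q, hq⟩ : ∃ q, N.natDegree = q + 1 := by
    refine ⟨N.natDegree - 1, ?_⟩
    by_contra hcon
    have h0 : N.natDegree = 0 := by omega
    rw [eq_C_of_natDegree_eq_zero h0, eval₂_C, mulSeries_apply, mul_eq_zero] at hNk
    have : N.coeff 0 = 0 := by simpa using hNk.resolve_right hser
    apply hN0
    rw [eq_C_of_natDegree_eq_zero h0, this, C_0]
  obtain ⟨h, h0, Q, R, hQ, hR, hid⟩ := exists_pseudo_division N hN0 (ofEuler opD)
  -- The remainder annihilates the series and has smaller order than `A`, so minimality kills it.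
  have hR0 : R = 0 := by
    refine hmin R ?_ (hR.trans_eq hNdeg)
    have e := congrArg (fun T => T periodSeries) (hid mulSeries derivSeries isWeyl_series)
    simp only [LinearMap.add_apply, Module.End.mul_apply, hNk, map_zero, zero_add] at e
    rw [← e, eval₂_ofEuler _ _ isWeyl_series, opD_periodSeries, map_zero]
  -- The same division identity is now read on polynomials expanded at p, where indicial polynomials
  -- are defined.
  have hfac : ∀ p, mulTaylor p h * (ofEuler opD).eval₂ (mulTaylor p) derivative
      = Q.eval₂ (mulTaylor p) derivative * N.eval₂ (mulTaylor p) derivative := by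
    intro p
    rw [hid _ _ (isWeyl_taylor p), hR0, eval₂_zero, add_zero]
  have hle : N.natDegree ≤ (ofEuler opD).natDegree := by
    rw [natDegree_ofEuler_opD, hNd]; omega
  have hind : ∀ {σ : ℤ}, σ ≠ 0 → ∀ {p f}, IsIndicial σ p (ofEuler opD) f →
      ∃ g, IsIndicial σ p N g ∧ g ∣ f := by
    rintro σ hσ p f ⟨l, hl, hf, hfd⟩
    obtain ⟨v, hv, hvd, hdvd⟩ := exists_symb_dvd hσ p h0 hN0 hle hQ (hfac p) hl (hf ▸ hfd)
    exact ⟨_, ⟨v, hv, rfl, hvd⟩, hf ▸ hdvd⟩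
  have hall : ∀ p, ∃ g, IsIndicial 1 p N g ∧ (p = 0 → g.roots.sum = 0) ∧
      (p ≠ 0 → HasNatExponents g) := by
    intro p
    by_cases hp : p = 0
    · subst hp
      obtain ⟨g, hg, hdvd⟩ := hind one_ne_zero isIndicial_opD_zero
      refine ⟨g, hg, fun _ => ?_, fun h => absurd rfl h⟩
      rw [sum_roots_of_dvd_pow 169 0 (by norm_num) 4 hdvd, mul_zero]
    · obtain ⟨f, hf, hfe⟩ := isIndicial_opD_finite p hp
      obtain ⟨g, hg, hdvd⟩ := hind one_ne_zero hf
      exact ⟨g, hg, fun h => absurd h hp, fun _ => hfe.of_dvd hdvd⟩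
  choose F hF hF0 hFp using hall
  obtain ⟨G, hG, hGd⟩ := hind (neg_ne_zero.mpr one_ne_zero) isIndicial_opD_infinity
  refine order_of_exponents hq (by omega) ?_ F hF (hF0 0 rfl) hFp hG ?_
  · rw [hN, coeff_C_mul]
    simp [IsRoot]
  · rw [sum_roots_of_dvd_pow (-65536) (-1 / 2) (by norm_num) 4 hGd]
    obtain ⟨v, -, -, hd⟩ := hG
    rw [hd, hq]
    push_cast
    ring

theorem isPicardFuchs_opD {Φ : ℂ → ℂ} (hΦ : AnalyticAt ℂ Φ 0)
    (hT : taylorSeries Φ = periodSeries) : IsPicardFuchs opD Φ := by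
  refine ⟨?_, ?_, fun M hM hM0 => ?_⟩
  · intro h
    have := natDegree_opD
    rw [h] at this
    simp at this
  · rw [applyOp_eventuallyEq_zero_iff hΦ, hT, eval₂_ofEuler _ _ isWeyl_series, opD_periodSeries]
  · by_contra hlt
    rw [natDegree_opD] at hlt
    obtain ⟨h1, h2⟩ := ofEuler_ne_zero M hM
    rw [applyOp_eventuallyEq_zero_iff hΦ, hT] at hM0
    exact not_eval₂_periodSeries _ h1 (by omega) hM0

end PicardFuchs

/-! ### Averages over the unit circle -/

/-- The average of `f` over the unit circle. -/
noncomputable def avg (f : ℂ → ℂ) : ℂ := Real.circleAverage f 0 1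

theorem avg_congr {f g : ℂ → ℂ} (h : ∀ z, ‖z‖ = 1 → f z = g z) : avg f = avg g :=
  Real.circleAverage_congr_sphere fun z hz => h z (by simpa using hz)

theorem avg_const_mul (c : ℂ) (f : ℂ → ℂ) : avg (fun z => c * f z) = c * avg f := by
  simpa [avg] using Real.circleAverage_fun_smul (a := c) (f := f) (c := 0) (R := 1)

theorem avg_mul_const (c : ℂ) (f : ℂ → ℂ) : avg (fun z => f z * c) = avg f * c := by
  simp only [mul_comm _ c, avg_const_mul]

/-- Cauchy's formula as an average. -/
theorem avg_div_one_sub {h : ℂ → ℂ} (hh : DiffContOnCl ℂ h (Metric.ball 0 1)) {β : ℂ}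
    (hβ : ‖β‖ < 1) : avg (fun z => h z / (1 - β / z)) = h β := by
  have key := DiffContOnCl.circleAverage_smul_div (c := 0) (R := 1) (w := β)
    (f := h) (by simpa using hh) (by simpa using hβ)
  rw [← key]
  refine avg_congr fun z hz => ?_
  have hz0 : z ≠ 0 := by rintro rfl; simp at hz
  have hzb : z - β ≠ 0 := by
    intro h0; rw [sub_eq_zero.mp h0] at hz; linarith
  simp only [sub_zero, smul_eq_mul]
  have : 1 - β / z = (z - β) / z := by field_simp
  rw [this]; field_simp

/-- Nonnegative powers are Cauchy's formula at 0. Negative ones reduce to them because z ↦ 1/z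
preserves averages over the unit circle. -/
theorem avg_zpow (n : ℤ) : avg (fun z => z ^ n) = if n = 0 then 1 else 0 := by
  have nat : ∀ m : ℕ, avg (fun z => z ^ m) = if m = 0 then 1 else 0 := by
    intro m
    have := avg_div_one_sub (h := fun z => z ^ m) (β := 0)
      ((differentiable_pow m).diffContOnCl) (by simp)
    simp only [zero_div, sub_zero, div_one] at this
    rw [this]; split_ifs with h <;> simp [h]
  obtain ⟨m, rfl | rfl⟩ := n.eq_nat_or_neg
  · simp [nat m]
  · have := Real.circleAverage_zero_one_congr_inv (f := fun z : ℂ => z ^ m)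
    rw [← avg] at this
    simpa [avg, nat m] using this.trans (nat m)

/-- Averaging a series term by term. -/
theorem hasSum_avg {ι : Type*} [Countable ι] {g : ι → ℂ → ℂ} {f : ℂ → ℂ} {u : ι → ℝ}
    (hg : ∀ i, ContinuousOn (g i) (Metric.sphere 0 1)) (hu : Summable u)
    (hb : ∀ i z, ‖z‖ = 1 → ‖g i z‖ ≤ u i)
    (hs : ∀ z, ‖z‖ = 1 → HasSum (fun i => g i z) (f z)) :
    HasSum (fun i => avg (g i)) (avg f) := by
  have hn : ∀ θ, ‖circleMap 0 1 θ‖ = 1 := by intro θ; simp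
  have hc : ∀ i, Continuous fun θ => g i (circleMap 0 1 θ) := fun i =>
    (hg i).comp_continuous (continuous_circleMap 0 1) (fun θ => by simp)
  have := intervalIntegral.hasSum_integral_of_dominated_convergence
    (μ := MeasureTheory.volume) (a := 0) (b := 2 * Real.pi)
    (F := fun i θ => g i (circleMap 0 1 θ)) (f := fun θ => f (circleMap 0 1 θ))
    (fun i _ => u i) (fun i => (hc i).aestronglyMeasurable)
    (fun i => Eventually.of_forall fun θ _ => hb i _ (hn θ))
    (Eventually.of_forall fun θ _ => hu)
    (by simp)
    (Eventually.of_forall fun θ _ => hs _ (hn θ))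
  exact this.const_smul ((2 * Real.pi)⁻¹ : ℝ)

/-! ### Fixed points of bounded holomorphic maps -/

/-- `G` is holomorphic and bounded by `1 / 2` on the disc of radius `3`. -/
structure IsSmallMap (G : ℂ → ℂ) : Prop where
  differentiableOn : DifferentiableOn ℂ G (Metric.ball 0 3)
  norm_le : ∀ z ∈ Metric.ball (0 : ℂ) 3, ‖G z‖ ≤ 1 / 2

namespace IsSmallMap

variable {G : ℂ → ℂ}

/-- Cauchy's estimate on the circle of radius 1 about z, for which the disc of radius 3 leaves room.
It makes G a contraction of the closed unit disc. -/
theorem norm_deriv_le (hG : IsSmallMap G) {z : ℂ} (hz : z ∈ Metric.closedBall (0 : ℂ) 1) :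
    ‖deriv G z‖ ≤ 1 / 2 := by
  have hz' : dist z 0 ≤ 1 := hz
  have hsub : Metric.closedBall z 1 ⊆ Metric.ball 0 3 :=
    Metric.closedBall_subset_ball' (by linarith)
  have := Complex.norm_deriv_le_of_forall_mem_sphere_norm_le (c := z) (R := 1) (C := 1 / 2)
    one_pos (hG.differentiableOn.diffContOnCl_ball hsub)
    (fun w hw => hG.norm_le w (hsub (Metric.sphere_subset_closedBall hw)))
  simpa using this

theorem norm_sub_le (hG : IsSmallMap G) {z w : ℂ} (hz : z ∈ Metric.closedBall (0 : ℂ) 1)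
    (hw : w ∈ Metric.closedBall (0 : ℂ) 1) : ‖G z - G w‖ ≤ 1 / 2 * ‖z - w‖ := by
  refine (convex_closedBall (0 : ℂ) 1).norm_image_sub_le_of_norm_deriv_le
    (fun x hx => ?_) (fun x hx => hG.norm_deriv_le hx) hw hz
  exact hG.differentiableOn.differentiableAt (Metric.isOpen_ball.mem_nhds
    (Metric.closedBall_subset_ball (by norm_num) hx))

theorem fixed_unique (hG : IsSmallMap G) {z w : ℂ} (hz : ‖z‖ ≤ 1) (hw : ‖w‖ ≤ 1)
    (h1 : G z = z) (h2 : G w = w) : z = w := by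
  have := hG.norm_sub_le (z := z) (w := w) (by simpa using hz) (by simpa using hw)
  rw [h1, h2] at this
  have h0 : ‖z - w‖ = 0 := by linarith [norm_nonneg (z - w)]
  exact sub_eq_zero.mp (norm_eq_zero.mp h0)

theorem exists_fixed (hG : IsSmallMap G) : ∃ z, ‖z‖ < 1 ∧ G z = z := by
  have hmap : Set.MapsTo G (Metric.closedBall 0 1) (Metric.closedBall 0 1) := by
    intro z hz
    have := hG.norm_le z (Metric.closedBall_subset_ball (by norm_num) hz)
    simp only [mem_closedBall_zero_iff]; linarith
  have hc : ContractingWith (1 / 2) (hmap.restrict G (Metric.closedBall 0 1) _) := by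
    refine ⟨by rw [← NNReal.coe_lt_coe]; norm_num, LipschitzWith.of_dist_le_mul fun x y => ?_⟩
    have := hG.norm_sub_le x.2 y.2
    simpa [Subtype.dist_eq, dist_eq_norm] using this
  obtain ⟨z, hz, hfix, -⟩ := hc.exists_fixedPoint' (x := 0)
    Metric.isClosed_closedBall.isComplete hmap (by simp) (edist_ne_top _ _)
  refine ⟨z, ?_, hfix⟩
  have := hG.norm_le z (Metric.closedBall_subset_ball (by norm_num) hz)
  rw [hfix.eq] at this
  linarith

theorem one_sub_deriv_ne_zero (hG : IsSmallMap G) {w : ℂ} (hw : ‖w‖ ≤ 1) :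
    1 - deriv G w ≠ 0 := by
  intro h
  have := hG.norm_deriv_le (z := w) (by simpa using hw)
  rw [← sub_eq_zero.mp h] at this
  norm_num at this

/-- Lagrange's formula: the average of `h z / (1 - G z / z)` is a residue at the fixed point
of `G`. -/
theorem avg_div_one_sub_div (hG : IsSmallMap G) {h : ℂ → ℂ}
    (hh : DiffContOnCl ℂ h (Metric.ball 0 1)) {w : ℂ} (hw : ‖w‖ < 1) (hfix : G w = w) :
    avg (fun z => h z / (1 - G z / z)) = h w / (1 - deriv G w) := by
  have hball : Metric.ball (0 : ℂ) 3 ∈ 𝓝 w :=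
    Metric.isOpen_ball.mem_nhds (by simp; linarith)
  -- Since G w = w, z - G z = (z - w)(1 - `dslope G w z`). The second factor has no zero in the
  -- closed disc by contraction, so Cauchy's formula at w applies to h divided by it.
  have hD : DifferentiableOn ℂ (dslope G w) (Metric.ball 0 3) :=
    (Complex.differentiableOn_dslope hball).mpr hG.differentiableOn
  have hne : ∀ z ∈ Metric.closedBall (0 : ℂ) 1, 1 - dslope G w z ≠ 0 := by
    intro z hz
    by_cases hzw : z = w
    · rw [hzw, dslope_same]; exact hG.one_sub_deriv_ne_zero hw.le
    · intro h0
      have h1 := sub_smul_dslope G w z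
      rw [← sub_eq_zero.mp h0, smul_eq_mul, mul_one] at h1
      exact hzw (sub_eq_zero.mp (norm_eq_zero.mp (by
        have := hG.norm_sub_le hz (w := w) (by simpa using hw.le)
        rw [← h1] at this
        linarith [norm_nonneg (z - w)])))
  have hD' : DiffContOnCl ℂ (fun z => h z / (1 - dslope G w z)) (Metric.ball 0 1) := by
    have h1 : DiffContOnCl ℂ (fun z => 1 - dslope G w z) (Metric.ball 0 1) :=
      ((differentiableOn_const 1).sub hD).diffContOnCl_ball
        (Metric.closedBall_subset_ball (by norm_num))
    have h2 := h1.inv (fun z hz => hne z (by rwa [closure_ball _ one_ne_zero] at hz))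
    have h3 := h2.smul hh
    refine ⟨h3.1.congr fun z _ => ?_, h3.2.congr fun z _ => ?_⟩ <;>
    simp [div_eq_inv_mul]
  have := avg_div_one_sub hD' hw
  rw [dslope_same] at this
  rw [← this]
  refine avg_congr fun z hz => ?_
  have hz0 : z ≠ 0 := by rintro rfl; simp at hz
  have h1 := sub_smul_dslope G w z
  rw [smul_eq_mul, hfix] at h1
  rw [div_div]
  congr 1
  field_simp
  linear_combination h1

end IsSmallMap

/-! ### Solving the equations of `X̌_t` near the torus -/

/-- The solution `x_1` of `P_4 = 0` for `x_0 = 1`. -/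
noncomputable def solOne (t a b c y z : ℂ) : ℂ := (t + t ^ 2 * y ^ 2 * (z + a)) / (b * c)

/-- The solution `x_3` of `P_2 = P_4 = 0` for `x_0 = 1` and `x_2 = y`. -/
noncomputable def solThree (t a b c y : ℂ) : ℂ :=
  (t * (b * c) * (b + c) + t ^ 2 * y ^ 2 * ((t + t ^ 2 * y ^ 2 * a) / (b * c)))
    / (a - t ^ 4 * y ^ 4 / (b * c))

/-- The map whose fixed points are the solutions `x_2` of `P_2 = P_4 = P_5 = 0` for `x_0 = 1`. -/
noncomputable def solMap (t a b c y : ℂ) : ℂ :=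
  (t * solThree t a b c y * a * (solThree t a b c y + a)
    + t ^ 2 * solOne t a b c y (solThree t a b c y)) / (b * c)

/-- The smallness of `t` that is needed on the torus of radius `ε`. -/
structure IsSmall (ε : ℝ) (t : ℂ) : Prop where
  pos : 0 < ε
  den : 81 * ‖t‖ ^ 4 / ε ^ 2 < ε / 2
  three : 2 * ‖t‖ * ε ^ 3 + 9 * ‖t‖ ^ 2 * ((‖t‖ + 9 * ‖t‖ ^ 2 * ε) / ε ^ 2) < ε / 2
  one : (‖t‖ + 9 * ‖t‖ ^ 2 * (1 + ε)) / ε ^ 2 < 1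
  map : (‖t‖ * ε * (1 + ε) + ‖t‖ ^ 2) / ε ^ 2 < 1 / 2
  fst : (2 * ‖t‖ * ε ^ 3 + ‖t‖ ^ 2) / ε < 1

theorem eventually_isSmall {ε : ℝ} (hε : 0 < ε) : ∀ᶠ t in 𝓝 (0 : ℂ), IsSmall ε t := by
  have key : ∀ (f : ℂ → ℝ) (r : ℝ), Continuous f → f 0 = 0 → 0 < r → ∀ᶠ t in 𝓝 0, f t < r := by
    intro f r hf h0 hr
    exact hf.continuousAt.eventually_lt continuousAt_const (by rwa [h0])
  filter_upwards [
    key (fun t => 81 * ‖t‖ ^ 4 / ε ^ 2) (ε / 2) (by fun_prop) (by simp) (by positivity),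
    key (fun t => 2 * ‖t‖ * ε ^ 3 + 9 * ‖t‖ ^ 2 * ((‖t‖ + 9 * ‖t‖ ^ 2 * ε) / ε ^ 2)) (ε / 2)
      (by fun_prop) (by simp) (by positivity),
    key (fun t => (‖t‖ + 9 * ‖t‖ ^ 2 * (1 + ε)) / ε ^ 2) 1 (by fun_prop) (by simp) (by positivity),
    key (fun t => (‖t‖ * ε * (1 + ε) + ‖t‖ ^ 2) / ε ^ 2) (1 / 2) (by fun_prop) (by simp)
      (by positivity),
    key (fun t => (2 * ‖t‖ * ε ^ 3 + ‖t‖ ^ 2) / ε) 1 (by fun_prop) (by simp) (by positivity)]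
    with t h1 h2 h3 h4 h5
  exact ⟨hε, h1, h2, h3, h4, h5⟩

/-- `a`, `b`, `c` lie on the circle of radius `ε`, and `t` is small. -/
structure IsSmallAt (ε : ℝ) (t a b c : ℂ) : Prop extends IsSmall ε t where
  norm_a : ‖a‖ = ε
  norm_b : ‖b‖ = ε
  norm_c : ‖c‖ = ε

/-! ### Estimates, derivatives and solutions on the torus of radius ε. -/

namespace IsSmallAt

variable {ε : ℝ} {t a b c : ℂ}

theorem a_ne (h : IsSmallAt ε t a b c) : a ≠ 0 := norm_pos_iff.mp (h.norm_a ▸ h.pos)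
theorem b_ne (h : IsSmallAt ε t a b c) : b ≠ 0 := norm_pos_iff.mp (h.norm_b ▸ h.pos)
theorem c_ne (h : IsSmallAt ε t a b c) : c ≠ 0 := norm_pos_iff.mp (h.norm_c ▸ h.pos)

theorem norm_bc (h : IsSmallAt ε t a b c) : ‖b * c‖ = ε ^ 2 := by
  rw [norm_mul, h.norm_b, h.norm_c, sq]

/-- The range |y| ≤ 3, rather than |y| ≤ 1, is what `IsSmallMap` asks for. It is the source of the
constants 81 = 3^4 and 9 = 3² in `IsSmall`. -/
theorem norm_den (h : IsSmallAt ε t a b c) {y : ℂ} (hy : ‖y‖ ≤ 3) :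
    ‖t ^ 4 * y ^ 4 / (b * c)‖ < ε / 2 := by
  refine lt_of_le_of_lt ?_ h.den
  rw [norm_div, h.norm_bc, norm_mul, norm_pow, norm_pow]
  have hy4 : ‖y‖ ^ 4 ≤ 81 := by
    calc ‖y‖ ^ 4 ≤ 3 ^ 4 := by gcongr
      _ = 81 := by norm_num
  have h0 := h.pos
  rw [mul_comm 81]
  gcongr

theorem den_lt (h : IsSmallAt ε t a b c) {y : ℂ} (hy : ‖y‖ ≤ 3) :
    ε / 2 < ‖a - t ^ 4 * y ^ 4 / (b * c)‖ := by
  have h1 := norm_sub_norm_le a (t ^ 4 * y ^ 4 / (b * c))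
  have h2 := h.norm_den hy
  rw [h.norm_a] at h1
  linarith

theorem den_ne (h : IsSmallAt ε t a b c) {y : ℂ} (hy : ‖y‖ ≤ 3) :
    a - t ^ 4 * y ^ 4 / (b * c) ≠ 0 :=
  norm_pos_iff.mp (lt_trans (half_pos h.pos) (h.den_lt hy))

theorem norm_solOne (h : IsSmallAt ε t a b c) {y z : ℂ} (hy : ‖y‖ ≤ 3) (hz : ‖z‖ ≤ 1) :
    ‖solOne t a b c y z‖ < 1 := by
  refine lt_of_le_of_lt ?_ h.one
  have h0 := h.pos
  rw [solOne, norm_div, h.norm_bc]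
  gcongr
  refine (norm_add_le _ _).trans ?_
  gcongr
  rw [norm_mul, norm_mul, norm_pow, norm_pow]
  have : ‖y‖ ^ 2 ≤ 3 ^ 2 := by gcongr
  have h3 : ‖z + a‖ ≤ 1 + ε := (norm_add_le _ _).trans (by rw [h.norm_a]; gcongr)
  rw [mul_comm 9]
  gcongr
  linarith

theorem norm_solThree (h : IsSmallAt ε t a b c) {y : ℂ} (hy : ‖y‖ ≤ 3) :
    ‖solThree t a b c y‖ < 1 := by
  have h0 := h.pos
  rw [solThree, norm_div, div_lt_one (norm_pos_iff.mpr (h.den_ne hy))]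
  refine lt_trans (lt_of_le_of_lt ?_ h.three) (h.den_lt hy)
  have hy2 : ‖y‖ ^ 2 ≤ 9 := by
    calc ‖y‖ ^ 2 ≤ 3 ^ 2 := by gcongr
      _ = 9 := by norm_num
  have e1 : ‖t * (b * c) * (b + c)‖ ≤ 2 * ‖t‖ * ε ^ 3 := by
    have : ‖b + c‖ ≤ ε + ε := (norm_add_le _ _).trans (by rw [h.norm_b, h.norm_c])
    calc ‖t * (b * c) * (b + c)‖ = ‖t‖ * ε ^ 2 * ‖b + c‖ := by rw [norm_mul, norm_mul, h.norm_bc]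
      _ ≤ ‖t‖ * ε ^ 2 * (ε + ε) := by gcongr
      _ = _ := by ring
  have e2 : ‖t ^ 2 * y ^ 2 * ((t + t ^ 2 * y ^ 2 * a) / (b * c))‖
      ≤ 9 * ‖t‖ ^ 2 * ((‖t‖ + 9 * ‖t‖ ^ 2 * ε) / ε ^ 2) := by
    rw [norm_mul, norm_div, h.norm_bc, norm_mul, norm_pow, norm_pow, mul_comm 9 (‖t‖ ^ 2)]
    gcongr
    refine (norm_add_le _ _).trans ?_
    gcongr
    rw [norm_mul, norm_mul, norm_pow, norm_pow, h.norm_a]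
    gcongr
  exact (norm_add_le _ _).trans (add_le_add e1 e2)

theorem norm_third_le (h : IsSmallAt ε t a b c) {x z : ℂ} (hx : ‖x‖ ≤ 1) (hz : ‖z‖ ≤ 1) :
    ‖(t * z * a * (z + a) + t ^ 2 * x) / (b * c)‖ < 1 / 2 := by
  refine lt_of_le_of_lt ?_ h.map
  have h0 := h.pos
  rw [norm_div, h.norm_bc]
  gcongr
  refine (norm_add_le _ _).trans (add_le_add ?_ ?_)
  · have h3 : ‖z + a‖ ≤ 1 + ε := (norm_add_le _ _).trans (by rw [h.norm_a]; gcongr)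
    rw [norm_mul, norm_mul, norm_mul, h.norm_a]
    calc ‖t‖ * ‖z‖ * ε * ‖z + a‖ ≤ ‖t‖ * 1 * ε * (1 + ε) := by gcongr
      _ = _ := by ring
  · rw [norm_mul, norm_pow]
    calc ‖t‖ ^ 2 * ‖x‖ ≤ ‖t‖ ^ 2 * 1 := by gcongr
      _ = _ := by ring

theorem norm_first_lt (h : IsSmallAt ε t a b c) {x y : ℂ} (hx : ‖x‖ ≤ 1) (hy : ‖y‖ ≤ 1) :
    ‖(t * (b * c) * (b + c) + t ^ 2 * x * y ^ 2) / a‖ < 1 := by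
  refine lt_of_le_of_lt ?_ h.fst
  have h0 := h.pos
  rw [norm_div, h.norm_a]
  gcongr
  refine (norm_add_le _ _).trans (add_le_add ?_ ?_)
  · have : ‖b + c‖ ≤ ε + ε := (norm_add_le _ _).trans (by rw [h.norm_b, h.norm_c])
    calc ‖t * (b * c) * (b + c)‖ = ‖t‖ * ε ^ 2 * ‖b + c‖ := by rw [norm_mul, norm_mul, h.norm_bc]
      _ ≤ ‖t‖ * ε ^ 2 * (ε + ε) := by gcongr
      _ = _ := by ring
  · rw [norm_mul, norm_mul, norm_pow, norm_pow]
    calc ‖t‖ ^ 2 * ‖x‖ * ‖y‖ ^ 2 ≤ ‖t‖ ^ 2 * 1 * 1 ^ 2 := by gcongr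
      _ = _ := by ring

/-- The derivative of `solThree` in `y`. -/
theorem hasDerivAt_solThree (h : IsSmallAt ε t a b c) {y : ℂ} (hy : ‖y‖ ≤ 3) :
    HasDerivAt (solThree t a b c)
      ((2 * t ^ 2 * y * solOne t a b c y (solThree t a b c y) + t ^ 2 * y ^ 2 *
        (2 * t ^ 2 * y * (solThree t a b c y + a) / (b * c))) / (a - t ^ 4 * y ^ 4 / (b * c))) y := by
  have hd := h.den_ne hy
  have hb := h.b_ne
  have hc := h.c_ne
  have p2 : HasDerivAt (fun y : ℂ => y ^ 2) (2 * y) y := by simpa using hasDerivAt_pow 2 y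
  have p4 : HasDerivAt (fun y : ℂ => y ^ 4) (4 * y ^ 3) y := by simpa using hasDerivAt_pow 4 y
  have hn := ((p2.const_mul (t ^ 2)).mul
    ((((p2.const_mul (t ^ 2)).mul_const a).const_add t).div_const (b * c))).const_add
      (t * (b * c) * (b + c))
  have hdn := ((p4.const_mul (t ^ 4)).div_const (b * c)).const_sub a
  refine (hn.div hdn hd).congr_deriv ?_
  have hx : solThree t a b c y * (a - t ^ 4 * y ^ 4 / (b * c))
    = t * (b * c) * (b + c) + t ^ 2 * y ^ 2 * ((t + t ^ 2 * y ^ 2 * a) / (b * c)) := by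
    rw [solThree, div_mul_cancel₀ _ hd]
  rw [Pi.mul_apply, ← hx]
  rw [div_eq_div_iff (pow_ne_zero 2 hd) hd]
  rw [solOne]
  generalize solThree t a b c y = X
  set d := a - t ^ 4 * y ^ 4 / (b * c) with hd'
  field_simp
  ring

theorem hasDerivAt_solMap (h : IsSmallAt ε t a b c) {y X : ℂ}
    (hX : HasDerivAt (solThree t a b c) X y) :
    HasDerivAt (solMap t a b c)
      ((t * a * (2 * solThree t a b c y + a) * X + t ^ 2 *
        ((2 * t ^ 2 * y * (solThree t a b c y + a) + t ^ 2 * y ^ 2 * X) / (b * c))) / (b * c)) y := by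
  have hb := h.b_ne
  have hc := h.c_ne
  have p2 : HasDerivAt (fun y : ℂ => y ^ 2) (2 * y) y := by simpa using hasDerivAt_pow 2 y
  have h1 : HasDerivAt (fun y => solOne t a b c y (solThree t a b c y)) _ y :=
    (((p2.const_mul (t ^ 2)).mul (hX.add_const a)).const_add t).div_const (b * c)
  have h2 := (((hX.const_mul t).mul_const a).mul (hX.add_const a)).add (h1.const_mul (t ^ 2))
  refine (h2.div_const (b * c)).congr_deriv ?_
  field_simp
  ring

theorem isSmallMap (h : IsSmallAt ε t a b c) : IsSmallMap (solMap t a b c) where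
  differentiableOn := fun y hy =>
    (h.hasDerivAt_solMap (h.hasDerivAt_solThree (mem_ball_zero_iff.mp hy).le)
      ).differentiableAt.differentiableWithinAt
  norm_le := fun y hy => by
    have hy' : ‖y‖ ≤ 3 := by simpa using (show dist y 0 < 3 from hy).le
    have h3 := (h.norm_solThree hy').le
    exact (h.norm_third_le (h.norm_solOne hy' h3).le h3).le

/-- The affine solutions of `P_2 = P_4 = P_5 = 0` are given by the fixed points of `solMap`. -/
theorem solution_iff (h : IsSmallAt ε t a b c) {x y z : ℂ} (hy : ‖y‖ ≤ 3) :
    (z * a - t * (b * c) * (b + c) - t ^ 2 * x * y ^ 2 = 0 ∧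
      x * (b * c) - t - t ^ 2 * y ^ 2 * (z + a) = 0 ∧
      y * (b * c) - t * z * a * (z + a) - t ^ 2 * x = 0) ↔
    solMap t a b c y = y ∧ z = solThree t a b c y ∧ x = solOne t a b c y z := by
  have hb := h.b_ne
  have hc := h.c_ne
  have hd := h.den_ne hy
  have hbc : b * c ≠ 0 := mul_ne_zero hb hc
  have e1 : x = solOne t a b c y z ↔ x * (b * c) - t - t ^ 2 * y ^ 2 * (z + a) = 0 := by
    rw [solOne, eq_div_iff hbc]
    constructor <;> intro h' <;> linear_combination h'
  have e2 : x = solOne t a b c y z → (z = solThree t a b c y ↔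
      z * a - t * (b * c) * (b + c) - t ^ 2 * x * y ^ 2 = 0) := by
    rintro rfl
    rw [solThree, eq_div_iff hd, solOne]
    have : z * (a - t ^ 4 * y ^ 4 / (b * c))
        - (t * (b * c) * (b + c) + t ^ 2 * y ^ 2 * ((t + t ^ 2 * y ^ 2 * a) / (b * c)))
      = z * a - t * (b * c) * (b + c) - t ^ 2 * ((t + t ^ 2 * y ^ 2 * (z + a)) / (b * c)) * y ^ 2 := by
      field_simp; ring
    rw [← this, sub_eq_zero]
  have e3 : z = solThree t a b c y → x = solOne t a b c y z → (solMap t a b c y = y ↔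
      y * (b * c) - t * z * a * (z + a) - t ^ 2 * x = 0) := by
    rintro rfl rfl
    rw [solMap, div_eq_iff hbc]
    constructor <;> intro h' <;> linear_combination -h'
  constructor
  · rintro ⟨h1, h2, h3⟩
    have hx := e1.mpr h2
    have hz := (e2 hx).mpr h1
    exact ⟨(e3 hz hx).mpr h3, hz, hx⟩
  · rintro ⟨h1, hz, hx⟩
    exact ⟨(e2 hx).mp hz, e1.mp hx, (e3 hz hx).mp h1⟩

end IsSmallAt

/-! ### The triple residue -/

/-- The kernel `1 / ((1 - A) (1 - B) (1 - C))` whose poles are at `P_2 = P_4 = P_5 = 0`. -/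
noncomputable def torusKernel (t a b c y z x : ℂ) : ℂ :=
  1 / ((1 - (t * (b * c) * (b + c) + t ^ 2 * x * y ^ 2) / a / z) * (1 - solOne t a b c y z / x)
    * (1 - (t * z * a * (z + a) + t ^ 2 * x) / (b * c) / y))

/-- The Jacobian determinant `∂(P_2, P_4, P_5) / ∂(x_1, x_2, x_3)` at `x_0 = 1`. -/
noncomputable def jac (t a b c x y z : ℂ) : ℂ :=
  Matrix.det !![-(t ^ 2 * y ^ 2), -(2 * t ^ 2 * x * y), a;
    b * c, -(2 * t ^ 2 * y * (z + a)), -(t ^ 2 * y ^ 2);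
    -t ^ 2, b * c, -(t * a * (2 * z + a))]

namespace IsSmallAt

variable {ε : ℝ} {t a b c : ℂ}

/-- Elimination of x_1 by P_4 has pivot bc, elimination of x_3 by P_2 has pivot a - t^4 y^4/(bc),
and what remains of P_5 is bc(1 - G'(y)) with G = `solMap`. -/
theorem jac_eq (h : IsSmallAt ε t a b c) {y : ℂ} (hy : ‖y‖ ≤ 3) :
    jac t a b c (solOne t a b c y (solThree t a b c y)) y (solThree t a b c y)
      = (b * c) ^ 2 * (a - t ^ 4 * y ^ 4 / (b * c)) * (1 - deriv (solMap t a b c) y) := by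
  have hb := h.b_ne
  have hc := h.c_ne
  have hd := h.den_ne hy
  rw [(h.hasDerivAt_solMap (h.hasDerivAt_solThree hy)).deriv, jac, Matrix.det_fin_three]
  generalize solOne t a b c y (solThree t a b c y) = x
  generalize solThree t a b c y = z
  set X := (2 * t ^ 2 * y * x + t ^ 2 * y ^ 2 * (2 * t ^ 2 * y * (z + a) / (b * c))) /
    (a - t ^ 4 * y ^ 4 / (b * c)) with hX
  rw [eq_div_iff hd] at hX
  field_simp at hX
  simp only [Matrix.of_apply, Matrix.cons_val', Matrix.cons_val_zero, Matrix.cons_val_one,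
    Matrix.cons_val]
  field_simp
  linear_combination (t * a * (2 * z + a) * (b * c) + t ^ 4 * y ^ 2) * hX

theorem one_sub_ne_zero {w : ℂ} (hw : ‖w‖ < 1) : 1 - w ≠ 0 := by
  intro h
  rw [← sub_eq_zero.mp h] at hw
  simp at hw

/-- In x, z and y in turn the only pole inside the unit circle is at the solution of P_4, P_2 and
P_5, respectively: by smallness of t the remaining factors have no zeros in the disc. The last
average is Lagrange's formula for `solMap`. -/
theorem avg_avg_avg_torusKernel (h : IsSmallAt ε t a b c) {w : ℂ} (hw : ‖w‖ < 1)
    (hfix : solMap t a b c w = w) :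
    avg (fun y => avg fun z => avg fun x => torusKernel t a b c y z x)
      = a * (b * c) ^ 2 /
        jac t a b c (solOne t a b c w (solThree t a b c w)) w (solThree t a b c w) := by
  have ha := h.a_ne
  have hb := h.b_ne
  have hc := h.c_ne
  have n1 : ∀ {u v : ℂ}, ‖v‖ = 1 → ‖u / v‖ = ‖u‖ := by
    intro u v hv; rw [norm_div, hv, div_one]
  have ne0 : ∀ {v : ℂ}, ‖v‖ = 1 → v ≠ 0 := by rintro v hv rfl; simp at hv
  have hcb : ∀ {v : ℂ}, v ∈ closure (Metric.ball (0 : ℂ) 1) → ‖v‖ ≤ 1 := by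
    intro v hv; rw [closure_ball _ one_ne_zero] at hv; simpa using hv
  have c1 : ∀ {x y : ℂ}, ‖x‖ ≤ 1 → ‖y‖ ≤ 1 → ∀ {z : ℂ}, ‖z‖ = 1 →
      1 - (t * (b * c) * (b + c) + t ^ 2 * x * y ^ 2) / a / z ≠ 0 := fun hx hy z hz =>
    one_sub_ne_zero (by rw [n1 hz]; exact h.norm_first_lt hx hy)
  have c3 : ∀ {x z : ℂ}, ‖x‖ ≤ 1 → ‖z‖ ≤ 1 → ∀ {y : ℂ}, ‖y‖ = 1 →
      1 - (t * z * a * (z + a) + t ^ 2 * x) / (b * c) / y ≠ 0 := fun hx hz y hy =>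
    one_sub_ne_zero (by rw [n1 hy]; linarith [h.norm_third_le hx hz])
  have reord : ∀ p q r : ℂ, 1 / (p * q * r) = 1 / p / r / q := by
    intro p q r; rw [div_div, div_div]; congr 1; ring
  have reord' : ∀ p s r : ℂ, 1 / (p * s) / r = 1 / p / r / s := by
    intro p q r; rw [div_div, div_div, div_div]; congr 1; ring
  have c0 : ∀ {y : ℂ}, ‖y‖ ≤ 1 → 1 - t ^ 4 * y ^ 4 / (b * c) / a ≠ 0 := by
    intro y hy h0
    refine h.den_ne (hy.trans (by norm_num : (1 : ℝ) ≤ 3)) ?_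
    have : a - t ^ 4 * y ^ 4 / (b * c) = a * (1 - t ^ 4 * y ^ 4 / (b * c) / a) := by field_simp
    rw [this, h0, mul_zero]
  have step1 : ∀ y z : ℂ, ‖y‖ = 1 → ‖z‖ = 1 → avg (fun x => torusKernel t a b c y z x)
      = 1 / (1 - t ^ 4 * y ^ 4 / (b * c) / a) /
        (1 - (t * z * a * (z + a) + t ^ 2 * solOne t a b c y z) / (b * c) / y)
          / (1 - solThree t a b c y / z) := by
    intro y z hy hz
    have hβ := h.norm_solOne (y := y) (z := z) (by rw [hy]; norm_num) hz.le
    have := avg_div_one_sub (β := solOne t a b c y z)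
      (h := fun x => 1 / (1 - (t * (b * c) * (b + c) + t ^ 2 * x * y ^ 2) / a / z) /
        (1 - (t * z * a * (z + a) + t ^ 2 * x) / (b * c) / y))
      (DifferentiableOn.diffContOnCl fun x hx => by
        have d1 := c1 (hcb hx) hy.le hz
        have d3 := c3 (hcb hx) hz.le hy
        exact DifferentiableAt.differentiableWithinAt (by fun_prop (disch := assumption))) hβ
    simp only [torusKernel]
    refine (avg_congr fun x hx => ?_).trans (this.trans ?_)
    · exact reord _ _ _
    · have hz0 := ne0 hz
      -- After x_1 is eliminated, P_2 is linear in z, so this factor splits into one free of z and 1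
      -- - `solThree`/z.
      have key : 1 - (t * (b * c) * (b + c) + t ^ 2 * solOne t a b c y z * y ^ 2) / a / z
          = (1 - t ^ 4 * y ^ 4 / (b * c) / a) * (1 - solThree t a b c y / z) := by
        have hd := h.den_ne (y := y) (by rw [hy]; norm_num)
        have hx : solThree t a b c y * (a - t ^ 4 * y ^ 4 / (b * c))
          = t * (b * c) * (b + c) + t ^ 2 * y ^ 2 * ((t + t ^ 2 * y ^ 2 * a) / (b * c)) := by
          rw [solThree, div_mul_cancel₀ _ hd]
        rw [solOne]
        field_simp at hx ⊢
        linear_combination hx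
      rw [key]
      exact reord' _ _ _
  have step2 : ∀ y : ℂ, ‖y‖ = 1 → avg (fun z => avg fun x => torusKernel t a b c y z x)
      = 1 / (1 - t ^ 4 * y ^ 4 / (b * c) / a) / (1 - solMap t a b c y / y) := by
    intro y hy
    have hy3 : ‖y‖ ≤ 3 := by rw [hy]; norm_num
    rw [avg_congr fun z hz => step1 y z hy hz]
    refine (avg_div_one_sub (DifferentiableOn.diffContOnCl fun z hz => ?_)
      (h.norm_solThree hy3)).trans rfl
    have d3 := c3 (h.norm_solOne hy3 (hcb hz)).le (hcb hz) hy
    simp only [solOne] at d3 ⊢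
    exact DifferentiableAt.differentiableWithinAt (by fun_prop (disch := assumption))
  rw [avg_congr step2, h.isSmallMap.avg_div_one_sub_div (DifferentiableOn.diffContOnCl fun y hy => ?_)
    hw hfix, h.jac_eq (hw.le.trans (by norm_num))]
  · have d0 := c0 hw.le
    have d1 := h.den_ne (hw.le.trans (by norm_num : (1 : ℝ) ≤ 3))
    have d2 := h.isSmallMap.one_sub_deriv_ne_zero hw.le
    have : 1 - t ^ 4 * w ^ 4 / (b * c) / a = (a - t ^ 4 * w ^ 4 / (b * c)) / a := by field_simp
    rw [this]
    generalize a - t ^ 4 * w ^ 4 / (b * c) = d at *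
    field_simp
  · have d0 := c0 (hcb hy)
    exact DifferentiableAt.differentiableWithinAt (by fun_prop (disch := assumption))

end IsSmallAt

/-! ### The three-form on the torus -/

theorem det_eqsDiff (t : ℂ) (x : Fin 7 → ℂ) (h0 : x 0 = 1) :
    (eqsDiff t x ![Pi.single 1 1, Pi.single 2 1, Pi.single 3 1]).det
      = jac t (x 4) (x 5) (x 6) (x 1) (x 2) (x 3) := by
  rw [jac]
  congr 1
  ext i j
  fin_cases i <;> fin_cases j <;>
  · simp [eqsDiff, eqs, polyDiff, pfaff, pf4, skewN, co, Fin.succAbove, Fin.lt_def,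
      Fin.sum_univ_seven, MvPolynomial.pderiv_X, Pi.single_apply, h0]
    try ring

/-- The first column has the single entry x_0, and by the vanishing hypotheses the remaining block
is lower triangular, with diagonal entries 1 from the frame. -/
theorem det_frame (x : Fin 7 → ℂ) (v : Fin 3 → Fin 7 → ℂ) (hv0 : ∀ k, v k 0 = 0)
    (h05 : v 0 5 = 0) (h06 : v 0 6 = 0) (h16 : v 1 6 = 0) :
    (Matrix.of (Matrix.vecCons x
      (Fin.append ![Pi.single 1 1, Pi.single 2 1, Pi.single 3 1] v))).det
      = x 0 * (v 0 4 * v 1 5 * v 2 6) := by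
  rw [Matrix.det_succ_column_zero, Finset.sum_eq_single 0, Matrix.det_of_isLowerTriangular]
  · rw [Fin.prod_univ_six]
    simp [Fin.append, Fin.addCases]
  · intro i j hij
    fin_cases i <;> fin_cases j <;>
    first
    | exact absurd hij (by decide)
    | simp [Fin.append, Fin.addCases, h05, h06, h16]
  · intro i _ hi
    have : Matrix.vecCons x
      (Fin.append ![Pi.single 1 1, Pi.single 2 1, Pi.single 3 1] v) i 0 = 0 := by
      fin_cases i
      · exact absurd rfl hi
      · simp [Fin.append, Fin.addCases]
      · simp [Fin.append, Fin.addCases]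
      · simp [Fin.append, Fin.addCases]
      · exact hv0 0
      · exact hv0 1
      · exact hv0 2
    rw [Matrix.of_apply, this]
    simp
  · simp

/-- The three factors i from the angular derivatives cancel those in (2πi)^3/(2πi)^6, leaving
(2π)^(-3). -/
theorem alpha_eq (t : ℂ) (x : Fin 7 → ℂ) (v : Fin 3 → Fin 7 → ℂ) (h0 : x 0 = 1)
    (hv0 : ∀ k, v k 0 = 0) (h04 : v 0 4 = Complex.I * x 4) (h05 : v 0 5 = 0) (h06 : v 0 6 = 0)
    (h15 : v 1 5 = Complex.I * x 5) (h16 : v 1 6 = 0) (h26 : v 2 6 = Complex.I * x 6) :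
    alpha t x v = ((2 * Real.pi : ℂ) ^ 3)⁻¹ * (x 4 * (x 5 * x 6) ^ 2 /
      jac t (x 4) (x 5) (x 6) (x 1) (x 2) (x 3)) := by
  have hI : Complex.I ≠ 0 := Complex.I_ne_zero
  have hpi : (Real.pi : ℂ) ≠ 0 := by exact_mod_cast Real.pi_ne_zero
  have hN : MvPolynomial.eval x (skewN t 0 2) = x 5 * x 6 := by simp [skewN, co]
  rw [alpha, residueForm, det_eqsDiff t x h0, omega0, det_frame x v hv0 h05 h06 h16, hN, h0, h04,
    h15, h26]
  generalize jac t (x 4) (x 5) (x 6) (x 1) (x 2) (x 3) = J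
  field_simp

/-- The point with coordinates `ε e^{iθ_k}`. -/
noncomputable def torusPt (ε : ℝ) (θ : Fin 3 → ℝ) (k : Fin 3) : ℂ :=
  ε * Complex.exp (θ k * Complex.I)

theorem norm_torusPt {ε : ℝ} (hε : 0 < ε) (θ : Fin 3 → ℝ) (k : Fin 3) : ‖torusPt ε θ k‖ = ε := by
  rw [torusPt, norm_mul, Complex.norm_exp_ofReal_mul_I, mul_one, Complex.norm_real,
    Real.norm_of_nonneg hε.le]

theorem contDiff_torusPt (ε : ℝ) (k : Fin 3) : ContDiff ℝ 1 fun θ => torusPt ε θ k := by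
  have h1 : ContDiff ℝ 1 fun θ : Fin 3 → ℝ => (θ k : ℂ) :=
    Complex.ofRealCLM.contDiff.comp (contDiff_apply ℝ ℝ k)
  exact contDiff_const.mul (h1.mul contDiff_const).cexp

theorem fderiv_torusPt (ε : ℝ) (θ : Fin 3 → ℝ) (k j : Fin 3) :
    fderiv ℝ (fun θ => torusPt ε θ k) θ (Pi.single j 1)
      = if k = j then Complex.I * torusPt ε θ k else 0 := by
  have h1 : HasFDerivAt (fun θ : Fin 3 → ℝ => (θ k : ℂ))
      (Complex.ofRealCLM.comp (ContinuousLinearMap.proj k)) θ :=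
    (Complex.ofRealCLM.comp (ContinuousLinearMap.proj (R := ℝ) (φ := fun _ : Fin 3 => ℝ) k)).hasFDerivAt
  have h2 := ((h1.mul_const Complex.I).cexp).const_mul (ε : ℂ)
  have h3 : HasFDerivAt (fun θ => torusPt ε θ k) _ θ := h2
  rw [h3.fderiv]
  simp [torusPt, Pi.single_apply]
  split_ifs <;> simp; ring

theorem IsTorusCycle.alpha_fderiv {ε δ : ℝ} {γ : ℂ → (Fin 3 → ℝ) → Fin 7 → ℂ}
    (hγ : IsTorusCycle ε δ γ) {t : ℂ} (ht : t ∈ Metric.ball 0 δ) (θ : Fin 3 → ℝ) :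
    alpha t (γ t θ) (fun k => fderiv ℝ (γ t) θ (Pi.single k 1))
      = ((2 * Real.pi : ℂ) ^ 3)⁻¹ * (torusPt ε θ 0 * (torusPt ε θ 1 * torusPt ε θ 2) ^ 2 /
        jac t (torusPt ε θ 0) (torusPt ε θ 1) (torusPt ε θ 2) (γ t θ 1) (γ t θ 2) (γ t θ 3)) := by
  have hd : DifferentiableAt ℝ (γ t) θ := ((hγ.contDiff t ht).differentiable one_ne_zero) θ
  have hcomp : ∀ (i : Fin 7) (k : Fin 3), fderiv ℝ (γ t) θ (Pi.single k 1) i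
      = fderiv ℝ (fun θ => γ t θ i) θ (Pi.single k 1) := by
    intro i k
    have := (hasFDerivAt_pi'.mp hd.hasFDerivAt) i
    rw [this.fderiv]; rfl
  have e0 : (fun θ => γ t θ 0) = fun _ => 1 := funext (hγ.coord_zero t ht)
  have e4 : (fun θ => γ t θ 4) = fun θ => torusPt ε θ 0 := funext (hγ.coord_four t ht)
  have e5 : (fun θ => γ t θ 5) = fun θ => torusPt ε θ 1 := funext (hγ.coord_five t ht)
  have e6 : (fun θ => γ t θ 6) = fun θ => torusPt ε θ 2 := funext (hγ.coord_six t ht)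
  rw [alpha_eq, congrFun e4, congrFun e5, congrFun e6]
  · exact congrFun e0 θ
  · intro k; rw [hcomp, e0]; simp
  · rw [hcomp, e4, fderiv_torusPt, congrFun e4]; simp
  · rw [hcomp, e5, fderiv_torusPt]; simp
  · rw [hcomp, e6, fderiv_torusPt]; simp
  · rw [hcomp, e5, fderiv_torusPt, congrFun e5]; simp
  · rw [hcomp, e6, fderiv_torusPt]; simp
  · rw [hcomp, e6, fderiv_torusPt, congrFun e6]; simp

/-- The affine equations of a torus cycle. -/
theorem eqs_of_mem_mirrorX {t : ℂ} {x : Fin 7 → ℂ} (h0 : x 0 = 1)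
    (h : ∃ h : x ≠ 0, Projectivization.mk ℂ x h ∈ mirrorX t) :
    x 3 * x 4 - t * (x 5 * x 6) * (x 5 + x 6) - t ^ 2 * x 1 * x 2 ^ 2 = 0 ∧
    x 1 * (x 5 * x 6) - t - t ^ 2 * x 2 ^ 2 * (x 3 + x 4) = 0 ∧
    x 2 * (x 5 * x 6) - t * x 3 * x 4 * (x 3 + x 4) - t ^ 2 * x 1 = 0 := by
  obtain ⟨hne, hm⟩ := h
  rw [mk_mem_mirrorX] at hm
  obtain ⟨-, p1, -, p3, p4⟩ := eval_pfaff t x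
  have q1 := (hm 1).symm.trans p1
  have q3 := (hm 3).symm.trans p3
  have q4 := (hm 4).symm.trans p4
  rw [h0] at q1 q3 q4
  exact ⟨by linear_combination -q1, by linear_combination -q3, by linear_combination -q4⟩

/-- Syzygies of the Pfaffians express x_5 x_6 P_1 and x_5 x_6 P_3 through P_2, P_4 and P_5. -/
theorem mem_mirrorX_of_eqs {t : ℂ} {x : Fin 7 → ℂ} (h0 : x 0 = 1) (hbc : x 5 * x 6 ≠ 0)
    (h1 : x 3 * x 4 - t * (x 5 * x 6) * (x 5 + x 6) - t ^ 2 * x 1 * x 2 ^ 2 = 0)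
    (h2 : x 1 * (x 5 * x 6) - t - t ^ 2 * x 2 ^ 2 * (x 3 + x 4) = 0)
    (h3 : x 2 * (x 5 * x 6) - t * x 3 * x 4 * (x 3 + x 4) - t ^ 2 * x 1 = 0) :
    ∃ h : x ≠ 0, Projectivization.mk ℂ x h ∈ mirrorX t := by
  have hne : x ≠ 0 := fun h => by simp [h] at h0
  refine ⟨hne, (mk_mem_mirrorX t x hne).mpr fun i => ?_⟩
  obtain ⟨p0, p1, p2, p3, p4⟩ := eval_pfaff t x
  rw [h0] at p0 p1 p2 p3 p4
  fin_cases i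
  · refine p0.trans (mul_left_cancel₀ hbc ?_)
    linear_combination t * (x 3 + x 4) * h1 - t * x 1 * h2 + h3
  · exact p1.trans (by linear_combination h1)
  · refine p2.trans (mul_left_cancel₀ hbc ?_)
    linear_combination t * h1 + x 3 * x 4 * h2 - t * x 2 ^ 2 * h3
  · exact p3.trans (by linear_combination h2)
  · exact p4.trans (by linear_combination h3)

/-! ### Existence of the torus cycles -/

theorem IsSmall.isSmallAt {ε : ℝ} {t : ℂ} (h : IsSmall ε t) (θ : Fin 3 → ℝ) :
    IsSmallAt ε t (torusPt ε θ 0) (torusPt ε θ 1) (torusPt ε θ 2) :=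
  { h with
    norm_a := norm_torusPt h.pos θ 0
    norm_b := norm_torusPt h.pos θ 1
    norm_c := norm_torusPt h.pos θ 2 }

/-! ### Smoothness of the solution formulas. -/

section Smooth

variable {E : Type*} [NormedAddCommGroup E] [NormedSpace ℝ E] {t a b c y z : E → ℂ} {e : E}

theorem contDiffAt_div_real (ha : ContDiffAt ℝ 1 a e) (hb : ContDiffAt ℝ 1 b e) (h : b e ≠ 0) :
    ContDiffAt ℝ 1 (fun e => a e / b e) e := by
  simp only [div_eq_mul_inv]
  exact ha.mul (hb.inv h)

theorem contDiffAt_solOne (ht : ContDiffAt ℝ 1 t e) (ha : ContDiffAt ℝ 1 a e)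
    (hb : ContDiffAt ℝ 1 b e) (hc : ContDiffAt ℝ 1 c e) (hy : ContDiffAt ℝ 1 y e)
    (hz : ContDiffAt ℝ 1 z e) (h : b e * c e ≠ 0) :
    ContDiffAt ℝ 1 (fun e => solOne (t e) (a e) (b e) (c e) (y e) (z e)) e := by
  unfold solOne
  exact contDiffAt_div_real (by fun_prop) (by fun_prop) h

theorem contDiffAt_solThree (ht : ContDiffAt ℝ 1 t e) (ha : ContDiffAt ℝ 1 a e)
    (hb : ContDiffAt ℝ 1 b e) (hc : ContDiffAt ℝ 1 c e) (hy : ContDiffAt ℝ 1 y e)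
    (h : b e * c e ≠ 0) (hd : a e - t e ^ 4 * y e ^ 4 / (b e * c e) ≠ 0) :
    ContDiffAt ℝ 1 (fun e => solThree (t e) (a e) (b e) (c e) (y e)) e := by
  unfold solThree
  have h1 : ContDiffAt ℝ 1 (fun e => (t e + t e ^ 2 * y e ^ 2 * a e) / (b e * c e)) e :=
    contDiffAt_div_real (by fun_prop) (by fun_prop) h
  have h2 : ContDiffAt ℝ 1 (fun e => t e ^ 4 * y e ^ 4 / (b e * c e)) e :=
    contDiffAt_div_real (by fun_prop) (by fun_prop) h
  exact contDiffAt_div_real (by fun_prop) (by fun_prop) hd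

theorem contDiffAt_solMap (ht : ContDiffAt ℝ 1 t e) (ha : ContDiffAt ℝ 1 a e)
    (hb : ContDiffAt ℝ 1 b e) (hc : ContDiffAt ℝ 1 c e) (hy : ContDiffAt ℝ 1 y e)
    (h : b e * c e ≠ 0) (hd : a e - t e ^ 4 * y e ^ 4 / (b e * c e) ≠ 0) :
    ContDiffAt ℝ 1 (fun e => solMap (t e) (a e) (b e) (c e) (y e)) e := by
  have h3 := contDiffAt_solThree ht ha hb hc hy h hd
  have h1 := contDiffAt_solOne ht ha hb hc hy h3 h
  unfold solMap
  exact contDiffAt_div_real (by fun_prop) (by fun_prop) h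

end Smooth

/-- The value at `(t, θ)` of the map whose fixed point is the coordinate `x_2` of the cycle. -/
noncomputable def cycleMap (ε : ℝ) (p : ℂ × (Fin 3 → ℝ)) (y : ℂ) : ℂ :=
  solMap p.1 (torusPt ε p.2 0) (torusPt ε p.2 1) (torusPt ε p.2 2) y

open Classical in
/-- A fixed point of `G` in the open unit disc, if there is one. -/
noncomputable def discFixedPoint (G : ℂ → ℂ) : ℂ :=
  if h : ∃ z, ‖z‖ < 1 ∧ G z = z then h.choose else 0

/-- The coordinate `x_2` of the torus cycle. -/
noncomputable def torusTwo (ε : ℝ) (p : ℂ × (Fin 3 → ℝ)) : ℂ :=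
  discFixedPoint (cycleMap ε p)

theorem torusTwo_spec {ε : ℝ} {p : ℂ × (Fin 3 → ℝ)} (h : IsSmall ε p.1) :
    ‖torusTwo ε p‖ < 1 ∧ cycleMap ε p (torusTwo ε p) = torusTwo ε p := by
  have hex : ∃ z, ‖z‖ < 1 ∧ cycleMap ε p z = z := (h.isSmallAt p.2).isSmallMap.exists_fixed
  rw [torusTwo, discFixedPoint, dif_pos hex]
  exact hex.choose_spec

/-- The implicit function theorem for G(y) - y = 0: the partial derivative in y is multiplication by
G' - 1, nonzero by contraction. Although `torusTwo` is defined by choice, uniqueness of the fixed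
point identifies it with the implicit function near p. -/
theorem contDiffAt_torusTwo {ε : ℝ} {p : ℂ × (Fin 3 → ℝ)} (h : ∀ᶠ t in 𝓝 p.1, IsSmall ε t) :
    ContDiffAt ℝ 1 (torusTwo ε) p := by
  have hp := h.self_of_nhds
  have hA := hp.isSmallAt p.2
  obtain ⟨hw, hfix⟩ := torusTwo_spec hp
  set w := torusTwo ε p with hwdef
  let F : (ℂ × (Fin 3 → ℝ)) × ℂ → ℂ := fun q => cycleMap ε q.1 q.2 - q.2
  have htp : ∀ k, ContDiffAt ℝ 1
      (fun q : (ℂ × (Fin 3 → ℝ)) × ℂ => torusPt ε q.1.2 k) (p, w) := fun k =>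
    ((contDiff_torusPt ε k).comp (contDiff_snd.comp contDiff_fst)).contDiffAt
  have hF : ContDiffAt ℝ 1 F (p, w) := by
    refine ContDiffAt.sub ?_ contDiffAt_snd
    exact contDiffAt_solMap (contDiff_fst.comp contDiff_fst).contDiffAt (htp 0) (htp 1) (htp 2)
      contDiffAt_snd (mul_ne_zero hA.b_ne hA.c_ne) (hA.den_ne (hw.le.trans (by norm_num)))
  set d := deriv (cycleMap ε p) w - 1 with hd
  have hd0 : d ≠ 0 := by
    have := hA.isSmallMap.one_sub_deriv_ne_zero hw.le
    intro h0
    apply this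
    change 1 - deriv (cycleMap ε p) w = 0
    linear_combination -h0
  have hder : (fderiv ℝ F (p, w) ∘L .inr ℝ (ℂ × (Fin 3 → ℝ)) ℂ)
      = (ContinuousLinearMap.mul ℝ ℂ) d := by
    have h1 : HasDerivAt (cycleMap ε p) (deriv (cycleMap ε p) w) w :=
      (hA.hasDerivAt_solMap (hA.hasDerivAt_solThree
        (hw.le.trans (by norm_num)))).differentiableAt.hasDerivAt
    have h2 : HasDerivAt (fun y => F (p, y)) d w := h1.sub (hasDerivAt_id w)
    have h3 := h2.hasFDerivAt.restrictScalars ℝ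
    have h4 := (hF.differentiableAt one_ne_zero).hasFDerivAt.comp w
      (hasFDerivAt_prodMk_right p w)
    rw [h4.unique h3]
    ext; simp [mul_comm]
  have hinv : (fderiv ℝ F (p, w) ∘L .inr ℝ (ℂ × (Fin 3 → ℝ)) ℂ).IsInvertible := by
    rw [hder]
    refine ContinuousLinearMap.IsInvertible.of_inverse (g := (ContinuousLinearMap.mul ℝ ℂ) d⁻¹) ?_ ?_
    · ext; simp [hd0]
    · ext; simp [hd0]
  have hψ := hF.contDiffAt_implicitFunction one_ne_zero hinv
  have hψ0 := hF.implicitFunction_apply_self one_ne_zero hinv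
  have hψe := hF.eventually_apply_implicitFunction one_ne_zero hinv
  set ψ := hF.implicitFunction one_ne_zero hinv
  refine hψ.congr_of_eventuallyEq ?_
  have hlt : ∀ᶠ q in 𝓝 p, ‖ψ q‖ < 1 := by
    refine hψ.continuousAt.norm.eventually_lt continuousAt_const ?_
    change ‖ψ p‖ < 1
    rw [show ψ p = w from hψ0]; exact hw
  filter_upwards [hlt, hψe, continuousAt_fst.eventually h] with q hq1 hq2 hq3
  obtain ⟨g1, g2⟩ := torusTwo_spec (p := q) hq3
  have hF0 : F (p, w) = 0 := sub_eq_zero.mpr hfix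
  refine (hq3.isSmallAt q.2).isSmallMap.fixed_unique g1.le hq1.le g2 ?_
  rw [hF0] at hq2
  exact sub_eq_zero.mp hq2

/-- The coordinate `x_3` of the torus cycle. -/
noncomputable def torusThree (ε : ℝ) (p : ℂ × (Fin 3 → ℝ)) : ℂ :=
  solThree p.1 (torusPt ε p.2 0) (torusPt ε p.2 1) (torusPt ε p.2 2) (torusTwo ε p)

/-- The coordinate `x_1` of the torus cycle. -/
noncomputable def torusOne (ε : ℝ) (p : ℂ × (Fin 3 → ℝ)) : ℂ :=
  solOne p.1 (torusPt ε p.2 0) (torusPt ε p.2 1) (torusPt ε p.2 2) (torusTwo ε p) (torusThree ε p)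

/-- The torus cycle. -/
noncomputable def torusCycle (ε : ℝ) (t : ℂ) (θ : Fin 3 → ℝ) : Fin 7 → ℂ :=
  ![1, torusOne ε (t, θ), torusTwo ε (t, θ), torusThree ε (t, θ), torusPt ε θ 0, torusPt ε θ 1,
    torusPt ε θ 2]

theorem contDiffAt_torusCycle {ε : ℝ} {p : ℂ × (Fin 3 → ℝ)} (h : ∀ᶠ t in 𝓝 p.1, IsSmall ε t) :
    ContDiffAt ℝ 1 (fun q : ℂ × (Fin 3 → ℝ) => torusCycle ε q.1 q.2) p := by
  have hp := h.self_of_nhds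
  have hA := hp.isSmallAt p.2
  have h2 := contDiffAt_torusTwo h
  have htp : ∀ k, ContDiffAt ℝ 1 (fun q : ℂ × (Fin 3 → ℝ) => torusPt ε q.2 k) p := fun k =>
    ((contDiff_torusPt ε k).comp contDiff_snd).contDiffAt
  have hbc := mul_ne_zero hA.b_ne hA.c_ne
  have h3 : ContDiffAt ℝ 1 (torusThree ε) p :=
    contDiffAt_solThree contDiffAt_fst (htp 0) (htp 1) (htp 2) h2 hbc
      (hA.den_ne ((torusTwo_spec hp).1.le.trans (by norm_num)))
  have h1 : ContDiffAt ℝ 1 (torusOne ε) p :=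
    contDiffAt_solOne contDiffAt_fst (htp 0) (htp 1) (htp 2) h2 h3 hbc
  refine contDiffAt_pi.mpr fun i => ?_
  fin_cases i
  · exact contDiffAt_const
  · exact h1
  · exact h2
  · exact h3
  · exact htp 0
  · exact htp 1
  · exact htp 2

theorem torusPt_periodic (ε : ℝ) (θ : Fin 3 → ℝ) (k : Fin 3) :
    torusPt ε (θ + Pi.single k (2 * Real.pi)) = torusPt ε θ := by
  ext j
  rw [torusPt, torusPt, Pi.add_apply]
  by_cases h : j = k
  · subst h
    rw [Pi.single_eq_same]
    push_cast
    rw [add_mul, Complex.exp_add, Complex.exp_two_pi_mul_I, mul_one]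
  · rw [Pi.single_eq_of_ne h, add_zero]

theorem cycleMap_zero_left (ε : ℝ) (θ : Fin 3 → ℝ) (y : ℂ) : cycleMap ε (0, θ) y = 0 := by
  simp [cycleMap, solMap]

theorem isTorusCycle_torusCycle {ε δ : ℝ} (hδ : 0 < δ)
    (h : ∀ t ∈ Metric.ball (0 : ℂ) δ, IsSmall ε t) : IsTorusCycle ε δ (torusCycle ε) where
  continuousOn := fun q hq =>
    (contDiffAt_torusCycle (mem_of_superset (Metric.isOpen_ball.mem_nhds hq.1)
      h)).continuousAt.continuousWithinAt
  contDiff := fun t ht => contDiff_iff_contDiffAt.mpr fun θ =>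
    (contDiffAt_torusCycle (p := (t, θ)) (mem_of_superset (Metric.isOpen_ball.mem_nhds ht)
      h)).comp θ (contDiffAt_const.prodMk contDiffAt_id)
  periodic := fun t _ θ k => by
    -- The chosen fixed point depends on the map alone, so equal maps at shifted angles give the
    -- same choice.
    have e : cycleMap ε (t, θ + Pi.single k (2 * Real.pi)) = cycleMap ε (t, θ) := by
      ext y
      simp only [cycleMap, torusPt_periodic]
    have e2 : torusTwo ε (t, θ + Pi.single k (2 * Real.pi)) = torusTwo ε (t, θ) := by
      rw [torusTwo, torusTwo, e]
    simp only [torusCycle, torusOne, torusThree, e2, torusPt_periodic]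
  coord_zero := fun _ _ _ => rfl
  coord_four := fun _ _ _ => rfl
  coord_five := fun _ _ _ => rfl
  coord_six := fun _ _ _ => rfl
  initial := fun θ => by
    have hs := (torusTwo_spec (p := (0, θ)) (h 0 (Metric.mem_ball_self hδ))).2
    rw [cycleMap_zero_left] at hs
    exact ⟨by simp [torusCycle, torusOne, solOne], hs.symm,
      by simp [torusCycle, torusThree, solThree]⟩
  mem := fun t ht θ => by
    have hA := (h t ht).isSmallAt θ
    obtain ⟨hw, hfix⟩ := torusTwo_spec (p := (t, θ)) (h t ht)
    obtain ⟨h1, h2, h3⟩ := (hA.solution_iff (hw.le.trans (by norm_num : (1 : ℝ) ≤ 3))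
      (z := torusThree ε (t, θ)) (x := torusOne ε (t, θ))).mpr ⟨hfix, rfl, rfl⟩
    exact mem_mirrorX_of_eqs (x := torusCycle ε t θ) rfl (mul_ne_zero hA.b_ne hA.c_ne) h1 h2 h3

theorem exists_isTorusCycle {ε : ℝ} (hε : 0 < ε) :
    ∃ δ : ℝ, 0 < δ ∧ ∃ γ, IsTorusCycle ε δ γ := by
  obtain ⟨δ, hδ, h⟩ := Metric.eventually_nhds_iff_ball.mp (eventually_isSmall hε)
  exact ⟨δ, hδ, _, isTorusCycle_torusCycle hδ h⟩

/-! ### The multinomial series -/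

/-- Triples of natural numbers, sorted by their sum. -/
def sigmaPiAntidiagEquiv :
    (Σ n : ℕ, {κ // κ ∈ Finset.piAntidiag (Finset.univ : Finset (Fin 3)) n}) ≃ (Fin 3 → ℕ) where
  toFun s := s.2.1
  invFun κ := ⟨∑ i, κ i, κ, by simp⟩
  left_inv := by
    rintro ⟨n, κ, h⟩
    obtain rfl : ∑ i, κ i = n := (Finset.mem_piAntidiag.mp h).1
    rfl
  right_inv _ := rfl

/-- A term of the multinomial series. -/
noncomputable def multiTerm (x : Fin 3 → ℂ) (κ : Fin 3 → ℕ) : ℂ :=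
  (Nat.multinomial Finset.univ κ : ℂ) * ∏ i, x i ^ κ i

theorem summable_norm_multiTerm {x : Fin 3 → ℂ} (h : ∑ i, ‖x i‖ < 1) :
    Summable fun κ => ‖multiTerm x κ‖ := by
  set f : (Fin 3 → ℕ) → ℝ := fun κ => ‖multiTerm x κ‖ with hf
  have hn : ∀ n, HasSum (fun c : {κ // κ ∈ Finset.piAntidiag (Finset.univ : Finset (Fin 3)) n} =>
      f c) ((∑ i, ‖x i‖) ^ n) := by
    intro n
    have h1 : (∑ i, ‖x i‖) ^ n
        = ∑ κ ∈ Finset.piAntidiag (Finset.univ : Finset (Fin 3)) n, f κ := by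
      rw [Finset.sum_pow_eq_sum_piAntidiag]
      simp [hf, multiTerm, norm_prod]
    rw [h1]
    exact Finset.hasSum (Finset.piAntidiag (Finset.univ : Finset (Fin 3)) n) f
  have h0 : ∀ s, 0 ≤ (f ∘ sigmaPiAntidiagEquiv) s := fun s => norm_nonneg _
  rw [← sigmaPiAntidiagEquiv.summable_iff]
  refine (summable_sigma_of_nonneg h0).mpr ⟨fun n => (hn n).summable, ?_⟩
  exact (summable_geometric_of_lt_one (by positivity) h).congr fun n => (hn n).tsum_eq.symm

/-- The geometric series with each power expanded by the multinomial theorem; absolute convergence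
permits the regrouping. -/
theorem hasSum_multiTerm {x : Fin 3 → ℂ} (h : ∑ i, ‖x i‖ < 1) :
    HasSum (multiTerm x) (1 - ∑ i, x i)⁻¹ := by
  have hs : ‖∑ i, x i‖ < 1 := (norm_sum_le _ _).trans_lt h
  rw [← sigmaPiAntidiagEquiv.hasSum_iff]
  refine HasSum.sigma_of_hasSum (hasSum_geometric_of_norm_lt_one hs) (fun n => ?_)
    (sigmaPiAntidiagEquiv.summable_iff.mpr (summable_norm_multiTerm h).of_norm)
  rw [Finset.sum_pow_eq_sum_piAntidiag]
  exact Finset.hasSum (Finset.piAntidiag (Finset.univ : Finset (Fin 3)) n) (multiTerm x)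

theorem HasSum.sum_piAntidiag {f : (Fin 3 → ℕ) → ℂ} {s : ℂ} (h : HasSum f s) :
    HasSum (fun n => ∑ κ ∈ Finset.piAntidiag (Finset.univ : Finset (Fin 3)) n, f κ) s :=
  ((sigmaPiAntidiagEquiv.hasSum_iff).mpr h).sigma fun n =>
    Finset.hasSum (Finset.piAntidiag (Finset.univ : Finset (Fin 3)) n) f

/-- The triples of exponents that contribute to the constant term. -/
def contrib (κ : Fin 3 → ℕ) : (Fin 3 → ℕ) × (Fin 3 → ℕ) × (Fin 3 → ℕ) :=
  (![κ 0 + κ 1 + κ 2, κ 0 + κ 1 + κ 2, κ 0], κ, ![κ 0 + κ 2, κ 0 + κ 1, κ 1 + κ 2])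

theorem contrib_injective : Function.Injective contrib := fun κ κ' h => by
  simp only [contrib, Prod.mk.injEq] at h
  exact h.2.1

/-- The product of three multinomial coefficients. -/
def tripleMultinomial (i : (Fin 3 → ℕ) × (Fin 3 → ℕ) × (Fin 3 → ℕ)) : ℕ :=
  Nat.multinomial Finset.univ i.1 * (Nat.multinomial Finset.univ i.2.1
    * Nat.multinomial Finset.univ i.2.2)

theorem cast_multinomial_three (a b c : ℕ) :
    (Nat.multinomial Finset.univ ![a, b, c] : ℚ)
      = (a + b + c).factorial / (a.factorial * b.factorial * c.factorial) := by
  have h1 := Nat.multinomial_spec Finset.univ ![a, b, c]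
  rw [Fin.prod_univ_three, Fin.sum_univ_three] at h1
  simp only [Matrix.cons_val_zero, Matrix.cons_val_one, Matrix.cons_val] at h1
  rw [eq_div_iff (by positivity), mul_comm]
  exact_mod_cast h1

/-- Vandermonde's identity, as k + p.2 = (k + m) - p.1. The terms with first index above m vanish.
-/
theorem sum_choose_mul_choose (k m : ℕ) :
    ∑ p ∈ Finset.HasAntidiagonal.antidiagonal m, m.choose p.1 * (k + m + k).choose (k + p.2)
      = (2 * (k + m)).choose (k + m) := by
  have h := Nat.add_choose_eq m (k + m + k) (k + m)
  rw [Finset.Nat.sum_antidiagonal_eq_sum_range_succ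
    (f := fun i j => m.choose i * (k + m + k).choose j)] at h
  rw [show 2 * (k + m) = m + (k + m + k) by ring, h, Finset.Nat.sum_antidiagonal_eq_sum_range_succ
    (f := fun i j => m.choose i * (k + m + k).choose (k + j))]
  refine (Finset.sum_congr rfl fun i hi => ?_).trans
    (Finset.sum_subset (Finset.range_mono (by omega)) fun i _ hi => ?_)
  · rw [Finset.mem_range] at hi
    congr 2
    omega
  · rw [Finset.mem_range] at hi
    rw [Nat.choose_eq_zero_of_lt (by omega), zero_mul]

theorem tripleMultinomial_contrib (k p q : ℕ) :
    tripleMultinomial (contrib ![k, p, q])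
      = (2 * (k + p + q) + k).choose (k + p + q) * (2 * (k + p + q)).choose (k + p + q)
        * (k + p + q).choose k ^ 2 * ((p + q).choose p * (k + (p + q) + k).choose (k + q)) := by
  have e1 := Nat.cast_add_choose ℚ (a := (k + p + q)) (b := (k + p + q + k))
  have e2 := Nat.cast_add_choose ℚ (a := (k + p + q)) (b := (k + p + q))
  have e3 := Nat.cast_add_choose ℚ (a := k) (b := (p + q))
  have e4 := Nat.cast_add_choose ℚ (a := p) (b := q)
  have e5 := Nat.cast_add_choose ℚ (a := (k + q)) (b := (k + p))
  have f1 := cast_multinomial_three (k + p + q) (k + p + q) k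
  have f2 := cast_multinomial_three k p q
  have f3 := cast_multinomial_three (k + q) (k + p) (p + q)
  have hM : tripleMultinomial (contrib ![k, p, q])
    = Nat.multinomial Finset.univ ![k + p + q, k + p + q, k]
      * (Nat.multinomial Finset.univ ![k, p, q]
        * Nat.multinomial Finset.univ ![k + q, k + p, p + q]) := rfl
  rw [hM]
  rw [← Nat.cast_inj (R := ℚ)]
  rw [show 2 * (k + p + q) + k = k + p + q + (k + p + q + k) by ring,
    show 2 * (k + p + q) = k + p + q + (k + p + q) by ring,
    show k + (p + q) + k = k + q + (k + p) by ring]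
  push_cast
  rw [f1, f2, f3, e1, e2, e4, e5]
  rw [show (k + p + q).choose k = (k + (p + q)).choose k by rw [add_assoc], e3,
    show k + p + q + (k + p + q) + k = k + p + q + (k + p + q + k) by ring,
    show k + q + (k + p) + (p + q) = k + p + q + (k + p + q) by ring,
    show k + q + (k + p) = k + p + q + k by ring, ← add_assoc k p q]
  field_simp

/-- Write κ = (k, p, q) and fix k. The sum over p + q = n - k is Vandermonde's and supplies the
second factor C(2n, n). -/
theorem sum_tripleMultinomial (n : ℕ) :
    ∑ κ ∈ Finset.piAntidiag (Finset.univ : Finset (Fin 3)) n, tripleMultinomial (contrib κ)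
      = periodCoeff n := by
  have h1 : ∑ κ ∈ Finset.piAntidiag (Finset.univ : Finset (Fin 3)) n, tripleMultinomial (contrib κ)
      = ∑ s ∈ (Finset.HasAntidiagonal.antidiagonal n).sigma fun km => Finset.HasAntidiagonal.antidiagonal km.2,
          tripleMultinomial (contrib ![s.1.1, s.2.1, s.2.2]) := by
    refine Finset.sum_nbij' (fun κ => ⟨(κ 0, κ 1 + κ 2), (κ 1, κ 2)⟩)
      (fun s => ![s.1.1, s.2.1, s.2.2]) ?_ ?_ ?_ ?_ ?_
    · intro κ hκ
      rw [Finset.mem_piAntidiag, Fin.sum_univ_three] at hκ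
      simp; omega
    · rintro ⟨⟨k, m⟩, p, q⟩ hs
      simp at hs
      simp [Fin.sum_univ_three]; omega
    · intro κ _
      ext i; fin_cases i <;> rfl
    · rintro ⟨⟨k, m⟩, p, q⟩ hs
      simp at hs
      obtain ⟨h1, rfl⟩ := hs
      rfl
    · intro κ _
      congr 2
      ext i; fin_cases i <;> rfl
  rw [h1, Finset.sum_sigma, periodCoeff, Finset.mul_sum,
    Finset.Nat.sum_antidiagonal_eq_sum_range_succ_mk]
  refine Finset.sum_congr rfl fun k hk => ?_
  rw [Finset.mem_range] at hk
  obtain ⟨m, rfl⟩ : ∃ m, n = k + m := ⟨n - k, by omega⟩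
  simp only [Nat.add_sub_cancel_left]
  calc _ = ∑ p ∈ Finset.HasAntidiagonal.antidiagonal m, (2 * (k + m) + k).choose (k + m)
        * (2 * (k + m)).choose (k + m) * (k + m).choose k ^ 2
        * (m.choose p.1 * (k + m + k).choose (k + p.2)) := by
        refine Finset.sum_congr rfl ?_
        rintro ⟨p, q⟩ hp
        rw [Finset.HasAntidiagonal.mem_antidiagonal] at hp
        simp only at hp
        subst hp
        rw [tripleMultinomial_contrib, add_assoc k p q]
    _ = _ := by
        rw [← Finset.mul_sum, sum_choose_mul_choose]; ring

/-! ### The expansion of the kernel -/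

/-- The index set of the expansion of the kernel. -/
abbrev TripleIndex : Type := (Fin 3 → ℕ) × (Fin 3 → ℕ) × (Fin 3 → ℕ)

/-- The exponent of `t` in a term of the expansion. -/
def degT (i : TripleIndex) : ℕ :=
  i.1 0 + i.1 1 + 2 * i.1 2 + (i.2.1 0 + 2 * i.2.1 1 + 2 * i.2.1 2)
    + (i.2.2 0 + i.2.2 1 + 2 * i.2.2 2)

/-- The exponent of `x_1`. -/
def expOne (i : TripleIndex) : ℤ :=
  (i.1 2 + i.2.2 2 : ℕ) - (i.2.1 0 + i.2.1 1 + i.2.1 2 : ℕ)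

/-- The exponent of `x_2`. -/
def expTwo (i : TripleIndex) : ℤ :=
  (2 * i.1 2 + 2 * i.2.1 1 + 2 * i.2.1 2 : ℕ) - (i.2.2 0 + i.2.2 1 + i.2.2 2 : ℕ)

/-- The exponent of `x_3`. -/
def expThree (i : TripleIndex) : ℤ :=
  (i.2.1 1 + 2 * i.2.2 0 + i.2.2 1 : ℕ) - (i.1 0 + i.1 1 + i.1 2 : ℕ)

/-- The exponent of `x_4`. -/
def expFour (i : TripleIndex) : ℤ :=
  (i.2.1 2 + i.2.2 0 + 2 * i.2.2 1 : ℕ) - (i.1 0 + i.1 1 + i.1 2 : ℕ)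

/-- The exponent of `x_5`. -/
def expFive (i : TripleIndex) : ℤ :=
  (2 * i.1 0 + i.1 1 : ℕ)
    - (i.2.1 0 + i.2.1 1 + i.2.1 2 + (i.2.2 0 + i.2.2 1 + i.2.2 2) : ℕ)

/-- The exponent of `x_6`. -/
def expSix (i : TripleIndex) : ℤ :=
  (i.1 0 + 2 * i.1 1 : ℕ)
    - (i.2.1 0 + i.2.1 1 + i.2.1 2 + (i.2.2 0 + i.2.2 1 + i.2.2 2) : ℕ)

/-- The coefficient of a term of the expansion. -/
noncomputable def termCoeff (t : ℂ) (i : TripleIndex) : ℂ :=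
  (tripleMultinomial i : ℂ) * t ^ degT i

/-- A term of the expansion. -/
noncomputable def kernelTerm (t a b c y z x : ℂ) (i : TripleIndex) : ℂ :=
  termCoeff t i * (a ^ expFour i * b ^ expFive i * c ^ expSix i) * y ^ expTwo i * z ^ expThree i
    * x ^ expOne i

theorem kernelTerm_eq {t a b c y z x : ℂ} (ha : a ≠ 0) (hb : b ≠ 0) (hc : c ≠ 0) (hy : y ≠ 0)
    (hz : z ≠ 0) (hx : x ≠ 0) (i : TripleIndex) :
    multiTerm ![t * b ^ 2 * c / (z * a), t * b * c ^ 2 / (z * a), t ^ 2 * x * y ^ 2 / (z * a)] i.1 *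
      (multiTerm ![t / (x * b * c), t ^ 2 * y ^ 2 * z / (x * b * c),
          t ^ 2 * y ^ 2 * a / (x * b * c)] i.2.1 *
        multiTerm ![t * z ^ 2 * a / (y * b * c), t * z * a ^ 2 / (y * b * c),
          t ^ 2 * x / (y * b * c)] i.2.2)
      = kernelTerm t a b c y z x i := by
  obtain ⟨i, j, k⟩ := i
  simp only [kernelTerm, termCoeff, tripleMultinomial, multiTerm, Fin.prod_univ_three, degT, expOne,
    expTwo, expThree, expFour, expFive, expSix, zpow_sub₀ ha, zpow_sub₀ hb, zpow_sub₀ hc,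
    zpow_sub₀ hx, zpow_sub₀ hy, zpow_sub₀ hz, zpow_natCast, Matrix.cons_val_zero,
    Matrix.cons_val_one, Matrix.cons_val]
  push_cast
  simp only [div_eq_mul_inv, mul_inv, ← inv_pow]
  -- With the inverses as independent variables, this is an identity of monomials with natural
  -- exponents.
  generalize a⁻¹ = a', b⁻¹ = b', c⁻¹ = c', x⁻¹ = x', y⁻¹ = y', z⁻¹ = z'
  ring

/-- The bound for the terms of the expansion on the torus. -/
noncomputable def termBound (ε : ℝ) (t : ℂ) (i : TripleIndex) : ℝ :=
  ‖termCoeff t i‖ * (ε ^ expFour i * ε ^ expFive i * ε ^ expSix i)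

namespace IsSmallAt

variable {ε : ℝ} {t a b c : ℂ}

theorem norm_kernelTerm (h : IsSmallAt ε t a b c) {x y z : ℂ} (hx : ‖x‖ = 1) (hy : ‖y‖ = 1)
    (hz : ‖z‖ = 1) (i : TripleIndex) : ‖kernelTerm t a b c y z x i‖ = termBound ε t i := by
  simp [kernelTerm, termBound, hx, hy, hz, h.norm_a, h.norm_b, h.norm_c]

/-- The conditions `fst`, `one` and `map` of `IsSmall` bound the norms of the monomials in the three
denominators by a total below 1, so the three multinomial series converge absolutely and can be
multiplied. -/
theorem hasSum_kernelTerm (h : IsSmallAt ε t a b c) {x y z : ℂ} (hx : ‖x‖ = 1) (hy : ‖y‖ = 1)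
    (hz : ‖z‖ = 1) : HasSum (kernelTerm t a b c y z x) (torusKernel t a b c y z x) ∧
      Summable (termBound ε t) := by
  have ha := h.a_ne
  have hb := h.b_ne
  have hc := h.c_ne
  have h0 := h.pos
  have hx0 : x ≠ 0 := by rintro rfl; simp at hx
  have hy0 : y ≠ 0 := by rintro rfl; simp at hy
  have hz0 : z ≠ 0 := by rintro rfl; simp at hz
  have hτ := norm_nonneg t
  have b1 : ∑ i, ‖(![t * b ^ 2 * c / (z * a), t * b * c ^ 2 / (z * a),
      t ^ 2 * x * y ^ 2 / (z * a)] : Fin 3 → ℂ) i‖ < 1 := by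
    refine lt_of_eq_of_lt ?_ h.fst
    simp [Fin.sum_univ_three, hx, hy, hz, h.norm_a, h.norm_b, h.norm_c]
    field_simp
    ring
  have b2 : ∑ i, ‖(![t / (x * b * c), t ^ 2 * y ^ 2 * z / (x * b * c),
      t ^ 2 * y ^ 2 * a / (x * b * c)] : Fin 3 → ℂ) i‖ < 1 := by
    refine lt_of_le_of_lt ?_ h.one
    simp [Fin.sum_univ_three, hx, hy, hz, h.norm_a, h.norm_b, h.norm_c]
    rw [← add_div, ← add_div, ← sq]
    refine div_le_div_of_nonneg_right ?_ (by positivity)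
    nlinarith [sq_nonneg ‖t‖, mul_nonneg (sq_nonneg ‖t‖) h0.le]
  have b3 : ∑ i, ‖(![t * z ^ 2 * a / (y * b * c), t * z * a ^ 2 / (y * b * c),
      t ^ 2 * x / (y * b * c)] : Fin 3 → ℂ) i‖ < 1 := by
    refine lt_of_eq_of_lt ?_ (h.map.trans (by norm_num))
    simp [Fin.sum_univ_three, hx, hy, hz, h.norm_a, h.norm_b, h.norm_c]
    field_simp
  have n23 := (summable_norm_multiTerm b2).mul_norm (summable_norm_multiTerm b3)
  have n123 := (summable_norm_multiTerm b1).mul_norm n23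
  have s := (hasSum_multiTerm b1).mul
    ((hasSum_multiTerm b2).mul (hasSum_multiTerm b3) n23.of_norm) n123.of_norm
  have e := fun i => kernelTerm_eq (t := t) ha hb hc hy0 hz0 hx0 i
  refine ⟨?_, n123.congr fun i => ?_⟩
  · convert! s using 1
    · exact funext fun i => (e i).symm
    · rw [torusKernel, solOne, one_div, mul_inv, mul_inv, mul_assoc]
      simp only [Fin.sum_univ_three, Matrix.cons_val_zero, Matrix.cons_val_one, Matrix.cons_val]
      congr 2
      · congr 2
        field_simp
      · congr 2
        field_simp
        ring
      · congr 2
        field_simp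
  · exact (congrArg norm (e i)).trans (h.norm_kernelTerm hx hy hz i)

/-- The averages of the kernel over the circles `|x_1| = |x_2| = |x_3| = 1`. -/
theorem hasSum_avg_avg_avg (h : IsSmallAt ε t a b c) :
    HasSum (fun i => termCoeff t i * (a ^ expFour i * b ^ expFive i * c ^ expSix i)
        * (if expTwo i = 0 then 1 else 0) * (if expThree i = 0 then 1 else 0)
        * (if expOne i = 0 then 1 else 0))
      (avg fun y => avg fun z => avg fun x => torusKernel t a b c y z x) := by
  have hsum : Summable (termBound ε t) :=
    (h.hasSum_kernelTerm (x := 1) (y := 1) (z := 1) (by simp) (by simp) (by simp)).2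
  have hpow : ∀ n : ℤ, ContinuousOn (fun z : ℂ => z ^ n) (Metric.sphere 0 1) := fun n =>
    continuousOn_id.zpow₀ n fun z hz => Or.inl (by rintro rfl; simp at hz)
  have hite : ∀ p : Prop, [Decidable p] → ‖(if p then 1 else 0 : ℂ)‖ ≤ 1 := by
    intro p _; split_ifs <;> simp
  have hK : ∀ i, ‖termCoeff t i * (a ^ expFour i * b ^ expFive i * c ^ expSix i)‖
      = termBound ε t i := by
    intro i
    simp [termBound, h.norm_a, h.norm_b, h.norm_c]
  have hB : ∀ i, 0 ≤ termBound ε t i := fun i => hK i ▸ norm_nonneg _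
  have step1 : ∀ y z : ℂ, ‖y‖ = 1 → ‖z‖ = 1 →
      HasSum (fun i => termCoeff t i * (a ^ expFour i * b ^ expFive i * c ^ expSix i)
        * y ^ expTwo i * z ^ expThree i * (if expOne i = 0 then 1 else 0))
        (avg fun x => torusKernel t a b c y z x) := by
    intro y z hy hz
    have := hasSum_avg (g := fun i x => kernelTerm t a b c y z x i)
      (fun i => continuousOn_const.mul (hpow _)) hsum
      (fun i x hx => (h.norm_kernelTerm hx hy hz i).le)
      (fun x hx => (h.hasSum_kernelTerm hx hy hz).1)
    simpa only [kernelTerm, avg_const_mul, avg_zpow] using this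
  have step2 : ∀ y : ℂ, ‖y‖ = 1 →
      HasSum (fun i => termCoeff t i * (a ^ expFour i * b ^ expFive i * c ^ expSix i)
        * y ^ expTwo i * (if expThree i = 0 then 1 else 0) * (if expOne i = 0 then 1 else 0))
        (avg fun z => avg fun x => torusKernel t a b c y z x) := by
    intro y hy
    have := hasSum_avg (g := fun i z => termCoeff t i
        * (a ^ expFour i * b ^ expFive i * c ^ expSix i) * y ^ expTwo i * z ^ expThree i
        * (if expOne i = 0 then 1 else 0)) (fun i => (continuousOn_const.mul (hpow _)).mul continuousOn_const) hsum
      (fun i z hz => by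
        rw [norm_mul, norm_mul, norm_mul, hK, norm_zpow, norm_zpow, hy, hz, one_zpow, one_zpow,
          mul_one, mul_one]
        exact mul_le_of_le_one_right (hB i) (hite _))
      (fun z hz => step1 y z hy hz)
    simpa only [avg_mul_const, avg_const_mul, avg_zpow] using this
  have := hasSum_avg (g := fun i y => termCoeff t i
        * (a ^ expFour i * b ^ expFive i * c ^ expSix i) * y ^ expTwo i
        * (if expThree i = 0 then 1 else 0) * (if expOne i = 0 then 1 else 0))
      (fun i => ((continuousOn_const.mul (hpow _)).mul continuousOn_const).mul
      continuousOn_const) hsum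
    (fun i y hy => by
      rw [norm_mul, norm_mul, norm_mul, hK, norm_zpow, hy, one_zpow, mul_one]
      exact (mul_le_of_le_one_right (mul_nonneg (hB i) (norm_nonneg _)) (hite _)).trans
        (mul_le_of_le_one_right (hB i) (hite _)))
    (fun y hy => step2 y hy)
  simpa only [avg_mul_const, avg_const_mul, avg_zpow] using this

end IsSmallAt

/-! ### The integral over the torus -/

theorem integral_circle_zpow (ε : ℝ) (n : ℤ) :
    ∫ s in Set.Icc 0 (2 * Real.pi), ((ε : ℂ) * Complex.exp (s * Complex.I)) ^ n
      = if n = 0 then (2 * Real.pi : ℂ) else 0 := by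
  have hpi : (Real.pi : ℂ) ≠ 0 := by exact_mod_cast Real.pi_ne_zero
  have h := avg_zpow n
  rw [avg, Real.circleAverage_def] at h
  have h1 : ∫ θ in (0 : ℝ)..2 * Real.pi, (circleMap 0 1 θ) ^ n
      = if n = 0 then (2 * Real.pi : ℂ) else 0 := by
    rw [inv_smul_eq_iff₀ (by positivity)] at h
    rw [h]
    split_ifs <;> simp
  rw [MeasureTheory.integral_Icc_eq_integral_Ioc,
    ← intervalIntegral.integral_of_le (by positivity)]
  simp only [mul_zpow]
  rw [intervalIntegral.integral_const_mul]
  have h2 : ∀ s : ℝ, Complex.exp (s * Complex.I) = circleMap 0 1 s := by simp [circleMap]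
  simp only [h2, h1]
  split_ifs with hn <;> simp [hn]

theorem integral_torusPt_zpow (ε : ℝ) (l m n : ℤ) :
    ∫ θ in Set.Icc (0 : Fin 3 → ℝ) (fun _ => 2 * Real.pi),
        torusPt ε θ 0 ^ l * torusPt ε θ 1 ^ m * torusPt ε θ 2 ^ n
      = (2 * Real.pi : ℂ) ^ 3 * (if l = 0 ∧ m = 0 ∧ n = 0 then 1 else 0) := by
  have h1 : Set.Icc (0 : Fin 3 → ℝ) (fun _ => 2 * Real.pi)
      = Set.univ.pi fun _ => Set.Icc 0 (2 * Real.pi) := (Set.pi_univ_Icc _ _).symm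
  have h2 := MeasureTheory.integral_fintype_prod_eq_prod (𝕜 := ℂ)
    (μ := fun _ : Fin 3 => (MeasureTheory.volume : MeasureTheory.Measure ℝ).restrict
      (Set.Icc 0 (2 * Real.pi)))
    (fun k (s : ℝ) => ((ε : ℂ) * Complex.exp (s * Complex.I)) ^ (![l, m, n] k))
  rw [h1, MeasureTheory.volume_pi, MeasureTheory.Measure.restrict_pi_pi]
  simp only [Fin.prod_univ_three] at h2
  refine h2.trans ?_
  rw [integral_circle_zpow, integral_circle_zpow, integral_circle_zpow]
  simp only [Matrix.cons_val_zero, Matrix.cons_val_one, Matrix.cons_val]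
  by_cases hl : l = 0 <;> by_cases hm : m = 0 <;> by_cases hn : n = 0 <;> simp [hl, hm, hn]
  ring

theorem degT_contrib (κ : Fin 3 → ℕ) : degT (contrib κ) = 7 * ∑ i, κ i := by
  simp [degT, contrib, Fin.sum_univ_three]; ring

/-- Six linear equations in nine unknowns: the middle triple is free and determines the other two.
-/
theorem mem_range_contrib (i : TripleIndex) (h1 : expOne i = 0) (h2 : expTwo i = 0)
    (h3 : expThree i = 0) (h4 : expFour i = 0) (h5 : expFive i = 0) (h6 : expSix i = 0) :
    i ∈ Set.range contrib := by
  obtain ⟨i, j, k⟩ := i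
  simp only [expOne, expTwo, expThree, expFour, expFive, expSix] at h1 h2 h3 h4 h5 h6
  refine ⟨j, ?_⟩
  rw [contrib, Prod.mk.injEq, Prod.mk.injEq]
  refine ⟨?_, rfl, ?_⟩
  · ext s; fin_cases s <;> simp <;> omega
  · ext s; fin_cases s <;> simp <;> omega

theorem exp_contrib (κ : Fin 3 → ℕ) :
    expOne (contrib κ) = 0 ∧ expTwo (contrib κ) = 0 ∧ expThree (contrib κ) = 0 ∧
      expFour (contrib κ) = 0 ∧ expFive (contrib κ) = 0 ∧ expSix (contrib κ) = 0 := by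
  simp only [expOne, expTwo, expThree, expFour, expFive, expSix, contrib, Matrix.cons_val_zero,
    Matrix.cons_val_one, Matrix.cons_val]
  omega

/-- The integral of the averaged kernel over the torus is the period series. -/
theorem IsSmall.hasSum_integral {ε : ℝ} {t : ℂ} (h : IsSmall ε t) :
    HasSum (fun n : ℕ => (periodCoeff n : ℂ) * t ^ (7 * n))
      (∫ θ in Set.Icc (0 : Fin 3 → ℝ) (fun _ => 2 * Real.pi), ((2 * Real.pi : ℂ) ^ 3)⁻¹ *
        avg fun y => avg fun z => avg fun x =>
          torusKernel t (torusPt ε θ 0) (torusPt ε θ 1) (torusPt ε θ 2) y z x) := by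
  have hpi : (Real.pi : ℂ) ≠ 0 := by exact_mod_cast Real.pi_ne_zero
  have hsum : Summable (termBound ε t) :=
    ((h.isSmallAt 0).hasSum_kernelTerm (x := 1) (y := 1) (z := 1) (by simp) (by simp) (by simp)).2
  set δ : TripleIndex → ℂ := fun i => (if expTwo i = 0 then 1 else 0)
    * (if expThree i = 0 then 1 else 0) * (if expOne i = 0 then 1 else 0) with hδ
  have hδ1 : ∀ i, ‖δ i‖ ≤ 1 := by
    intro i
    simp only [hδ]
    split_ifs <;> simp
  have hne : ∀ θ k, torusPt ε θ k ≠ 0 := fun θ k =>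
    norm_pos_iff.mp (by rw [norm_torusPt h.pos]; exact h.pos)
  have hcont : ∀ k (n : ℤ), Continuous fun θ => torusPt ε θ k ^ n := fun k n =>
    (contDiff_torusPt ε k).continuous.zpow₀ n fun θ => Or.inl (hne θ k)
  have hfin : MeasureTheory.IsFiniteMeasure (MeasureTheory.volume.restrict
      (Set.Icc (0 : Fin 3 → ℝ) (fun _ => 2 * Real.pi))) :=
    MeasureTheory.isFiniteMeasure_restrict.mpr isCompact_Icc.measure_lt_top.ne
  have key := MeasureTheory.hasSum_integral_of_dominated_convergence
    (μ := MeasureTheory.volume.restrict (Set.Icc (0 : Fin 3 → ℝ) (fun _ => 2 * Real.pi)))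
    (F := fun i θ => termCoeff t i * (torusPt ε θ 0 ^ expFour i * torusPt ε θ 1 ^ expFive i
      * torusPt ε θ 2 ^ expSix i) * δ i)
    (f := fun θ => avg fun y => avg fun z => avg fun x =>
      torusKernel t (torusPt ε θ 0) (torusPt ε θ 1) (torusPt ε θ 2) y z x)
    (fun i _ => termBound ε t i)
    (fun i => ((continuous_const.mul (((hcont 0 _).mul (hcont 1 _)).mul (hcont 2 _))).mul
      continuous_const).aestronglyMeasurable)
    (fun i => Eventually.of_forall fun θ => by
      have hb : ‖termCoeff t i * (torusPt ε θ 0 ^ expFour i * torusPt ε θ 1 ^ expFive i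
          * torusPt ε θ 2 ^ expSix i)‖ = termBound ε t i := by
        simp [termBound, norm_torusPt h.pos]
      rw [norm_mul, hb]
      exact mul_le_of_le_one_right (hb ▸ norm_nonneg _) (hδ1 i))
    (Eventually.of_forall fun _ => hsum)
    (MeasureTheory.integrable_const _)
    (Eventually.of_forall fun θ => by
      simpa only [hδ, mul_assoc] using (h.isSmallAt θ).hasSum_avg_avg_avg)
  have key2 := key.mul_left ((2 * Real.pi : ℂ) ^ 3)⁻¹
  rw [MeasureTheory.integral_const_mul]
  simp only [MeasureTheory.integral_mul_const, MeasureTheory.integral_const_mul,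
    integral_torusPt_zpow] at key2
  -- Only the terms with all six exponents zero survive, and these form the range of `contrib`.
  -- Grouping them by |κ| = n then collects the power t^(7n).
  rw [← contrib_injective.hasSum_iff] at key2
  · convert! key2.sum_piAntidiag using 1
    ext n
    rw [← sum_tripleMultinomial n]
    push_cast
    rw [Finset.sum_mul]
    refine Finset.sum_congr rfl fun κ hκ => ?_
    obtain ⟨h1, h2, h3, h4, h5, h6⟩ := exp_contrib κ
    have hn : ∑ i, κ i = n := (Finset.mem_piAntidiag.mp hκ).1
    simp only [Function.comp_apply, hδ, h1, h2, h3, h4, h5, h6, termCoeff, degT_contrib, hn]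
    simp
    field_simp
  · intro i hi
    by_cases hd : expTwo i = 0 ∧ expThree i = 0 ∧ expOne i = 0
    · have h456 : ¬ (expFour i = 0 ∧ expFive i = 0 ∧ expSix i = 0) := fun ⟨h4, h5, h6⟩ =>
        hi (mem_range_contrib i hd.2.2 hd.1 hd.2.1 h4 h5 h6)
      rw [if_neg h456, mul_zero, mul_zero, zero_mul, mul_zero]
    · have h0 : δ i = 0 := by
        simp only [not_and_or] at hd
        simp only [hδ]
        rcases hd with h | h | h <;> simp [h]
      rw [h0, mul_zero, mul_zero]

/-- At t = 0 the coordinate x_2 is zero, and the box of angles is compact. The bound forces x_2 to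
be the unique fixed point in the disc, so the period does not depend on the chosen family. -/
theorem IsTorusCycle.eventually_norm_lt {ε δ : ℝ} {γ : ℂ → (Fin 3 → ℝ) → Fin 7 → ℂ} (hδ : 0 < δ)
    (hγ : IsTorusCycle ε δ γ) :
    ∀ᶠ t in 𝓝 (0 : ℂ), ∀ θ ∈ Set.Icc (0 : Fin 3 → ℝ) (fun _ => 2 * Real.pi), ‖γ t θ 2‖ < 1 := by
  refine isCompact_Icc.eventually_forall_of_forall_eventually fun θ _ => ?_
  have hc : ContinuousAt (fun q : ℂ × (Fin 3 → ℝ) => γ q.1 q.2) (0, θ) :=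
    hγ.continuousOn.continuousAt
      (prod_mem_nhds (Metric.ball_mem_nhds 0 hδ) univ_mem)
  have h2 : ContinuousAt (fun q : ℂ × (Fin 3 → ℝ) => ‖γ q.1 q.2 2‖) (0, θ) :=
    ((continuous_apply 2).continuousAt.comp hc).norm
  exact h2.eventually_lt continuousAt_const (by simp [(hγ.initial θ).2.1])

/-- The period is the value of its series. -/
theorem IsTorusCycle.hasSum_period {ε δ : ℝ} {γ : ℂ → (Fin 3 → ℝ) → Fin 7 → ℂ} (hε : 0 < ε)
    (hδ : 0 < δ) (hγ : IsTorusCycle ε δ γ) : ∀ᶠ t in 𝓝 (0 : ℂ),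
      HasSum (fun n : ℕ => (periodCoeff n : ℂ) * t ^ (7 * n)) (period t (γ t)) := by
  filter_upwards [hγ.eventually_norm_lt hδ, eventually_isSmall hε, Metric.ball_mem_nhds 0 hδ]
    with t hlt hs ht
  convert! hs.hasSum_integral using 1
  refine MeasureTheory.setIntegral_congr_fun measurableSet_Icc fun θ hθ => ?_
  have hw := hlt θ hθ
  have hA := hs.isSmallAt θ
  have hq := eqs_of_mem_mirrorX (hγ.coord_zero t ht θ) (hγ.mem t ht θ)
  have e4 : γ t θ 4 = torusPt ε θ 0 := hγ.coord_four t ht θ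
  have e5 : γ t θ 5 = torusPt ε θ 1 := hγ.coord_five t ht θ
  have e6 : γ t θ 6 = torusPt ε θ 2 := hγ.coord_six t ht θ
  rw [e4, e5, e6, hA.solution_iff (hw.le.trans (by norm_num))] at hq
  obtain ⟨hfix, h3, h1⟩ := hq
  rw [hγ.alpha_fderiv ht θ, hA.avg_avg_avg_torusKernel hw hfix, h1, h3]

/-! ### The period as a function of `t ^ 7` -/

/-- Here 512 = 4² · 8 · 4, from C(2n, n) ≤ 4^n, C(2n+k, n) ≤ 8^n for k ≤ n, and Σ C(n, k)² = C(2n,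
n) ≤ 4^n. -/
theorem periodCoeff_le (n : ℕ) : periodCoeff n ≤ 512 ^ n := by
  have h1 : (2 * n).choose n ≤ 4 ^ n := by
    have := Nat.choose_le_two_pow (2 * n) n
    rwa [pow_mul] at this
  have h2 : ∑ k ∈ Finset.range (n + 1), (2 * n + k).choose n * n.choose k ^ 2
      ≤ 8 ^ n * 4 ^ n := by
    calc _ ≤ ∑ k ∈ Finset.range (n + 1), 8 ^ n * n.choose k ^ 2 := by
          refine Finset.sum_le_sum fun k hk => Nat.mul_le_mul_right _ ?_
          rw [Finset.mem_range] at hk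
          calc (2 * n + k).choose n ≤ 2 ^ (2 * n + k) := Nat.choose_le_two_pow _ _
            _ ≤ 2 ^ (3 * n) := Nat.pow_le_pow_right (by norm_num) (by omega)
            _ = 8 ^ n := by rw [pow_mul]; norm_num
      _ = 8 ^ n * (2 * n).choose n := by rw [← Finset.mul_sum, Nat.sum_range_choose_sq]
      _ ≤ _ := Nat.mul_le_mul_left _ h1
  calc periodCoeff n ≤ (4 ^ n) ^ 2 * (8 ^ n * 4 ^ n) :=
        Nat.mul_le_mul (Nat.pow_le_pow_left h1 2) h2
    _ = 512 ^ n := by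
        rw [← mul_pow, ← pow_mul, mul_comm n 2, pow_mul, ← mul_pow]; norm_num

/-- The period as a function of `φ = t ^ 7`. -/
noncomputable def periodFun (φ : ℂ) : ℂ := ∑' n : ℕ, (periodCoeff n : ℂ) * φ ^ n

theorem eventually_hasSum_periodFun :
    ∀ᶠ φ in 𝓝 (0 : ℂ), HasSum (fun n : ℕ => (periodCoeff n : ℂ) * φ ^ n) (periodFun φ) := by
  filter_upwards [Metric.ball_mem_nhds (0 : ℂ) (show (0 : ℝ) < 1 / 512 by norm_num)] with φ hφ
  rw [mem_ball_zero_iff] at hφ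
  refine Summable.hasSum (Summable.of_norm_bounded
    (summable_geometric_of_lt_one (r := 512 * ‖φ‖) (by positivity) (by linarith)) fun n => ?_)
  rw [norm_mul, norm_pow, Complex.norm_natCast, mul_pow]
  gcongr
  exact_mod_cast periodCoeff_le n

theorem mainTheorem2 (ε : ℝ) (hε : 0 < ε) :
    (∃ δ : ℝ, 0 < δ ∧ ∃ γ, IsTorusCycle ε δ γ) ∧
    (∀ (δ : ℝ) (γ : ℂ → (Fin 3 → ℝ) → Fin 7 → ℂ), 0 < δ → IsTorusCycle ε δ γ →
      (∀ᶠ t in 𝓝 (0 : ℂ),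
        HasSum (fun n : ℕ => (periodCoeff n : ℂ) * t ^ (7 * n)) (period t (γ t))) ∧
      ∃ Φ : ℂ → ℂ, AnalyticAt ℂ Φ 0 ∧
        (∀ᶠ φ in 𝓝 (0 : ℂ), HasSum (fun n : ℕ => (periodCoeff n : ℂ) * φ ^ n) (Φ φ)) ∧
        (∀ᶠ t in 𝓝 (0 : ℂ), period t (γ t) = Φ (t ^ 7)) ∧
        opD.natDegree = 4 ∧ IsPicardFuchs opD Φ) ∧
    (∀ s t : ℂ, s ^ 7 = t ^ 7 →
      ∃ g : (Fin 7 → ℂ) ≃ₗ[ℂ] (Fin 7 → ℂ),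
        Projectivization.map g.toLinearMap g.injective '' mirrorX s = mirrorX t) := by
  refine ⟨exists_isTorusCycle hε, fun δ γ hδ hγ => ?_, exists_equiv_image_mirrorX⟩
  have hper := hγ.hasSum_period hε hδ
  obtain ⟨hA, hT⟩ := taylorSeries_of_hasSum eventually_hasSum_periodFun
  refine ⟨hper, periodFun, hA, eventually_hasSum_periodFun, ?_, natDegree_opD,
    isPicardFuchs_opD hA hT⟩
  have hpow : Tendsto (fun t : ℂ => t ^ 7) (𝓝 0) (𝓝 0) := by
    simpa using (continuous_pow 7).tendsto (0 : ℂ)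
  filter_upwards [hper, hpow.eventually eventually_hasSum_periodFun] with t h1 h2
  refine h1.unique ?_
  simpa only [pow_mul] using h2
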